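/- By a one-vertex affine 2-complex we mean a (not necessarily finite) 2-complex with exactly one vertex whose 2-cells are convex Euclidean polygons, each side of a polygon being identified affinely with a 1-cell. A circle-valued Morse function on such a complex $X$ is a continuous map $f\colon X\to S^1=\mathbb R/\mathbb Z$, sending the vertex to the base point, such that on each cell $f$ lifts through the characteristic map to an affine real-valued function that is non-constant if the cell has positive dimension. The ascending (resp. descending) link of the vertex is the subgraph of its link formed by the ends of 1-cells and the corners of 2-cells at which this lift attains its minimum (resp. maximum). For a 1-cell $e$ let $f_*([e])\in\pi_1(S^1)=\mathbb Z$ be the class of the loop $f|_e$. **Theorem.** Let $K_1,K_2$ be one-vertex affine 2-complexes with circle-valued Morse functions $f_j\colon K_j\to S^1$ whose ascending and descending links are trees. Let $a_0,a_1$ be 1-cells of $K_1$ and $b_0,b_1$ be 1-cells of $K_2$ (repetitions allowed), put $\alpha_i=f_{1*}([a_i])$ and $\beta_i=f_{2*}([b_i])$, and suppose $|\alpha_0|+|\beta_1|=|\alpha_1|+|\beta_0|$. Orient $a_0,a_1$ so that $f_1$ increases along them and $b_0,b_1$ so that $f_2$ increases along them. Let $\sigma,\tau\in\{1,-1\}$,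 and let $K$ be obtained from the wedge $K_1\vee K_2$ (the two vertices being identified) by attaching a square 2-cell along $a_0^{\sigma}b_1^{\tau}a_1^{-\sigma}b_0^{-\tau}$. Then: (i) $\pi_1(K)$ is free-by-cyclic, i.e. there is an epimorphism $\pi_1(K)\to\mathbb Z$ with free kernel; if $K_1$ and $K_2$ have finitely many 1-cells, then $\pi_1(K)\cong F_k\rtimes\mathbb Z$ with $F_k$ free of some finite rank $k$. (ii) If all 2-cells of $K_1$ and $K_2$ are Euclidean squares (or, more generally, parallelograms), or if $|\alpha_0|=|\alpha_1|$, then $\pi_1(K)$ maps onto $\mathbb Z^2$. -/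

import Mathlib

/-! ## Convex polygons -/

/-- A convex polygon in the plane with `extra + 3 ≥ 3` sides, its vertices listed counterclockwise:
every vertex which is not an end of the side from `vertex i` to `vertex (i + 1)` lies strictly to
the left of that side. Indices are cyclic. (Only the affine structure and the topology of the plane
are used below, so the plane is taken to be `ℝ × ℝ`.) -/
structure ConvexPolygon where
  extra : ℕ
  vertex : Fin (extra + 3) → ℝ × ℝ
  convex : ∀ i j : Fin (extra + 3), j ≠ i → j ≠ i + 1 →
    0 < ((vertex (i + 1)).1 - (vertex i).1) * ((vertex j).2 - (vertex i).2)
      - ((vertex (i + 1)).2 - (vertex i).2) * ((vertex j).1 - (vertex i).1)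

namespace ConvexPolygon

/-- The (cyclic) index set of the vertices; `i` also indexes the side from vertex `i` to vertex
`i + 1`. -/
abbrev Index (P : ConvexPolygon) : Type := Fin (P.extra + 3)

/-- The closed polygonal region. -/
def region (P : ConvexPolygon) : Set (ℝ × ℝ) := convexHull ℝ (Set.range P.vertex)

theorem vertex_mem (P : ConvexPolygon) (i : P.Index) : P.vertex i ∈ P.region :=
  subset_convexHull ℝ _ ⟨i, rfl⟩

/-- The affine parametrization of the `i`-th side by `[0, 1]`. -/
def side (P : ConvexPolygon) (i : P.Index) (t : unitInterval) : P.region :=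
  ⟨AffineMap.lineMap (P.vertex i) (P.vertex (i + 1)) (t : ℝ),
    (convex_convexHull ℝ _).lineMap_mem (P.vertex_mem i) (P.vertex_mem (i + 1)) t.2⟩

/-- The polygon is a parallelogram; in particular every Euclidean square or rectangle is one. -/
def IsParallelogram (P : ConvexPolygon) : Prop :=
  ∃ h : P.extra = 1,
    P.vertex (Fin.cast (by rw [h]) (0 : Fin 4)) + P.vertex (Fin.cast (by rw [h]) (2 : Fin 4)) =
      P.vertex (Fin.cast (by rw [h]) (1 : Fin 4)) + P.vertex (Fin.cast (by rw [h]) (3 : Fin 4))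

/-- The unit square. -/
def unitSquare : ConvexPolygon where
  extra := 1
  vertex := ![(0, 0), (1, 0), (1, 1), (0, 1)]
  convex := by
    intro i j
    fin_cases i <;> fin_cases j <;> simp

end ConvexPolygon

/-! ## One-vertex affine 2-complexes -/

/-- An affine 2-complex with exactly one vertex, with `1`-cells indexed by `E` and `2`-cells indexed
by `F`: every `2`-cell is a convex polygon, and each of its sides is identified affinely with a
`1`-cell. `(e, true)` stands for the `1`-cell `e` with its given orientation and `(e, false)` for `e`
with the opposite orientation; `bdry c i` is the oriented `1`-cell read along the `i`-th side of
`c`. -/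
structure OneVertexComplex (E : Type*) (F : Type*) where
  polygon : F → ConvexPolygon
  bdry : ∀ c : F, (polygon c).Index → E × Bool

namespace OneVertexComplex

universe u v u₁ v₁ u₂ v₂

variable {E : Type u} {F : Type v}

/-- The disjoint union of the closed cells: one point, an interval for every `1`-cell, and a convex
polygon for every `2`-cell. -/
abbrev Cells (K : OneVertexComplex E F) : Type (max u v) :=
  PUnit.{1} ⊕ (Σ _ : E, unitInterval) ⊕ (Σ c : F, (K.polygon c).region)

/-- The point at time `t` of the oriented `1`-cell `x`. -/
def edgePoint (K : OneVertexComplex E F) (x : E × Bool) (t : unitInterval) : K.Cells :=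
  Sum.inr (Sum.inl ⟨x.1, if x.2 then t else unitInterval.symm t⟩)

/-- The gluing of the cells: both ends of each `1`-cell are glued to the vertex, and each side of
each polygon is glued to its oriented `1`-cell. -/
inductive Glue (K : OneVertexComplex E F) : K.Cells → K.Cells → Prop
  | start (e : E) : Glue K (Sum.inr (Sum.inl ⟨e, 0⟩)) (Sum.inl PUnit.unit)
  | finish (e : E) : Glue K (Sum.inr (Sum.inl ⟨e, 1⟩)) (Sum.inl PUnit.unit)
  | side (c : F) (i : (K.polygon c).Index) (t : unitInterval) :
      Glue K (Sum.inr (Sum.inr ⟨c, (K.polygon c).side i t⟩)) (K.edgePoint (K.bdry c i) t)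

/-- The topological space of the complex: the quotient of the disjoint union of the closed cells by
the gluing, with the quotient topology. -/
abbrev Space (K : OneVertexComplex E F) : Type (max u v) := Quot K.Glue

/-- The unique vertex. -/
def point (K : OneVertexComplex E F) : K.Space := Quot.mk _ (Sum.inl PUnit.unit)

/-- The characteristic map of a `1`-cell. -/
def edgeMap (K : OneVertexComplex E F) (e : E) (t : unitInterval) : K.Space :=
  Quot.mk _ (Sum.inr (Sum.inl ⟨e, t⟩))

/-- The characteristic map of a `2`-cell. -/
def cellMap (K : OneVertexComplex E F) (c : F) (x : (K.polygon c).region) : K.Space :=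
  Quot.mk _ (Sum.inr (Sum.inr ⟨c, x⟩))

/-- The fundamental group of the complex, based at its vertex. -/
abbrev Pi1 (K : OneVertexComplex E F) : Type (max u v) := FundamentalGroup K.Space K.point

/-- All 2-cells are parallelograms (for instance Euclidean squares). -/
def IsSquared (K : OneVertexComplex E F) : Prop := ∀ c : F, (K.polygon c).IsParallelogram

/-! ### The link of the vertex

The vertices of the link are the ends of the `1`-cells: `(e, true)` is the initial end of `e` and
`(e, false)` its terminal end. The edges of the link are the corners of the `2`-cells. -/

/-- The corners of the `2`-cells. -/
abbrev Corner (K : OneVertexComplex E F) : Type v := Σ c : F, (K.polygon c).Index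

/-- The two ends of the edge of the link given by a corner. At the corner `i` of the polygon `c`, the
side `i` leaves the vertex and the side `i - 1` arrives at it. -/
def cornerEnds (K : OneVertexComplex E F) (x : K.Corner) : Sym2 (E × Bool) :=
  s(K.bdry x.1 x.2, ((K.bdry x.1 (x.2 - 1)).1, !(K.bdry x.1 (x.2 - 1)).2))

/-- The subgraph of the link with vertex set `V` and edge set `C` is a tree: it has no loop, no two
edges with the same pair of ends, and the resulting simple graph is a tree (in particular it is
non-empty). -/
def LinkTree (K : OneVertexComplex E F) (V : Set (E × Bool)) (C : Set K.Corner) : Prop :=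
  (∀ x ∈ C, ¬ (K.cornerEnds x).IsDiag) ∧ Set.InjOn K.cornerEnds C ∧
    ((SimpleGraph.fromEdgeSet (K.cornerEnds '' C)).induce V).IsTree

/-! ### Circle-valued Morse functions -/

/-- A circle-valued Morse function on the complex: a continuous map to `S¹ = ℝ / ℤ` taking the vertex
to the base point, which lifts to a Morse function between universal covers. The latter means that
for every cell the composite with the characteristic map lifts to an affine function to `ℝ`, not
constant on cells of positive dimension. (For a 2-cell, being non-constant follows from its
sides being non-constant. As there is a single vertex, the image of the `0`-skeleton of the universal
cover lies in `ℤ`, so it is discrete.) These affine lifts are unique up to an integer. -/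
structure MorseMap (K : OneVertexComplex E F) where
  toMap : C(K.Space, UnitAddCircle)
  map_point : toMap K.point = 0
  edgeLift : E → (ℝ →ᵃ[ℝ] ℝ)
  edgeLift_spec : ∀ e (t : unitInterval), ((edgeLift e t : ℝ) : UnitAddCircle) = toMap (K.edgeMap e t)
  edgeLift_nonconst : ∀ e, edgeLift e 0 ≠ edgeLift e 1
  cellLift : F → ((ℝ × ℝ) →ᵃ[ℝ] ℝ)
  cellLift_spec : ∀ c (x : (K.polygon c).region),
    ((cellLift c x : ℝ) : UnitAddCircle) = toMap (K.cellMap c x)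

namespace MorseMap

variable {K : OneVertexComplex E F}

/-- The image `f_*([e])` of the loop `e` in `π₁(S¹) = ℤ`: the total change of a lift along `e`. -/
def degree (f : K.MorseMap) (e : E) : ℝ := f.edgeLift e 1 - f.edgeLift e 0

/-- The degree of a `1`-cell is an integer. -/
theorem degree_int (f : K.MorseMap) (e : E) : ∃ n : ℤ, f.degree e = n := by
  have h0 := f.edgeLift_spec e 0
  have h1 := f.edgeLift_spec e 1
  have g0 : K.edgeMap e 0 = K.point := Quot.sound (Glue.start e)
  have g1 : K.edgeMap e 1 = K.point := Quot.sound (Glue.finish e)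
  rw [g0, f.map_point] at h0
  rw [g1, f.map_point] at h1
  have h : ((f.degree e : ℝ) : UnitAddCircle) = 0 := by
    have h0' : ((f.edgeLift e 0 : ℝ) : UnitAddCircle) = 0 := by simpa using h0
    have h1' : ((f.edgeLift e 1 : ℝ) : UnitAddCircle) = 0 := by simpa using h1
    rw [degree, AddCircle.coe_sub, h0', h1', sub_zero]
  obtain ⟨n, hn⟩ := (AddCircle.coe_eq_zero_iff (1 : ℝ)).1 h
  exact ⟨n, by rw [← hn]; simp⟩

/-- The point `0` or `1` of `[0, 1]` at which an end of a `1`-cell is located. -/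
def endTime (b : Bool) : ℝ := if b then 0 else 1

/-- Vertices of the ascending link: the ends of `1`-cells at which the lift is minimal. -/
def ascVertices (f : K.MorseMap) : Set (E × Bool) :=
  {x | ∀ t : unitInterval, f.edgeLift x.1 (endTime x.2) ≤ f.edgeLift x.1 t}

/-- Vertices of the descending link: the ends of `1`-cells at which the lift is maximal. -/
def descVertices (f : K.MorseMap) : Set (E × Bool) :=
  {x | ∀ t : unitInterval, f.edgeLift x.1 t ≤ f.edgeLift x.1 (endTime x.2)}

/-- Edges of the ascending link: the corners of `2`-cells at which the lift is minimal. -/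
def ascCorners (f : K.MorseMap) : Set K.Corner :=
  {x | ∀ y ∈ (K.polygon x.1).region, f.cellLift x.1 ((K.polygon x.1).vertex x.2) ≤ f.cellLift x.1 y}

/-- Edges of the descending link: the corners of `2`-cells at which the lift is maximal. -/
def descCorners (f : K.MorseMap) : Set K.Corner :=
  {x | ∀ y ∈ (K.polygon x.1).region, f.cellLift x.1 y ≤ f.cellLift x.1 ((K.polygon x.1).vertex x.2)}

/-- The ascending link is a tree. -/
def AscendingLinkTree (f : K.MorseMap) : Prop := K.LinkTree f.ascVertices f.ascCorners

/-- The descending link is a tree. -/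
def DescendingLinkTree (f : K.MorseMap) : Prop := K.LinkTree f.descVertices f.descCorners

/-- The `1`-cell `e`, traversed in the direction in which `f` increases if `s = true`, and in the
direction in which `f` decreases if `s = false`. -/
noncomputable def letter (f : K.MorseMap) (s : Bool) (e : E) : E × Bool :=
  (e, decide (0 < f.degree e) == s)

end MorseMap

/-! ### Wedges and attached squares -/

/-- The wedge of two one-vertex complexes: the disjoint union with the two vertices identified. -/
def wedge {E₁ : Type u₁} {F₁ : Type v₁} {E₂ : Type u₂} {F₂ : Type v₂}
    (K₁ : OneVertexComplex E₁ F₁) (K₂ : OneVertexComplex E₂ F₂) :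
    OneVertexComplex (E₁ ⊕ E₂) (F₁ ⊕ F₂) where
  polygon := Sum.elim K₁.polygon K₂.polygon
  bdry
    | Sum.inl c, i => ((Sum.inl (K₁.bdry c i).1), (K₁.bdry c i).2)
    | Sum.inr c, i => ((Sum.inr (K₂.bdry c i).1), (K₂.bdry c i).2)

/-- Attach one more `2`-cell, a square whose sides read the word `w`. -/
def attachSquare (K : OneVertexComplex E F) (w : Fin 4 → E × Bool) :
    OneVertexComplex E (Option F) where
  polygon c := c.elim ConvexPolygon.unitSquare K.polygon
  bdry
    | none, i => w i
    | some c, i => K.bdry c i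

/-- An oriented `1`-cell of `K₁`, seen in a wedge `K₁ ∨ K₂`. -/
def inLeft {E₁ : Type u₁} {E₂ : Type u₂} (x : E₁ × Bool) : (E₁ ⊕ E₂) × Bool := (Sum.inl x.1, x.2)

/-- An oriented `1`-cell of `K₂`, seen in a wedge `K₁ ∨ K₂`. -/
def inRight {E₁ : Type u₁} {E₂ : Type u₂} (x : E₂ × Bool) : (E₁ ⊕ E₂) × Bool := (Sum.inr x.1, x.2)

/-- The wedge of `K₁` and `K₂` with a square attached along `a₀^{±1} b₁^{±1} a₁^{∓1} b₀^{∓1}`. Here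
`s` chooses whether `a₀` is traversed in the increasing or in the decreasing direction of `f₁`, and
`a₁` is traversed in the opposite way; similarly for `t`, `b₁`, `b₀` and `f₂`. -/
noncomputable def squareAmalgam {E₁ : Type u₁} {F₁ : Type v₁} {E₂ : Type u₂} {F₂ : Type v₂}
    {K₁ : OneVertexComplex E₁ F₁} {K₂ : OneVertexComplex E₂ F₂}
    (f₁ : K₁.MorseMap) (f₂ : K₂.MorseMap) (a₀ a₁ : E₁) (b₀ b₁ : E₂) (s t : Bool) :
    OneVertexComplex (E₁ ⊕ E₂) (Option (F₁ ⊕ F₂)) :=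
  (wedge K₁ K₂).attachSquare
    ![inLeft (f₁.letter s a₀), inRight (f₂.letter t b₁),
      inLeft (f₁.letter (!s) a₁), inRight (f₂.letter (!t) b₀)]

end OneVertexComplex

/-! ## Free-by-cyclic groups -/

/-- `G` is free-by-(infinite cyclic): an extension of `ℤ` by a free group, of any rank. -/
def IsFreeByCyclic (G : Type*) [Group G] : Prop :=
  ∃ φ : G →* Multiplicative ℤ, Function.Surjective φ ∧ IsFreeGroup φ.ker

/-- `G` is isomorphic to a semidirect product `F_k ⋊ ℤ` with `F_k` free of finite rank `k`. -/
def IsFinFreeByCyclic (G : Type*) [Group G] : Prop :=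
  ∃ (k : ℕ) (θ : Multiplicative ℤ →* MulAut (FreeGroup (Fin k))),
    Nonempty (G ≃* FreeGroup (Fin k) ⋊[θ] Multiplicative ℤ)

/-! The fundamental group is presented by the 1-cells and the boundary words of the 2-cells
(`pi1Equiv`), so the theorem becomes one about the group `CellGroup`. The degrees of a Morse
function respect every boundary word and define a height homomorphism to ℤ. Dividing by the common
factor of the degrees makes it onto (`exists_surjective_height`).

Free kernel: in the infinite cyclic covering given by the height, the 1-cells lift to `E × ℤ` and
the relators to `F × ℤ`. Each lifted 2-cell has one strictly highest and one strictly lowest corner.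
These corners are the edges of the descending and the ascending link. Rooting the two trees matches
the 2-cells bijectively with the non-root 1-cells, each edge going to its child end. A lifted
relator whose cell lies in levels ≥ 0 is solved for the child at its top corner, any other for the
child at its bottom corner. With lifts ordered by their distance from level 0 and then by depth in
the tree, the selected letter exceeds all others of its word (`rank_var_lt`), and no letter is
selected twice (`sel_injective`). The lifted relators thus form a `TriangularSystem`: values in any
group can be prescribed freely on the unselected lifts and determine the rest. This is the universal
property making the action groupoid on the levels free (`isFreeGroupoid`), and the height kernel is
one of its vertex groups (`isFreeGroup_ker`).

Finite rank: unselected lifts are lifts of the two roots or lie in a band near level 0. A section of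
the height adapted to the roots makes the former contribute trivially, and the band is finite when
there are finitely many 1-cells (`fg_ker`).

The square: after replacing each Morse function by its negative if necessary, the attached word
climbs along `a₀` and `b₁` and descends along `a₁` and `b₀`. The equation on degrees closes it up,
so its only lowest corner lies between `a₀` and `b₀` and its only highest corner between `b₁` and
`a₁`. Each link of the wedge is a disjoint union of two trees, and the square adds exactly one edge
joining them. Hence the links are again trees (`exists_amalgam`) and the argument above applies to
the whole complex.

Maps onto ℤ²: if `|α₀| = |α₁|`, the two heights extend separately by zero
(`exists_surjective_of_balanced`). If all cells are parallelograms, opposite sides have opposite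
degrees, so every odd function of the degree gives a homomorphism. Odd functions supported on a
single absolute value then separate `a₀` from `a₁` (`exists_surjective_of_squared`). -/

namespace ConvexPolygon

/-! ### Convex polygons as cones over their boundary -/

variable (P : ConvexPolygon)

/-- The planar cross product. -/
def cross (p q : ℝ × ℝ) : ℝ := p.1 * q.2 - p.2 * q.1

/-- The affine function which vanishes on the line of the side `i` and is positive to its left. -/
def sideFun (i : P.Index) (x : ℝ × ℝ) : ℝ := cross (P.vertex (i + 1) - P.vertex i) (x - P.vertex i)

theorem index_one_ne_zero : (1 : P.Index) ≠ 0 := by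
  simp

theorem index_two_ne_zero : (1 + 1 : P.Index) ≠ 0 := by
  simp only [ne_eq, Fin.ext_iff, Fin.val_add, Fin.val_one, Fin.val_zero]
  rw [Nat.mod_eq_of_lt (by omega)]
  omega

theorem succ_ne (i : P.Index) : i + 1 ≠ i := fun h => P.index_one_ne_zero (by simp at h)

theorem pred_ne (i : P.Index) : i - 1 ≠ i := fun h => P.index_one_ne_zero (by simp at h)

theorem succ_succ_ne (i : P.Index) : i + 1 + 1 ≠ i := fun h =>
  P.index_two_ne_zero (by simpa [add_assoc] using h)

theorem pred_ne_succ (i : P.Index) : i - 1 ≠ i + 1 := fun h => by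
  apply P.succ_succ_ne i
  rw [← h, sub_add_cancel]

theorem sideFun_pos {i j : P.Index} (h₀ : j ≠ i) (h₁ : j ≠ i + 1) : 0 < P.sideFun i (P.vertex j) := by
  have := P.convex i j h₀ h₁
  simpa [sideFun, cross] using this

theorem sideFun_left (i : P.Index) : P.sideFun i (P.vertex i) = 0 := by
  simp [sideFun, cross]

theorem sideFun_right (i : P.Index) : P.sideFun i (P.vertex (i + 1)) = 0 := by
  simp [sideFun, cross]; ring

theorem sideFun_vertex_nonneg (i j : P.Index) : 0 ≤ P.sideFun i (P.vertex j) := by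
  by_cases h₀ : j = i
  · rw [h₀, sideFun_left]
  by_cases h₁ : j = i + 1
  · rw [h₁, sideFun_right]
  exact (P.sideFun_pos h₀ h₁).le

theorem sideFun_comb (i : P.Index) (x y : ℝ × ℝ) {a b : ℝ} (h : a + b = 1) :
    P.sideFun i (a • x + b • y) = a * P.sideFun i x + b * P.sideFun i y := by
  obtain rfl : a = 1 - b := by linarith
  simp [sideFun, cross]; ring

theorem sideFun_nonneg (i : P.Index) {x : ℝ × ℝ} (hx : x ∈ P.region) : 0 ≤ P.sideFun i x := by
  have hc : Convex ℝ {x | 0 ≤ P.sideFun i x} := by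
    intro x hx y hy a b ha hb hab
    simp only [Set.mem_ofPred_eq] at hx hy ⊢
    rw [P.sideFun_comb i x y hab]
    positivity
  refine convexHull_min ?_ hc hx
  rintro _ ⟨j, rfl⟩
  exact P.sideFun_vertex_nonneg i j

theorem vertex_succ_ne (i : P.Index) : P.vertex (i + 1) ≠ P.vertex i := by
  intro h
  have := P.sideFun_pos (P.succ_succ_ne i) (P.succ_ne (i + 1))
  rw [sideFun, h] at this
  simp [cross] at this

/-- The barycentre of the vertices. -/
noncomputable def center : ℝ × ℝ := ((P.extra : ℝ) + 3)⁻¹ • ∑ i, P.vertex i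

theorem card_pos : (0 : ℝ) < (P.extra : ℝ) + 3 := by positivity

theorem card_smul_center : ((P.extra : ℝ) + 3) • P.center = ∑ i, P.vertex i := by
  rw [center, smul_inv_smul₀ P.card_pos.ne']

theorem center_mem : P.center ∈ P.region := by
  rw [center, Finset.smul_sum]
  refine (convex_convexHull ℝ _).sum_mem (fun _ _ => inv_nonneg.2 P.card_pos.le) ?_
    (fun i _ => P.vertex_mem i)
  have := P.card_pos.ne'
  simp [this]

/-- The vectors from the barycentre to the vertices add up to zero. This feeds `exists_sign_change`,
which finds two consecutive rays from the centre with `x` between them. -/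
theorem sum_cross_center (x : ℝ × ℝ) : ∑ i, cross (P.vertex i - P.center) (x - P.center) = 0 := by
  have h := P.card_smul_center
  have h₁ := congrArg Prod.fst h
  have h₂ := congrArg Prod.snd h
  rw [Prod.fst_sum] at h₁
  rw [Prod.snd_sum] at h₂
  simp only [Prod.smul_fst, Prod.smul_snd, smul_eq_mul] at h₁ h₂
  simp only [cross, Prod.fst_sub, Prod.snd_sub, Finset.sum_sub_distrib, ← Finset.sum_mul, ← h₁, ← h₂]
  simp

theorem sum_sideFun (i : P.Index) :
    ∑ j, P.sideFun i (P.vertex j) = ((P.extra : ℝ) + 3) * P.sideFun i P.center := by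
  have h := P.card_smul_center
  have h₁ := congrArg Prod.fst h
  have h₂ := congrArg Prod.snd h
  rw [Prod.fst_sum] at h₁
  rw [Prod.snd_sum] at h₂
  simp only [Prod.smul_fst, Prod.smul_snd, smul_eq_mul] at h₁ h₂
  simp only [sideFun, cross, Prod.fst_sub, Prod.snd_sub, Finset.sum_sub_distrib, ← Finset.mul_sum,
    ← h₁, ← h₂]
  simp
  ring

theorem sideFun_center_pos (i : P.Index) : 0 < P.sideFun i P.center := by
  have h : 0 < ∑ j, P.sideFun i (P.vertex j) :=
    Finset.sum_pos' (fun j _ => P.sideFun_vertex_nonneg i j)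
      ⟨i + 1 + 1, Finset.mem_univ _, P.sideFun_pos (P.succ_succ_ne i) (P.succ_ne _)⟩
  rw [sum_sideFun] at h
  exact pos_of_mul_pos_right h P.card_pos.le

theorem cross_center (i : P.Index) :
    cross (P.vertex i - P.center) (P.vertex (i + 1) - P.center) = P.sideFun i P.center := by
  simp [sideFun, cross]; ring

/-- A cyclic family of reals of sum zero passes from `≥ 0` to `≤ 0` somewhere. -/
theorem exists_sign_change (d : P.Index → ℝ) (h : ∑ i, d i = 0) : ∃ i, 0 ≤ d i ∧ d (i + 1) ≤ 0 := by
  by_contra! hc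
  -- Start at an index with non-negative value. Without a sign change, positivity spreads from there
  -- around the whole cycle, contradicting the sum.
  obtain ⟨i₀, -, h₀⟩ := Finset.exists_le_of_sum_le (s := (Finset.univ : Finset P.Index))
    (f := fun _ => (0 : ℝ)) (g := d) Finset.univ_nonempty (by simp [h])
  have key : ∀ n : ℕ, 0 < d (i₀ + 1 + (Fin.ofNat _ n)) := by
    intro n
    induction n with
    | zero => simpa using hc _ h₀
    | succ n ih =>
      have := hc _ ih.le
      have e : (Fin.ofNat (P.extra + 3) (n + 1)) = Fin.ofNat (P.extra + 3) n + 1 := by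
        simp [Fin.ext_iff, Fin.val_add]
      rwa [e, ← add_assoc]
  have hall : ∀ j, 0 < d j := by
    intro j
    have := key (j - (i₀ + 1)).val
    simpa using this
  exact (Finset.sum_pos (fun j _ => hall j) Finset.univ_nonempty).ne' h

/-- The point with polar coordinates `r` on the segment from the centre to the point `t` of side
`i`. -/
noncomputable def conePoint (i : P.Index) (t r : unitInterval) : P.region :=
  ⟨AffineMap.lineMap P.center (P.side i t : ℝ × ℝ) (r : ℝ),
    (convex_convexHull ℝ _).lineMap_mem P.center_mem (P.side i t).2 r.2⟩

theorem conePoint_val (i : P.Index) (t r : unitInterval) :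
    (P.conePoint i t r : ℝ × ℝ) =
      P.center + (r : ℝ) • ((1 - (t : ℝ)) • P.vertex i + (t : ℝ) • P.vertex (i + 1) - P.center) := by
  simp only [conePoint, side, AffineMap.lineMap_apply_module]
  module

theorem conePoint_one (i : P.Index) (t : unitInterval) : P.conePoint i t 1 = P.side i t := by
  apply Subtype.ext
  simp [conePoint]

theorem continuous_conePoint (i : P.Index) :
    Continuous fun p : unitInterval × unitInterval => P.conePoint i p.1 p.2 := by
  rw [continuous_induced_rng]
  have : (Subtype.val ∘ fun p : unitInterval × unitInterval => P.conePoint i p.1 p.2) =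
    fun p : unitInterval × unitInterval => P.center + (p.2 : ℝ) •
      ((1 - (p.1 : ℝ)) • P.vertex i + (p.1 : ℝ) • P.vertex (i + 1) - P.center) := by
    ext1 p
    exact P.conePoint_val i p.1 p.2
  rw [this]
  fun_prop

/-- Cramer's rule gives the coordinates `b`, `a` of `x` with respect to two consecutive rays from
the centre. The sign change makes them non-negative, and `x` lying on the inner side of the edge
gives `a + b ≤ 1`. The radius is then `a + b` and the position on the side is `a / (a + b)`; the
centre itself is treated apart. -/
theorem exists_conePoint (x : P.region) : ∃ i t r, P.conePoint i t r = x := by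
  obtain ⟨x, hx⟩ := x
  obtain ⟨i, h₀, h₁⟩ := P.exists_sign_change _ (P.sum_cross_center x)
  have hD := P.sideFun_center_pos i
  have hx' := P.sideFun_nonneg i hx
  set D := P.sideFun i P.center with hDdef
  set a := cross (P.vertex i - P.center) (x - P.center) / D with ha
  set b := - cross (P.vertex (i + 1) - P.center) (x - P.center) / D with hb
  have ha0 : 0 ≤ a := div_nonneg h₀ hD.le
  have hb0 : 0 ≤ b := div_nonneg (by linarith) hD.le
  have hab : a + b ≤ 1 := by
    have : P.sideFun i x = D - (cross (P.vertex i - P.center) (x - P.center)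
        - cross (P.vertex (i + 1) - P.center) (x - P.center)) := by
      rw [hDdef]; simp only [sideFun, cross, Prod.fst_sub, Prod.snd_sub]; ring
    rw [ha, hb, ← add_div, div_le_one hD]
    linarith
  have hxeq : x = P.center + (b • (P.vertex i - P.center) + a • (P.vertex (i + 1) - P.center)) := by
    have e : D * (1 : ℝ) = D := mul_one D
    have hDe : cross (P.vertex i - P.center) (P.vertex (i + 1) - P.center) = D := P.cross_center i
    have hDn := hD.ne'
    ext
    · simp only [ha, hb, Prod.fst_add, Prod.smul_fst, Prod.fst_sub, smul_eq_mul]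
      field_simp
      rw [← hDe]
      simp only [cross, Prod.fst_sub, Prod.snd_sub]
      ring
    · simp only [ha, hb, Prod.snd_add, Prod.smul_snd, Prod.snd_sub, smul_eq_mul]
      field_simp
      rw [← hDe]
      simp only [cross, Prod.fst_sub, Prod.snd_sub]
      ring
  rcases (add_nonneg ha0 hb0).eq_or_lt with h | h
  · refine ⟨i, 0, 0, Subtype.ext ?_⟩
    have ha' : a = 0 := by linarith
    have hb' : b = 0 := by linarith
    rw [ha', hb'] at hxeq
    refine (P.conePoint_val i 0 0).trans ?_
    simpa using hxeq.symm
  · refine ⟨i, ⟨a / (a + b), by positivity, by rw [div_le_one h]; linarith⟩, ⟨a + b, h.le, hab⟩,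
      Subtype.ext ?_⟩
    rw [conePoint_val]
    simp only
    rw [hxeq]
    have h' := h.ne'
    ext
    · simp only [Prod.fst_add, Prod.smul_fst, Prod.fst_sub, smul_eq_mul]
      field_simp
      ring
    · simp only [Prod.snd_add, Prod.smul_snd, Prod.snd_sub, smul_eq_mul]
      field_simp
      ring

theorem conePoint_zero (i j : P.Index) (t t' : unitInterval) :
    P.conePoint i t 0 = P.conePoint j t' 0 := by
  apply Subtype.ext
  simp [conePoint_val]

theorem conePoint_end (i : P.Index) (r : unitInterval) :
    P.conePoint i 1 r = P.conePoint (i + 1) 0 r := by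
  apply Subtype.ext
  simp [conePoint_val]

theorem sideFun_conePoint (j i : P.Index) (t r : unitInterval) :
    P.sideFun j (P.conePoint i t r) = P.sideFun j P.center * (1 - r) +
      r * ((1 - t) * P.sideFun j (P.vertex i) + t * P.sideFun j (P.vertex (i + 1))) := by
  rw [conePoint_val]
  simp only [sideFun, cross, Prod.fst_add, Prod.snd_add, Prod.fst_sub, Prod.snd_sub, Prod.smul_fst,
    Prod.smul_snd, smul_eq_mul]
  ring

/-- On the triangle over side `i`, the function `sideFun i` is exactly `1 - r` times its value at
the centre. On any other triangle it is at least `1 - r'` times that value. -/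
theorem conePoint_radius {i j : P.Index} {t t' r r' : unitInterval}
    (h : P.conePoint i t r = P.conePoint j t' r') : r = r' := by
  suffices key : ∀ {i j : P.Index} {t t' r r' : unitInterval},
      P.conePoint i t r = P.conePoint j t' r' → (r : ℝ) ≤ r' from
    Subtype.ext (le_antisymm (key h) (key h.symm))
  intro i j t t' r r' h
  have e := congrArg (fun x : P.region => P.sideFun i x) h
  simp only [sideFun_conePoint, sideFun_left, sideFun_right] at e
  have hc := P.sideFun_center_pos i
  have h₁ := P.sideFun_vertex_nonneg i j
  have h₂ := P.sideFun_vertex_nonneg i (j + 1)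
  have h₃ : 0 ≤ (r' : ℝ) * ((1 - t') * P.sideFun i (P.vertex j) +
      t' * P.sideFun i (P.vertex (j + 1))) := by
    have := t'.2.1; have := t'.2.2; have := r'.2.1
    have : (0 : ℝ) ≤ 1 - t' := by linarith
    positivity
  by_contra! hlt
  nlinarith

theorem side_injective (i : P.Index) {t t' : unitInterval} (h : P.side i t = P.side i t') :
    t = t' := by
  apply Subtype.ext
  have h' : AffineMap.lineMap (P.vertex i) (P.vertex (i + 1)) (t : ℝ) =
    AffineMap.lineMap (P.vertex i) (P.vertex (i + 1)) (t' : ℝ) := congrArg Subtype.val h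
  exact AffineMap.lineMap_injective ℝ (P.vertex_succ_ne i).symm h'

theorem side_end (i : P.Index) : P.side i 1 = P.side (i + 1) 0 := by
  rw [← conePoint_one, ← conePoint_one, conePoint_end]

/-- On side `i` the function of side `j` is a convex combination of two non-negative vertex values.
Where it vanishes, every vertex of positive weight must lie on side `j`, which leaves only a common
end. -/
theorem side_eq_cases {i j : P.Index} {t t' : unitInterval} (h : P.side i t = P.side j t') :
    (i = j ∧ t = t') ∨ (j = i + 1 ∧ t = 1 ∧ t' = 0) ∨ (i = j + 1 ∧ t = 0 ∧ t' = 1) := by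
  by_cases hij : i = j
  · subst hij
    exact Or.inl ⟨rfl, P.side_injective i h⟩
  right
  have e := congrArg (fun x : P.region => P.sideFun j x) h
  simp only [← conePoint_one, sideFun_conePoint, sideFun_left, sideFun_right] at e
  simp only [Set.Icc.coe_one, sub_self, mul_zero, one_mul, zero_add, add_zero] at e
  have h₁ := P.sideFun_vertex_nonneg j i
  have h₂ := P.sideFun_vertex_nonneg j (i + 1)
  have ht0 := t.2.1
  have ht1 := t.2.2
  have m₁ : 0 ≤ (1 - (t : ℝ)) * P.sideFun j (P.vertex i) := mul_nonneg (by linarith) h₁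
  have m₂ : 0 ≤ (t : ℝ) * P.sideFun j (P.vertex (i + 1)) := mul_nonneg ht0 h₂
  have z₁ : (1 - (t : ℝ)) * P.sideFun j (P.vertex i) = 0 := by linarith
  have z₂ : (t : ℝ) * P.sideFun j (P.vertex (i + 1)) = 0 := by linarith
  by_cases hi : i = j + 1
  · right
    have : P.sideFun j (P.vertex (i + 1)) ≠ 0 := by
      subst hi
      exact (P.sideFun_pos (P.succ_succ_ne j) (P.succ_ne _)).ne'
    have ht : t = 0 := Subtype.ext ((mul_eq_zero.1 z₂).resolve_right this)
    refine ⟨hi, ht, ?_⟩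
    subst hi ht
    rw [← side_end] at h
    exact (P.side_injective j h).symm
  · left
    have hne := (P.sideFun_pos hij hi).ne'
    have ht : t = 1 := Subtype.ext (by
      have := (mul_eq_zero.1 z₁).resolve_right hne
      rw [Set.Icc.coe_one]; linarith)
    have z : P.sideFun j (P.vertex (i + 1)) = 0 := by simpa [ht] using z₂
    have hj : j = i + 1 := by
      by_contra hj
      refine (P.sideFun_pos (i := j) (j := i + 1) (Ne.symm hj) ?_).ne' z
      intro h
      exact hij (add_right_cancel h)
    refine ⟨hj, ht, ?_⟩
    subst hj ht
    rw [side_end] at h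
    exact (P.side_injective _ h).symm

theorem conePoint_eq_cases {i j : P.Index} {t t' r r' : unitInterval}
    (h : P.conePoint i t r = P.conePoint j t' r') : r = r' ∧ (r = 0 ∨ P.side i t = P.side j t') := by
  have hr := P.conePoint_radius h
  subst hr
  refine ⟨rfl, ?_⟩
  by_cases h0 : r = 0
  · exact Or.inl h0
  right
  have h0' : (r : ℝ) ≠ 0 := fun h => h0 (Subtype.ext h)
  have e := congrArg Subtype.val h
  simp only [conePoint, AffineMap.lineMap_apply, vsub_eq_sub, vadd_eq_add] at e
  exact Subtype.ext (sub_left_injective (smul_right_injective _ h0' (add_right_cancel e)))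

/-- The region lies in the cone at each of its vertices. -/
theorem exists_vertex_coords (i : P.Index) {x : ℝ × ℝ} (hx : x ∈ P.region) :
    ∃ a b : ℝ, 0 ≤ a ∧ 0 ≤ b ∧
      x = P.vertex i + (a • (P.vertex (i + 1) - P.vertex i) + b • (P.vertex (i - 1) - P.vertex i)) := by
  have hD : 0 < P.sideFun i (P.vertex (i - 1)) :=
    P.sideFun_pos (P.pred_ne i) (P.pred_ne_succ i)
  have h₁ := P.sideFun_nonneg i hx
  have h₂ := P.sideFun_nonneg (i - 1) hx
  have hDn := hD.ne'
  refine ⟨P.sideFun (i - 1) x / P.sideFun i (P.vertex (i - 1)),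
    P.sideFun i x / P.sideFun i (P.vertex (i - 1)), by positivity, by positivity, ?_⟩
  ext
  · simp only [Prod.fst_add, Prod.smul_fst, Prod.fst_sub, smul_eq_mul]
    field_simp
    simp only [sideFun, sub_add_cancel, cross, Prod.fst_sub, Prod.snd_sub]
    ring
  · simp only [Prod.snd_add, Prod.smul_snd, Prod.snd_sub, smul_eq_mul]
    field_simp
    simp only [sideFun, sub_add_cancel, cross, Prod.fst_sub, Prod.snd_sub]
    ring

theorem map_vertex_coords (f : (ℝ × ℝ) →ᵃ[ℝ] ℝ) (p u v : ℝ × ℝ) (a b : ℝ) :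
    f (p + (a • (u - p) + b • (v - p))) = f p + (a * (f u - f p) + b * (f v - f p)) := by
  have h : p + (a • (u - p) + b • (v - p)) = (a • (u -ᵥ p) + b • (v -ᵥ p)) +ᵥ p := by
    simp [add_comm]
  rw [h, f.map_vadd, map_add, map_smul, map_smul, f.linearMap_vsub, f.linearMap_vsub]
  simp [add_comm]

/-- An affine function which does not increase along both sides at a vertex, and which is not
constant along sides, has its strict maximum on the region at this vertex. -/
theorem lt_of_local_max (f : (ℝ × ℝ) →ᵃ[ℝ] ℝ) (i : P.Index)
    (h₁ : f (P.vertex (i + 1)) < f (P.vertex i)) (h₂ : f (P.vertex (i - 1)) < f (P.vertex i))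
    {x : ℝ × ℝ} (hx : x ∈ P.region) (hne : x ≠ P.vertex i) : f x < f (P.vertex i) := by
  obtain ⟨a, b, ha, hb, rfl⟩ := P.exists_vertex_coords i hx
  rw [map_vertex_coords]
  have hab : a ≠ 0 ∨ b ≠ 0 := by
    by_contra! h
    simp [h.1, h.2] at hne
  rcases hab with h | h
  · have := lt_of_le_of_ne ha h.symm
    nlinarith
  · have := lt_of_le_of_ne hb h.symm
    nlinarith

/-- An affine function which is not constant on sides has a strict maximum at a vertex. -/
theorem exists_strict_max (f : (ℝ × ℝ) →ᵃ[ℝ] ℝ)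
    (hf : ∀ i, f (P.vertex i) ≠ f (P.vertex (i + 1))) :
    ∃ i, ∀ x ∈ P.region, x ≠ P.vertex i → f x < f (P.vertex i) := by
  obtain ⟨i, hi⟩ := Finite.exists_max fun i => f (P.vertex i)
  refine ⟨i, fun x hx hne => P.lt_of_local_max f i ?_ ?_ hx hne⟩
  · exact lt_of_le_of_ne (hi _) (hf i).symm
  · exact lt_of_le_of_ne (hi _) (by simpa using hf (i - 1))

theorem vertex_injective : Function.Injective P.vertex := by
  intro i j h
  by_contra hne
  by_cases hj : i = j + 1
  · exact P.vertex_succ_ne j (hj ▸ h)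
  · exact (P.sideFun_pos hne hj).ne' (by rw [h, sideFun_left])

end ConvexPolygon

/-! ### The complex as a quotient of triangles -/

section ConeComplex

open Topology unitInterval

section HomeomorphPi1

open CategoryTheory

variable {X Y : Type*} [TopologicalSpace X] [TopologicalSpace Y]

theorem Homeomorph.faithful_fundamentalGroupoid_map (φ : X ≃ₜ Y) :
    (FundamentalGroupoid.map (φ : C(X, Y))).Faithful := by
  have h : FundamentalGroupoid.map (φ : C(X, Y)) ⋙ FundamentalGroupoid.map (φ.symm : C(Y, X)) =
      𝟭 _ := by
    rw [← FundamentalGroupoid.map_comp, ← FundamentalGroupoid.map_id]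
    congr 1
    ext x
    simp
  exact Functor.Faithful.of_comp_eq h

theorem Homeomorph.full_fundamentalGroupoid_map (φ : X ≃ₜ Y) :
    (FundamentalGroupoid.map (φ : C(X, Y))).Full := by
  have h : FundamentalGroupoid.map (φ : C(X, Y)) ⋙ FundamentalGroupoid.map (φ.symm : C(Y, X)) =
      𝟭 _ := by
    rw [← FundamentalGroupoid.map_comp, ← FundamentalGroupoid.map_id]
    congr 1
    ext x
    simp
  have := φ.symm.faithful_fundamentalGroupoid_map
  exact Functor.Full.of_comp_faithful_iso (eqToIso h)

/-- A homeomorphism induces an isomorphism of fundamental groups. -/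
noncomputable def Homeomorph.fundamentalGroupMulEquiv (φ : X ≃ₜ Y) (x : X) :
    FundamentalGroup X x ≃* FundamentalGroup Y (φ x) :=
  have := φ.full_fundamentalGroupoid_map
  have := φ.faithful_fundamentalGroupoid_map
  MulEquiv.ofBijective ((FundamentalGroupoid.map (φ : C(X, Y))).mapEnd ⟨x⟩)
    ⟨(FundamentalGroupoid.map (φ : C(X, Y))).map_injective,
      (FundamentalGroupoid.map (φ : C(X, Y))).map_surjective⟩

end HomeomorphPi1

namespace OneVertexComplex

universe u v

variable {E : Type u} {F : Type v} (K : OneVertexComplex E F)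

/-- The disjoint union of a point, an interval for every `1`-cell, and a square for every side of a
`2`-cell. The square belonging to a side stands for the triangle spanned by this side and the centre
of the polygon: `(t, r)` is the point with radial coordinate `r` on the segment from the centre to
the point `t` of the side. -/
abbrev ConeCells : Type (max u v) :=
  PUnit.{1} ⊕ (Σ _ : E, I) ⊕ (Σ _ : K.Corner, I × I)

/-- The vertex, before gluing. -/
abbrev vtx : K.ConeCells := Sum.inl PUnit.unit

/-- A point of a `1`-cell, before gluing. -/
abbrev edg (e : E) (t : I) : K.ConeCells := Sum.inr (Sum.inl ⟨e, t⟩)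

/-- A point of a triangle of a `2`-cell, before gluing. -/
abbrev tri (c : F) (i : (K.polygon c).Index) (t r : I) : K.ConeCells :=
  Sum.inr (Sum.inr ⟨⟨c, i⟩, (t, r)⟩)

/-- The time along a `1`-cell at time `t` along the same cell with orientation `b`. -/
abbrev orient (b : Bool) (t : I) : I := if b then t else σ t

/-- The gluing of the triangles. -/
inductive ConeGlue : K.ConeCells → K.ConeCells → Prop
  | start (e : E) : ConeGlue (K.edg e 0) K.vtx
  | finish (e : E) : ConeGlue (K.edg e 1) K.vtx
  | apex (c : F) (i j : (K.polygon c).Index) (t t' : I) : ConeGlue (K.tri c i t 0) (K.tri c j t' 0)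
  | radial (c : F) (i : (K.polygon c).Index) (r : I) : ConeGlue (K.tri c i 1 r) (K.tri c (i + 1) 0 r)
  | side (c : F) (i : (K.polygon c).Index) (t : I) :
      ConeGlue (K.tri c i t 1) (K.edg (K.bdry c i).1 (orient (K.bdry c i).2 t))

/-- The complex, glued from triangles. -/
abbrev ConeSpace : Type (max u v) := Quot K.ConeGlue

/-- The vertex of the complex glued from triangles. -/
abbrev conePt : K.ConeSpace := Quot.mk _ K.vtx

/-- The cells as quotients of the triangles. -/
noncomputable def cellsOfCone : K.ConeCells → K.Cells
  | Sum.inl _ => Sum.inl PUnit.unit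
  | Sum.inr (Sum.inl x) => Sum.inr (Sum.inl x)
  | Sum.inr (Sum.inr x) =>
    Sum.inr (Sum.inr ⟨x.1.1, (K.polygon x.1.1).conePoint x.1.2 x.2.1 x.2.2⟩)

theorem continuous_cellsOfCone : Continuous K.cellsOfCone := by
  refine continuous_sum_dom.2 ⟨continuous_const, continuous_sum_dom.2 ⟨?_, ?_⟩⟩
  · exact continuous_inr.comp continuous_inl
  · refine continuous_sigma fun x => ?_
    refine continuous_inr.comp (continuous_inr.comp ?_)
    have h : Continuous fun y : (K.polygon x.1).region =>
      (⟨x.1, y⟩ : Σ c, (K.polygon c).region) :=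
      @continuous_sigmaMk F (fun c => (K.polygon c).region) _ x.1
    exact h.comp ((K.polygon x.1).continuous_conePoint x.2)

theorem surjective_cellsOfCone : Function.Surjective K.cellsOfCone := by
  rintro (_ | x | ⟨c, x⟩)
  · exact ⟨K.vtx, rfl⟩
  · exact ⟨Sum.inr (Sum.inl x), rfl⟩
  · obtain ⟨i, t, r, rfl⟩ := (K.polygon c).exists_conePoint x
    exact ⟨K.tri c i t r, rfl⟩

/-- Each polygon is the image of finitely many squares, so compactness makes that piece a quotient
map. Openness is tested cell by cell, so there may be infinitely many cells. -/
theorem isQuotientMap_cellsOfCone : IsQuotientMap K.cellsOfCone := by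
  refine (isQuotientMap_iff _).2 ⟨.of_isOpen_preimage_iff_isOpen fun s =>
    ⟨fun h => ?_, fun h => h.preimage K.continuous_cellsOfCone⟩, K.surjective_cellsOfCone⟩
  rw [isOpen_sum_iff, isOpen_sum_iff, isOpen_sigma_iff] at h ⊢
  refine ⟨isOpen_discrete _, h.2.1, isOpen_sigma_iff.2 fun c => ?_⟩
  have h₃ := isOpen_sigma_iff.1 h.2.2
  let g : (Σ _ : (K.polygon c).Index, I × I) → (K.polygon c).region :=
    fun x => (K.polygon c).conePoint x.1 x.2.1 x.2.2
  have hg : IsQuotientMap g := by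
    refine IsQuotientMap.of_surjective_continuous ?_ ?_
    · intro x
      obtain ⟨i, t, r, h⟩ := (K.polygon c).exists_conePoint x
      exact ⟨⟨i, (t, r)⟩, h⟩
    · exact continuous_sigma fun i => (K.polygon c).continuous_conePoint i
  rw [← hg.isOpen_preimage, isOpen_sigma_iff]
  exact fun i => h₃ ⟨c, i⟩

variable {K} in
theorem mk_tri_eq {c : F} {i j : (K.polygon c).Index} {t t' r r' : I}
    (h : (K.polygon c).conePoint i t r = (K.polygon c).conePoint j t' r') :
    (Quot.mk K.ConeGlue (K.tri c i t r)) = Quot.mk K.ConeGlue (K.tri c j t' r') := by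
  obtain ⟨rfl, rfl | h⟩ := (K.polygon c).conePoint_eq_cases h
  · exact Quot.sound (.apex ..)
  · rcases (K.polygon c).side_eq_cases h with ⟨rfl, rfl⟩ | ⟨rfl, rfl, rfl⟩ | ⟨rfl, rfl, rfl⟩
    · rfl
    · exact Quot.sound (.radial ..)
    · exact (Quot.sound (.radial ..)).symm

/-- The natural map from the complex glued from triangles. -/
noncomputable def coneToSpace : K.ConeSpace → K.Space :=
  Quot.lift (fun x => Quot.mk _ (K.cellsOfCone x)) (by
    rintro _ _ (e | e | ⟨c, i, j, t, t'⟩ | ⟨c, i, r⟩ | ⟨c, i, t⟩)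
    · exact Quot.sound (Glue.start e)
    · exact Quot.sound (Glue.finish e)
    · simp only [cellsOfCone, (K.polygon c).conePoint_zero i j t t']
    · simp only [cellsOfCone, (K.polygon c).conePoint_end i r]
    · simp only [cellsOfCone, (K.polygon c).conePoint_one i t]
      exact Quot.sound (Glue.side c i t))

theorem isQuotientMap_coneToSpace : IsQuotientMap K.coneToSpace := by
  have h : IsQuotientMap (K.coneToSpace ∘ Quot.mk K.ConeGlue) :=
    isQuotientMap_quot_mk.comp K.isQuotientMap_cellsOfCone
  refine IsQuotientMap.of_comp continuous_quot_mk ?_ h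
  exact (isQuotientMap_quot_mk.continuous_iff (f := Quot.mk K.ConeGlue)).2 h.continuous

/-- A set-theoretic left inverse suffices: choose any preimage among the triangles. By `mk_tri_eq`
the glued class does not depend on the choice. -/
theorem injective_coneToSpace : Function.Injective K.coneToSpace := by
  let s : K.Cells → K.ConeSpace := fun x => Quot.mk _ (Function.surjInv K.surjective_cellsOfCone x)
  have hs : ∀ x, s (K.cellsOfCone x) = Quot.mk _ x := by
    intro x
    have h := Function.surjInv_eq K.surjective_cellsOfCone (K.cellsOfCone x)
    simp only [s]
    generalize Function.surjInv K.surjective_cellsOfCone (K.cellsOfCone x) = y at h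
    rcases x with _ | x | ⟨⟨c, i⟩, t, r⟩ <;> rcases y with _ | y | ⟨⟨c', i'⟩, t', r'⟩ <;>
      simp only [cellsOfCone, Sum.inr.injEq, Sum.inl.injEq, reduceCtorEq] at h
    · rfl
    · rw [h]
    · rw [Sigma.mk.injEq] at h
      obtain ⟨rfl, h⟩ := h
      exact mk_tri_eq (eq_of_heq h)
  let ψ : K.Space → K.ConeSpace := Quot.lift s (by
    rintro _ _ (e | e | ⟨c, i, t⟩)
    · exact (hs (K.edg e 0)).trans ((Quot.sound (.start e)).trans (hs K.vtx).symm)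
    · exact (hs (K.edg e 1)).trans ((Quot.sound (.finish e)).trans (hs K.vtx).symm)
    · rw [← (K.polygon c).conePoint_one]
      exact (hs (K.tri c i t 1)).trans ((Quot.sound (.side c i t)).trans (hs (K.edg _ _)).symm))
  refine Function.LeftInverse.injective (g := ψ) ?_
  rintro ⟨x⟩
  exact hs x

/-- The complex is homeomorphic to the complex glued from triangles. -/
noncomputable def coneHomeomorph : K.ConeSpace ≃ₜ K.Space :=
  (isHomeomorph_iff_isQuotientMap_injective.2
    ⟨K.isQuotientMap_coneToSpace, K.injective_coneToSpace⟩).homeomorph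

/-- The fundamental group of the complex can be computed in the complex glued from triangles. -/
noncomputable def conePi1Equiv : FundamentalGroup K.ConeSpace K.conePt ≃* K.Pi1 :=
  K.coneHomeomorph.fundamentalGroupMulEquiv K.conePt

end OneVertexComplex

/-! ### Partial products of cyclic words -/

section PrefixProd

variable {G : Type*} [Group G] {m : ℕ}

/-- The product of the first `i` entries of a word. -/
def prefixProd (f : Fin (m + 1) → G) (i : Fin (m + 1)) : G := ((List.ofFn f).take i).prod

theorem prefixProd_zero (f : Fin (m + 1) → G) : prefixProd f 0 = 1 := by
  simp [prefixProd]

theorem prefixProd_of_lt (f : Fin (m + 1) → G) (i : Fin (m + 1)) (h : (i : ℕ) + 1 < m + 1) :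
    prefixProd f (i + 1) = prefixProd f i * f i := by
  have e : ((i + 1 : Fin (m + 1)) : ℕ) = i + 1 := by
    rw [Fin.val_add_one_of_lt]
    exact Fin.lt_def.2 (by simp; omega)
  rw [prefixProd, prefixProd, e, List.prod_take_succ _ _ (by rw [List.length_ofFn]; omega),
    List.getElem_ofFn]

theorem prefixProd_last (f : Fin (m + 1) → G) :
    prefixProd f (Fin.last m) * f (Fin.last m) = (List.ofFn f).prod := by
  have h := List.prod_take_succ (List.ofFn f) m (by simp)
  rw [List.take_of_length_le (by simp)] at h
  rw [h, prefixProd, List.getElem_ofFn]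
  rfl

/-- Only at the last index, where `i + 1` wraps around to `0`, is it needed that the whole word has
product `1`. -/
theorem prefixProd_succ (f : Fin (m + 1) → G) (h : (List.ofFn f).prod = 1) (i : Fin (m + 1)) :
    prefixProd f (i + 1) = prefixProd f i * f i := by
  by_cases hi : (i : ℕ) + 1 < m + 1
  · exact prefixProd_of_lt f i hi
  · obtain rfl : i = Fin.last m := Fin.ext (by simp; omega)
    rw [prefixProd_last, h, Fin.last_add_one, prefixProd_zero]

/-- A cyclic word which telescopes has product `1`. -/
theorem prod_ofFn_eq_one_of_telescope (f u : Fin (m + 1) → G) (h : ∀ i, f i = u i * (u (i + 1))⁻¹) :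
    (List.ofFn f).prod = 1 := by
  have key : ∀ n (hn : n < m + 1), prefixProd f ⟨n, hn⟩ = u 0 * (u ⟨n, hn⟩)⁻¹ := by
    intro n
    induction n with
    | zero => intro hn; simpa using prefixProd_zero f
    | succ n ih =>
      intro hn
      have hn' : n < m + 1 := by omega
      have e : (⟨n + 1, hn⟩ : Fin (m + 1)) = ⟨n, hn'⟩ + 1 := by
        ext
        rw [Fin.val_add_one_of_lt]
        exact Fin.lt_def.2 (by simp; omega)
      rw [e, prefixProd_of_lt f ⟨n, hn'⟩ hn, ih hn', h]
      group
  rw [← prefixProd_last, show Fin.last m = ⟨m, by omega⟩ from rfl, key, h,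
    show (⟨m, by omega⟩ : Fin (m + 1)) + 1 = 0 from Fin.last_add_one m]
  group

end PrefixProd

/-- Needed for the section over the star of the vertex, which jumps at the midpoints of 1-cells and
of sides. Those midpoints are removed from the star. -/
theorem isOpen_halves {α : Type*} (a b g : α) :
    IsOpen {t : I | (t : ℝ) ≠ 1 / 2 ∧ (open Classical in if (t : ℝ) < 1 / 2 then a else b) = g} := by
  have : {t : I | (t : ℝ) ≠ 1 / 2 ∧ (open Classical in if (t : ℝ) < 1 / 2 then a else b) = g} =
      ({t : I | (t : ℝ) < 1 / 2} ∩ {_t | a = g}) ∪ ({t : I | 1 / 2 < (t : ℝ)} ∩ {_t | b = g}) := by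
    ext t
    simp only [Set.mem_ofPred_eq, Set.mem_union, Set.mem_inter_iff]
    rcases lt_trichotomy (t : ℝ) (1 / 2) with h | h | h
    · simp only [h.ne, h, h.not_gt, if_true, ne_eq, not_false_eq_true, true_and, false_and, or_false]
    · simp only [h, ne_eq, not_true_eq_false, lt_irrefl, false_and, or_false]
    · simp only [h.ne', h, h.not_gt, if_false, ne_eq, not_false_eq_true, true_and, false_and, false_or]
  rw [this]
  refine ((isOpen_lt continuous_subtype_val continuous_const).inter isOpen_const).union
    ((isOpen_lt continuous_const continuous_subtype_val).inter isOpen_const)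

/-! ### Regular coverings from copies of the cells labelled by a group -/

namespace OneVertexComplex

universe u v w

variable {E : Type u} {F : Type v} (K : OneVertexComplex E F) {G : Type w} [Group G] (gen : E → G)

/-- The value of an oriented `1`-cell. -/
def letterVal (x : E × Bool) : G := if x.2 then gen x.1 else (gen x.1)⁻¹

/-- The values of the boundary word of a `2`-cell. -/
def bdryVal (c : F) (i : (K.polygon c).Index) : G := letterVal gen (K.bdry c i)

/-- The product of the boundary word of a `2`-cell. -/
def wordVal (c : F) : G := (List.ofFn (K.bdryVal gen c)).prod

/-- The value of the part of the boundary word before a corner. -/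
def cornerVal (c : F) (i : (K.polygon c).Index) : G := prefixProd (K.bdryVal gen c) i

/-- The value at the initial point of the `1`-cell along a side. -/
def sideVal (c : F) (i : (K.polygon c).Index) : G :=
  if (K.bdry c i).2 then K.cornerVal gen c i else K.cornerVal gen c (i + 1)

/-- The gluing of copies of the triangles indexed by `G`, which gives the regular covering with group
`G`. -/
inductive CoverGlue : (Σ _ : G, K.ConeCells) → (Σ _ : G, K.ConeCells) → Prop
  | start (g : G) (e : E) : CoverGlue ⟨g, K.edg e 0⟩ ⟨g, K.vtx⟩
  | finish (g : G) (e : E) : CoverGlue ⟨g, K.edg e 1⟩ ⟨g * gen e, K.vtx⟩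
  | apex (g : G) (c : F) (i j : (K.polygon c).Index) (t t' : I) :
      CoverGlue ⟨g, K.tri c i t 0⟩ ⟨g, K.tri c j t' 0⟩
  | radial (g : G) (c : F) (i : (K.polygon c).Index) (r : I) :
      CoverGlue ⟨g, K.tri c i 1 r⟩ ⟨g, K.tri c (i + 1) 0 r⟩
  | side (g : G) (c : F) (i : (K.polygon c).Index) (t : I) :
      CoverGlue ⟨g, K.tri c i t 1⟩
        ⟨g * K.sideVal gen c i, K.edg (K.bdry c i).1 (orient (K.bdry c i).2 t)⟩

/-- The regular covering with group `G`. -/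
abbrev Cover : Type (max u v w) := Quot (K.CoverGlue gen)

/-- The covering map. -/
def coverMap : K.Cover gen → K.ConeSpace :=
  Quot.lift (fun x => Quot.mk _ x.2) (by
    rintro _ _ (⟨g, e⟩ | ⟨g, e⟩ | ⟨g, c, i, j, t, t'⟩ | ⟨g, c, i, r⟩ | ⟨g, c, i, t⟩)
    · exact Quot.sound (.start e)
    · exact Quot.sound (.finish e)
    · exact Quot.sound (.apex ..)
    · exact Quot.sound (.radial ..)
    · exact Quot.sound (.side ..))

instance : MulAction G (K.Cover gen) where
  smul h := Quot.map (fun x => ⟨h * x.1, x.2⟩) (by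
    rintro _ _ (⟨g, e⟩ | ⟨g, e⟩ | ⟨g, c, i, j, t, t'⟩ | ⟨g, c, i, r⟩ | ⟨g, c, i, t⟩)
    · exact .start ..
    · simpa only [mul_assoc] using CoverGlue.finish (h * g) e
    · exact .apex ..
    · exact .radial ..
    · simpa only [mul_assoc] using CoverGlue.side (h * g) c i t)
  one_smul := by
    rintro ⟨g, x⟩
    change Quot.mk _ _ = _
    simp
  mul_smul := by
    rintro h h' ⟨g, x⟩
    change Quot.mk _ _ = Quot.mk _ _
    simp [mul_assoc]

theorem smul_mk (h g : G) (z : K.ConeCells) :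
    h • (Quot.mk _ ⟨g, z⟩ : K.Cover gen) = Quot.mk _ ⟨h * g, z⟩ := rfl

theorem isQuotientMap_coverMap : IsQuotientMap (K.coverMap gen) := by
  have h₁ : IsQuotientMap fun x : (Σ _ : G, K.ConeCells) => x.2 := by
    refine IsOpenMap.isQuotientMap ?_ (continuous_sigma fun _ => continuous_id) fun z => ⟨⟨1, z⟩, rfl⟩
    exact isOpenMap_sigma.2 fun _ => IsOpenMap.id
  have h : IsQuotientMap (K.coverMap gen ∘ Quot.mk _) := isQuotientMap_quot_mk.comp h₁
  refine IsQuotientMap.of_comp continuous_quot_mk ?_ h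
  exact (isQuotientMap_quot_mk.continuous_iff (f := Quot.mk (K.CoverGlue gen))).2 h.continuous

theorem exists_smul_of_glue {z z' : K.ConeCells} (h : K.ConeGlue z z') (g : G) :
    ∃ g', (Quot.mk _ ⟨g, z⟩ : K.Cover gen) = Quot.mk _ ⟨g', z'⟩ := by
  rcases h with ⟨e⟩ | ⟨e⟩ | ⟨c, i, j, t, t'⟩ | ⟨c, i, r⟩ | ⟨c, i, t⟩
  · exact ⟨_, Quot.sound (.start ..)⟩
  · exact ⟨_, Quot.sound (.finish ..)⟩
  · exact ⟨_, Quot.sound (.apex ..)⟩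
  · exact ⟨_, Quot.sound (.radial ..)⟩
  · exact ⟨_, Quot.sound (.side ..)⟩

theorem exists_eq_of_mk_eq {z z' : K.ConeCells}
    (h : (Quot.mk _ z : K.ConeSpace) = Quot.mk _ z') (g : G) :
    ∃ g', (Quot.mk _ ⟨g, z⟩ : K.Cover gen) = Quot.mk _ ⟨g', z'⟩ := by
  have h' := Quot.eqvGen_exact h
  clear h
  induction h' generalizing g with
  | rel x y hxy => exact K.exists_smul_of_glue gen hxy g
  | refl x => exact ⟨g, rfl⟩
  | symm x y _ ih =>
    obtain ⟨g', h⟩ := ih g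
    -- The inductive hypothesis leads from sheet `g` to some sheet `g'`. Translating by `g * g'⁻¹`
    -- makes its far end lie in sheet `g`.
    refine ⟨g * g'⁻¹ * g, ?_⟩
    have := congrArg (fun x => (g * g'⁻¹) • x) h
    simp only [smul_mk] at this
    rw [this]
    simp
  | trans x y z _ _ ih₁ ih₂ =>
    obtain ⟨g₁, h₁⟩ := ih₁ g
    obtain ⟨g₂, h₂⟩ := ih₂ g₁
    exact ⟨g₂, h₁.trans h₂⟩

/-- A partial section of the covering, given before gluing. -/
structure LocalSection where
  carrier : Set K.ConeCells
  val : K.ConeCells → G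
  compat : ∀ g z g' z', K.CoverGlue gen ⟨g, z⟩ ⟨g', z'⟩ →
    (z ∈ carrier ↔ z' ∈ carrier) ∧ (z ∈ carrier → g * val z = g' * val z')
  isOpen_val : ∀ g, IsOpen {z | z ∈ carrier ∧ val z = g}

/-- The product `g * val z` is constant on gluing classes, so it labels the sheets over the carrier
equivariantly. The set of points with a given label is open, and a translate by `h` can meet it only
if `h = 1`. -/
theorem LocalSection.exists_nhds (s : K.LocalSection gen) {g : G} {z : K.ConeCells}
    (hz : z ∈ s.carrier) :
    ∃ U ∈ 𝓝 (Quot.mk _ ⟨g, z⟩ : K.Cover gen), ∀ h : G, ((h • ·) '' U ∩ U).Nonempty → h = 1 := by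
  let P : K.Cover gen → Option G := Quot.lift
    (fun x => open Classical in if x.2 ∈ s.carrier then some (x.1 * s.val x.2) else none) (by
      rintro ⟨g, z⟩ ⟨g', z'⟩ h
      obtain ⟨h₁, h₂⟩ := s.compat _ _ _ _ h
      by_cases hz : z ∈ s.carrier
      · simp [hz, ← h₁, h₂ hz]
      · simp [hz, ← h₁])
  have hP : ∀ (h : G) y a, P y = some a → P (h • y) = some (h * a) := by
    rintro h ⟨g, z⟩ a ha
    by_cases hz : z ∈ s.carrier
    · have ha' : g * s.val z = a := by simpa [P, hz] using ha
      simp [smul_mk, P, hz, ← ha', mul_assoc]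
    · simp [P, hz] at ha
  refine ⟨P ⁻¹' {some (g * s.val z)}, IsOpen.mem_nhds ?_ (by simp [P, hz]), ?_⟩
  · rw [← (isQuotientMap_quot_mk (r := K.CoverGlue gen)).isOpen_preimage, isOpen_sigma_iff]
    intro g'
    convert s.isOpen_val (g'⁻¹ * (g * s.val z)) using 1
    ext z'
    by_cases hz' : z' ∈ s.carrier
    · simp [P, hz', eq_inv_mul_iff_mul_eq]
    · simp [P, hz']
  · rintro h ⟨_, ⟨y, hy, rfl⟩, hy'⟩
    have h₁ := hP h y _ hy
    have h₂ : P (h • y) = some (g * s.val z) := hy'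
    rw [h₁, Option.some.injEq] at h₂
    simpa using h₂

variable {K gen}

theorem cornerVal_succ (hrel : ∀ c, K.wordVal gen c = 1) (c : F) (i : (K.polygon c).Index) :
    K.cornerVal gen c (i + 1) = K.cornerVal gen c i * letterVal gen (K.bdry c i) :=
  prefixProd_succ _ (hrel c) i

/-- The star of the vertex. -/
def vertexStar (K : OneVertexComplex E F) : K.ConeCells → Prop
  | Sum.inl _ => True
  | Sum.inr (Sum.inl x) => (x.2 : ℝ) ≠ 1 / 2
  | Sum.inr (Sum.inr x) => (x.2.1 : ℝ) ≠ 1 / 2 ∧ x.2.2 ≠ 0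

/-- The star of a `1`-cell. -/
def edgeStar (K : OneVertexComplex E F) (e : E) : K.ConeCells → Prop
  | Sum.inl _ => False
  | Sum.inr (Sum.inl x) => x.1 = e ∧ x.2 ≠ 0 ∧ x.2 ≠ 1
  | Sum.inr (Sum.inr x) => (K.bdry x.1.1 x.1.2).1 = e ∧ x.2.1 ≠ 0 ∧ x.2.1 ≠ 1 ∧ x.2.2 ≠ 0

/-- The star of a `2`-cell. -/
def faceStar (K : OneVertexComplex E F) (c : F) : K.ConeCells → Prop
  | Sum.inl _ => False
  | Sum.inr (Sum.inl _) => False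
  | Sum.inr (Sum.inr x) => x.1.1 = c ∧ x.2.2 ≠ 1

theorem symm_half_iff (t : I) : ((σ t : I) : ℝ) ≠ 1 / 2 ↔ (t : ℝ) ≠ 1 / 2 := by
  rw [coe_symm_eq, not_iff_not]
  constructor <;> intro h <;> linarith

variable (K gen) in
/-- The section over the star of the vertex. -/
noncomputable def vertexVal : K.ConeCells → G
  | Sum.inl _ => 1
  | Sum.inr (Sum.inl x) => open Classical in if (x.2 : ℝ) < 1 / 2 then 1 else gen x.1
  | Sum.inr (Sum.inr x) => open Classical in if (x.2.1 : ℝ) < 1 / 2 then K.cornerVal gen x.1.1 x.1.2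
      else K.cornerVal gen x.1.1 (x.1.2 + 1)

variable (K gen) in
/-- The section over the star of a `1`-cell. -/
def edgeVal : K.ConeCells → G
  | Sum.inl _ => 1
  | Sum.inr (Sum.inl _) => 1
  | Sum.inr (Sum.inr x) => K.sideVal gen x.1.1 x.1.2

/-- The first half of a side belongs to corner `i`, the second to corner `i + 1`, and a reversed
1-cell exchanges the halves. The relator enters through `cornerVal_succ`, where the last corner
meets corner `0`. -/
theorem side_vertexVal (hrel : ∀ c, K.wordVal gen c = 1) (c : F) (i : (K.polygon c).Index) (t : I)
    (ht : (t : ℝ) ≠ 1 / 2) (r : I) :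
    K.vertexVal gen (K.tri c i t r) = K.sideVal gen c i *
      K.vertexVal gen (K.edg (K.bdry c i).1 (orient (K.bdry c i).2 t)) := by
  have h := cornerVal_succ hrel c i
  simp only [vertexVal, sideVal, letterVal, orient] at h ⊢
  cases hb : (K.bdry c i).2
  · simp only [hb, Bool.false_eq_true, if_false, coe_symm_eq] at h ⊢
    rcases lt_or_gt_of_ne ht with h' | h'
    · rw [if_pos h', if_neg (by linarith), h]; simp
    · rw [if_neg h'.not_gt, if_pos (by linarith), mul_one]
  · simp only [hb, if_true] at h ⊢
    split_ifs
    · simp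
    · exact h

/-- The section over the star of the vertex. -/
noncomputable def vertexSection (hrel : ∀ c, K.wordVal gen c = 1) : K.LocalSection gen where
  carrier := {z | K.vertexStar z}
  val := K.vertexVal gen
  compat := by
    rintro _ _ _ _ (⟨g, e⟩ | ⟨g, e⟩ | ⟨g, c, i, j, t, t'⟩ | ⟨g, c, i, r⟩ | ⟨g, c, i, t⟩)
    · simp [vertexStar, vertexVal]
    · simp [vertexStar, vertexVal]; norm_num
    · simp [vertexStar]
    · simp only [Set.mem_ofPred_eq, vertexStar, vertexVal]
      norm_num
    · have h₁ : K.vertexStar (K.tri c i t 1) ↔ (t : ℝ) ≠ 1 / 2 := by simp [vertexStar]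
      have h₂ : K.vertexStar (K.edg (K.bdry c i).1 (orient (K.bdry c i).2 t)) ↔ (t : ℝ) ≠ 1 / 2 := by
        simp only [vertexStar, orient]
        split_ifs
        · rfl
        · exact symm_half_iff t
      refine ⟨h₁.trans h₂.symm, fun h => ?_⟩
      rw [side_vertexVal hrel c i t (h₁.1 h), mul_assoc]
  isOpen_val := by
    intro g
    rw [isOpen_sum_iff, isOpen_sum_iff, isOpen_sigma_iff, isOpen_sigma_iff]
    refine ⟨isOpen_discrete _, fun e => isOpen_halves 1 (gen e) g, fun x => ?_⟩
    have h := ((isOpen_halves (K.cornerVal gen x.1 x.2) (K.cornerVal gen x.1 (x.2 + 1)) g).preimage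
      (continuous_fst (X := I) (Y := I))).inter
      ((isOpen_ne (x := (0 : I))).preimage (continuous_snd (X := I) (Y := I)))
    convert h using 1
    ext p
    simp only [Set.mem_preimage, Set.mem_ofPred_eq, vertexStar, vertexVal, Set.mem_inter_iff]
    tauto

/-- The section over the star of a `1`-cell. -/
noncomputable def edgeSection (e : E) : K.LocalSection gen where
  carrier := {z | K.edgeStar e z}
  val := K.edgeVal gen
  compat := by
    rintro _ _ _ _ (⟨g, e⟩ | ⟨g, e⟩ | ⟨g, c, i, j, t, t'⟩ | ⟨g, c, i, r⟩ | ⟨g, c, i, t⟩)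
    · simp [edgeStar]
    · simp [edgeStar]
    · simp [edgeStar]
    · simp [edgeStar]
    · simp only [Set.mem_ofPred_eq, edgeStar, edgeVal, orient]
      refine ⟨?_, by simp⟩
      split_ifs
      · simp
      · simp only [ne_eq, symm_eq_zero, symm_eq_one, one_ne_zero, not_false_eq_true, and_true]
        tauto
  isOpen_val := by
    intro g
    rw [isOpen_sum_iff, isOpen_sum_iff, isOpen_sigma_iff, isOpen_sigma_iff]
    refine ⟨isOpen_discrete _, fun e' => ?_, fun x => ?_⟩
    · have h := (((isOpen_ne (x := (0 : I))).inter (isOpen_ne (x := (1 : I)))).inter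
        (isOpen_const (p := e' = e))).inter (isOpen_const (p := (1 : G) = g))
      convert h using 1
      ext p
      simp only [Set.mem_preimage, Set.mem_ofPred_eq, edgeStar, edgeVal, Set.mem_inter_iff]
      tauto
    · have h := ((((isOpen_ne (x := (0 : I))).preimage (continuous_fst (X := I) (Y := I))).inter
        ((isOpen_ne (x := (1 : I))).preimage (continuous_fst (X := I) (Y := I)))).inter
        ((isOpen_ne (x := (0 : I))).preimage (continuous_snd (X := I) (Y := I)))).inter
        (isOpen_const (p := (K.bdry x.1 x.2).1 = e ∧ K.sideVal gen x.1 x.2 = g))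
      convert h using 1
      ext p
      simp only [Set.mem_preimage, Set.mem_ofPred_eq, edgeStar, edgeVal, Set.mem_inter_iff]
      tauto

/-- The section over the star of a `2`-cell. -/
noncomputable def faceSection (c : F) : K.LocalSection gen where
  carrier := {z | K.faceStar c z}
  val := fun _ => 1
  compat := by
    rintro _ _ _ _ (⟨g, e⟩ | ⟨g, e⟩ | ⟨g, c, i, j, t, t'⟩ | ⟨g, c, i, r⟩ | ⟨g, c, i, t⟩) <;>
      simp [faceStar]
  isOpen_val := by
    intro g
    rw [isOpen_sum_iff, isOpen_sum_iff, isOpen_sigma_iff, isOpen_sigma_iff]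
    refine ⟨isOpen_discrete _, fun e' => ?_, fun x => ?_⟩
    · convert isOpen_empty using 1
      ext p
      simp [faceStar]
    · have h := ((isOpen_ne (x := (1 : I))).preimage (continuous_snd (X := I) (Y := I))).inter
        (isOpen_const (p := x.1 = c ∧ (1 : G) = g))
      convert h using 1
      ext p
      simp only [Set.mem_preimage, Set.mem_ofPred_eq, faceStar, Set.mem_inter_iff]
      tauto

theorem mem_star (z : K.ConeCells) :
    K.vertexStar z ∨ (∃ e, K.edgeStar e z) ∨ ∃ c, K.faceStar c z := by
  have h0 : ∀ t : I, (t : ℝ) = 1 / 2 → t ≠ 0 ∧ t ≠ 1 := by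
    intro t ht
    constructor <;> rintro rfl <;> norm_num at ht
  rcases z with _ | ⟨e, t⟩ | ⟨⟨c, i⟩, t, r⟩
  · exact Or.inl trivial
  · by_cases ht : (t : ℝ) = 1 / 2
    · exact Or.inr (Or.inl ⟨e, rfl, h0 t ht⟩)
    · exact Or.inl ht
  · by_cases hr : r = 1
    · subst hr
      by_cases ht : (t : ℝ) = 1 / 2
      · exact Or.inr (Or.inl ⟨_, rfl, (h0 t ht).1, (h0 t ht).2, one_ne_zero⟩)
      · exact Or.inl ⟨ht, one_ne_zero⟩
    · exact Or.inr (Or.inr ⟨c, rfl, hr⟩)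

/-- The relators are needed only over the star of the vertex, where the corners of a polygon have to
match up. Over the other stars the sheet labels are consistent for any choice of generators. -/
theorem isQuotientCoveringMap_coverMap (hrel : ∀ c, K.wordVal gen c = 1) :
    IsQuotientCoveringMap (K.coverMap gen) G where
  toIsQuotientMap := K.isQuotientMap_coverMap gen
  continuous_const_smul h := by
    refine (isQuotientMap_quot_mk.continuous_iff (f := Quot.mk (K.CoverGlue gen))).2 ?_
    refine continuous_quot_mk.comp (g := Quot.mk (K.CoverGlue gen))
      (f := fun x : (Σ _ : G, K.ConeCells) => (⟨h * x.1, x.2⟩ : Σ _ : G, K.ConeCells)) ?_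
    exact continuous_sigma fun g => @continuous_sigmaMk G (fun _ => K.ConeCells) _ (h * g)
  apply_eq_iff_mem_orbit := by
    rintro ⟨g, z⟩ ⟨g', z'⟩
    constructor
    · intro h
      obtain ⟨g'', h⟩ := K.exists_eq_of_mk_eq gen h g
      exact ⟨g'' * g'⁻¹, by rw [h]; simp [smul_mk]⟩
    · rintro ⟨h, e⟩
      exact (congrArg (K.coverMap gen) e).symm
  disjoint := by
    rintro ⟨g, z⟩
    rcases K.mem_star z with h | ⟨e, h⟩ | ⟨c, h⟩
    · exact (vertexSection hrel).exists_nhds K gen h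
    · exact (edgeSection e).exists_nhds K gen h
    · exact (faceSection c).exists_nhds K gen h

variable (K) in
/-- The loop along a `1`-cell. -/
def edgeLoop (e : E) : Path K.conePt K.conePt where
  toFun t := Quot.mk _ (K.edg e t)
  continuous_toFun := continuous_quot_mk.comp (continuous_inr.comp (continuous_inl.comp
    (@continuous_sigmaMk E (fun _ => I) _ e)))
  source' := Quot.sound (.start e)
  target' := Quot.sound (.finish e)

/-- The class of the loop along a `1`-cell. -/
abbrev edgeClass (K : OneVertexComplex E F) (e : E) : FundamentalGroup K.ConeSpace K.conePt :=
  FundamentalGroup.fromPath (Path.Homotopic.Quotient.mk (K.edgeLoop e))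

/-- The fundamental group maps to every group in which the boundary words hold. -/
theorem exists_hom_of_wordVal (hrel : ∀ c, K.wordVal gen c = 1) :
    ∃ μ : FundamentalGroup K.ConeSpace K.conePt →* Gᵐᵒᵖ, ∀ e, μ (K.edgeClass e) =
      MulOpposite.op (gen e) := by
  have hp := isQuotientCoveringMap_coverMap hrel
  let y : K.Cover gen := Quot.mk _ ⟨1, K.vtx⟩
  let b : K.coverMap gen ⁻¹' {K.conePt} := ⟨y, rfl⟩
  refine ⟨hp.fundamentalGroupToMulOpposite b, fun e => ?_⟩
  rw [hp.fundamentalGroupToMulOpposite_apply_eq_Iff]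
  -- This lift of the loop along `e` runs from the vertex of sheet `1` to the vertex of sheet `gen
  -- e`, which computes the monodromy.
  let γ : Path y (Quot.mk _ ⟨gen e, K.vtx⟩) :=
    { toFun := fun t => Quot.mk _ ⟨1, K.edg e t⟩
      continuous_toFun := continuous_quot_mk.comp ((@continuous_sigmaMk G (fun _ => K.ConeCells) _ 1).comp
        (continuous_inr.comp (continuous_inl.comp (@continuous_sigmaMk E (fun _ => I) _ e))))
      source' := Quot.sound (.start 1 e)
      target' := (Quot.sound (.finish 1 e)).trans (by simp) }
  have h := hp.isCoveringMap.monodromy_map (Path.Homotopic.Quotient.mk γ)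
  have h' := congrArg Subtype.val h
  refine Eq.trans ?_ h'.symm
  simp [b, y, smul_mk]

end OneVertexComplex

/-! ### Homotopy classes of paths: subdivision, tracks of contractions, simply connected cells -/

open CategoryTheory

instance unitInterval.contractibleSpace : ContractibleSpace I :=
  (convex_Icc (0 : ℝ) 1).contractibleSpace ⟨0, by simp⟩

section Paths

variable {X : Type*} [TopologicalSpace X]

/-- A property of homotopy classes of paths which is closed under concatenation and which holds for
paths in the members of an open cover holds for all paths. -/
theorem Path.Homotopic.Quotient.induction_openCover {ι : Type*} (U : ι → Set X)
    (hU : ∀ i, IsOpen (U i)) (hcov : ∀ x, ∃ i, x ∈ U i)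
    (Q : ∀ {x y : X}, Path.Homotopic.Quotient x y → Prop)
    (trans : ∀ {x y z : X} (p : Path.Homotopic.Quotient x y) (q : Path.Homotopic.Quotient y z),
      Q p → Q q → Q (p.trans q))
    (small : ∀ i {x y : X} (p : Path x y), (∀ s, p s ∈ U i) → Q (Path.Homotopic.Quotient.mk p))
    {x y : X} (p : Path x y) : Q (Path.Homotopic.Quotient.mk p) := by
  obtain ⟨t, ht0, htm, ⟨n, hn⟩, hsub⟩ := exists_monotone_Icc_subset_open_cover_unitInterval
    (c := fun i => p ⁻¹' U i) (fun i => (hU i).preimage p.continuous)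
    (fun s _ => by simpa using hcov (p s))
  have hs : ∀ n, Q (Path.Homotopic.Quotient.mk (p.subpath (t n) (t (n + 1)))) := by
    intro n
    obtain ⟨i, hi⟩ := hsub n
    refine small i _ fun s => ?_
    have h : p.subpath (t n) (t (n + 1)) s ∈ Set.range (p.subpath (t n) (t (n + 1))) := ⟨s, rfl⟩
    rw [p.range_subpath_of_le _ _ (htm n.le_succ)] at h
    obtain ⟨s', hs', e⟩ := h
    rw [← e]
    exact hi hs'
  have key : ∀ n, Q (Path.Homotopic.Quotient.mk (p.subpath (t 0) (t (n + 1)))) := by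
    intro n
    induction n with
    | zero => exact hs 0
    | succ n ih =>
      have h := trans _ _ ih (hs (n + 1))
      rw [← Path.Homotopic.Quotient.mk_trans] at h
      rwa [Path.Homotopic.Quotient.eq.2 ⟨Path.Homotopy.subpathTransSubpath p _ _ _⟩] at h
  have h := key n
  rw [ht0, hn _ n.le_succ] at h
  have aux : ∀ {x' y' : X} (hx : x' = x) (hy : y' = y) (q : Path x' y'), q = p.cast hx hy →
      Q (Path.Homotopic.Quotient.mk q) → Q (Path.Homotopic.Quotient.mk p) := by
    rintro x' y' rfl rfl q rfl h
    exact h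
  exact aux p.source p.target _ p.subpath_zero_one h

/-- A path in a subset which contracts in the whole space to a point is determined by the tracks of
its ends. -/
theorem Path.Homotopic.trans_track {U : Set X} (H : U × I → X) (hH : Continuous H) {a : X}
    (h0 : ∀ x, H (x, 0) = x) (h1 : ∀ x, H (x, 1) = a) {x y : X} (p : Path x y)
    (hp : ∀ s, p s ∈ U) (τx : Path x a) (τy : Path y a) (hx : ∀ (h : x ∈ U) s, τx s = H (⟨x, h⟩, s))
    (hy : ∀ (h : y ∈ U) s, τy s = H (⟨y, h⟩, s)) : (p.trans τy).Homotopic τx := by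
  have hxU : x ∈ U := by simpa using hp 0
  have hyU : y ∈ U := by simpa using hp 1
  let q : Path (⟨x, hxU⟩ : U) ⟨y, hyU⟩ :=
    { toFun := fun s => ⟨p s, hp s⟩
      continuous_toFun := p.continuous.subtype_mk _
      source' := by simp
      target' := by simp }
  let f : C(U, X) := ⟨Subtype.val, continuous_subtype_val⟩
  let g : C(U, X) := ContinuousMap.const U a
  let F : f.Homotopy g :=
    { toFun := fun z => H (z.2, z.1)
      continuous_toFun := hH.comp continuous_swap
      map_zero_left := h0
      map_one_left := h1 }
  have h := Path.Homotopic.map_trans_evalAt F q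
  have e₁ : q.map (map_continuous f) = p := by ext s; rfl
  have e₂ : F.evalAt ⟨y, hyU⟩ = τy := by ext s; exact (hy hyU s).symm
  have e₃ : F.evalAt ⟨x, hxU⟩ = τx := by ext s; exact (hx hxU s).symm
  have e₄ : q.map (map_continuous g) = Path.refl a := by ext s; rfl
  have h' : (p.trans τy).Homotopic (τx.trans (Path.refl a)) := by
    rw [← e₁, ← e₂, ← e₃, ← e₄]
    exact h
  exact h'.trans ⟨Path.Homotopy.transRefl _⟩

variable {Y : Type*} [TopologicalSpace Y] [SimplyConnectedSpace Y]

/-- The class of the images of the paths between two points of a simply connected space. -/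
noncomputable def cellHom (χ : C(Y, X)) (p q : Y) {x y : X} (hx : χ p = x) (hy : χ q = y) :
    FundamentalGroupoid.mk x ⟶ FundamentalGroupoid.mk y :=
  Path.Homotopic.Quotient.mk
    (((PathConnectedSpace.somePath p q).map χ.continuous).cast hx.symm hy.symm)

/-- Paths with the same ends in a simply connected space are homotopic, so the arbitrary path in
`cellHom` may be replaced by any convenient one. The calculus of `cellHom` rests on this. -/
theorem mk_eq_cellHom (χ : C(Y, X)) {p q : Y} (δ : Path p q) {x y : X} (hx : χ p = x) (hy : χ q = y)
    (γ : Path x y) (h : ∀ s, γ s = χ (δ s)) :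
    (Path.Homotopic.Quotient.mk γ : FundamentalGroupoid.mk x ⟶ FundamentalGroupoid.mk y) =
      cellHom χ p q hx hy := by
  subst hx hy
  obtain rfl : γ = δ.map χ.continuous := by ext s; exact h s
  exact Path.Homotopic.Quotient.eq.2 ((SimplyConnectedSpace.paths_homotopic δ _).map χ)

theorem cellHom_trans (χ : C(Y, X)) (p q r : Y) {x y z : X} (hx : χ p = x) (hy : χ q = y)
    (hz : χ r = z) : cellHom χ p q hx hy ≫ cellHom χ q r hy hz = cellHom χ p r hx hz := by
  subst hx hy hz
  rw [← mk_eq_cellHom χ ((PathConnectedSpace.somePath p q).trans (PathConnectedSpace.somePath q r))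
    rfl rfl (((PathConnectedSpace.somePath p q).map χ.continuous).trans
      ((PathConnectedSpace.somePath q r).map χ.continuous)) (fun s => by rw [← Path.map_trans]; rfl)]
  rfl

theorem cellHom_self (χ : C(Y, X)) (p : Y) {x : X} (hx : χ p = x) : cellHom χ p p hx hx = 𝟙 _ :=
  (mk_eq_cellHom χ (Path.refl p) hx hx (Path.refl x) (fun _ => hx.symm)).symm

theorem inv_cellHom (χ : C(Y, X)) (p q : Y) {x y : X} (hx : χ p = x) (hy : χ q = y) :
    inv (cellHom χ p q hx hy) = cellHom χ q p hy hx := by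
  apply IsIso.inv_eq_of_hom_inv_id
  rw [cellHom_trans, cellHom_self]

/-- Transfers a class between two cells along a common face: two paths that become equal after
gluing are enough. -/
theorem cellHom_congr {Y' : Type*} [TopologicalSpace Y'] [SimplyConnectedSpace Y'] (χ : C(Y, X))
    (χ' : C(Y', X)) {p q : Y} (δ : Path p q) {p' q' : Y'} (δ' : Path p' q') {x y : X} (hx : χ p = x)
    (hy : χ q = y) (hx' : χ' p' = x) (hy' : χ' q' = y) (h : ∀ s, χ (δ s) = χ' (δ' s)) :
    cellHom χ p q hx hy = cellHom χ' p' q' hx' hy' := by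
  rw [← mk_eq_cellHom χ δ hx hy ((δ.map χ.continuous).cast hx.symm hy.symm) (fun _ => rfl),
    mk_eq_cellHom χ' δ' hx' hy' _ h]

theorem cellHom_const (χ : C(Y, X)) {p q : Y} (δ : Path p q) {x : X} (hx : χ p = x)
    (hy : χ q = x) (h : ∀ s, χ (δ s) = x) : cellHom χ p q hx hy = 𝟙 _ :=
  (mk_eq_cellHom χ δ hx hy (Path.refl x) (fun s => (h s).symm)).symm

/-- The straight path in the unit interval. -/
def linePath (t a : I) : Path t a where
  toFun := Set.Icc.convexComb t a
  continuous_toFun := by fun_prop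
  source' := by simp
  target' := by simp

theorem linePath_symm (t a s : I) : σ (linePath t a s) = linePath (σ t) (σ a) s := by
  apply Subtype.ext
  simp only [linePath, Path.coe_mk', ContinuousMap.coe_mk, coe_symm_eq, Set.Icc.coe_convexComb]
  ring

theorem linePath_self (t s : I) : linePath t t s = t := by
  simp [linePath]

theorem continuous_linePath : Continuous fun x : I × I × I => linePath x.1 x.2.1 x.2.2 :=
  Set.Icc.continuous_convexComb_prod

end Paths

/-! ### Contractible stars of cells -/

namespace OneVertexComplex

universe u v w

variable {E : Type u} {F : Type v} (K : OneVertexComplex E F)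

/-- The characteristic map of a `1`-cell. -/
def edgeChar (e : E) : C(I, K.ConeSpace) where
  toFun t := Quot.mk _ (K.edg e t)
  continuous_toFun := continuous_quot_mk.comp (continuous_inr.comp (continuous_inl.comp
    (@continuous_sigmaMk E (fun _ => I) _ e)))

/-- The characteristic map of a triangle. -/
def triChar (x : K.Corner) : C(I × I, K.ConeSpace) where
  toFun p := Quot.mk _ (K.tri x.1 x.2 p.1 p.2)
  continuous_toFun := continuous_quot_mk.comp (continuous_inr.comp (continuous_inr.comp
    (@continuous_sigmaMk K.Corner (fun _ => I × I) _ x)))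

/-- The straight path in the unit square. -/
def linePath₂ (p q : I × I) : Path p q := (linePath p.1 q.1).prod (linePath p.2 q.2)

theorem linePath₂_apply (p q : I × I) (s : I) :
    linePath₂ p q s = (linePath p.1 q.1 s, linePath p.2 q.2 s) := rfl

/-- The point at time `s` of the straight path. -/
def slide (t a s : I) : I := linePath t a s

theorem slide_self (t s : I) : slide t t s = t := linePath_self t s

theorem slide_symm (t a s : I) : σ (slide t a s) = slide (σ t) (σ a) s := linePath_symm t a s

theorem slide_zero (t a : I) : slide t a 0 = t := (linePath t a).source

theorem slide_one (t a : I) : slide t a 1 = a := (linePath t a).target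

/-- The flow which moves every point on a straight line to a target in the same cell. -/
def flow (a : E → I → I) (b : K.Corner → I × I → I × I) (s : I) : K.ConeCells → K.ConeCells
  | Sum.inl x => Sum.inl x
  | Sum.inr (Sum.inl x) => K.edg x.1 (slide x.2 (a x.1 x.2) s)
  | Sum.inr (Sum.inr x) => Sum.inr (Sum.inr ⟨x.1, slide x.2.1 (b x.1 x.2).1 s, slide x.2.2 (b x.1 x.2).2 s⟩)

theorem continuousAt_of_isOpenEmbedding {A B C T : Type*} [TopologicalSpace A] [TopologicalSpace B]
    [TopologicalSpace C] [TopologicalSpace T] {j : A → B} (hj : IsOpenEmbedding j) (f : B × T → C)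
    (a : A) (s : T) (h : ContinuousAt (fun x : A × T => f (j x.1, x.2)) (a, s)) :
    ContinuousAt f (j a, s) :=
  ((hj.prodMap IsOpenEmbedding.id).continuousAt_iff (x := (a, s))).1 h

/-- An open subset of the complex, given before gluing, with a contraction which moves each point on
a straight line to a target in the same cell. -/
structure Contraction where
  carrier : Set K.ConeCells
  isOpen_carrier : IsOpen carrier
  saturated : ∀ z z', K.ConeGlue z z' → (z ∈ carrier ↔ z' ∈ carrier)
  edgeTarget : E → I → I
  triTarget : K.Corner → I × I → I × I
  continuousOn_edge : ∀ e, ContinuousOn (edgeTarget e) {t | K.edg e t ∈ carrier}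
  continuousOn_tri : ∀ x, ContinuousOn (triTarget x) {p | Sum.inr (Sum.inr ⟨x, p⟩) ∈ carrier}
  flow_glue : ∀ z z', K.ConeGlue z z' → z ∈ carrier → ∀ s,
    (Quot.mk _ (K.flow edgeTarget triTarget s z) : K.ConeSpace) =
      Quot.mk _ (K.flow edgeTarget triTarget s z')
  center : K.ConeSpace
  flow_one : ∀ z ∈ carrier, Quot.mk _ (K.flow edgeTarget triTarget 1 z) = center

namespace Contraction

variable {K} (S : K.Contraction)

/-- The flow of a contraction. -/
abbrev flowMap (s : I) (z : K.ConeCells) : K.ConeCells := K.flow S.edgeTarget S.triTarget s z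

/-- The open subset of the complex. -/
def image : Set K.ConeSpace := Quot.mk _ '' S.carrier

theorem mem_carrier_iff_of_eq {z z' : K.ConeCells}
    (h : (Quot.mk _ z : K.ConeSpace) = Quot.mk _ z') : z ∈ S.carrier ↔ z' ∈ S.carrier := by
  have h' := Quot.eqvGen_exact h
  clear h
  induction h' with
  | rel x y hxy => exact S.saturated x y hxy
  | refl x => rfl
  | symm x y _ ih => exact ih.symm
  | trans x y z _ _ ih₁ ih₂ => exact ih₁.trans ih₂

theorem mk_mem_image {z : K.ConeCells} : Quot.mk _ z ∈ S.image ↔ z ∈ S.carrier := by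
  constructor
  · rintro ⟨z', hz', h⟩
    exact (S.mem_carrier_iff_of_eq h).1 hz'
  · exact fun h => ⟨z, h, rfl⟩

theorem preimage_image : Quot.mk K.ConeGlue ⁻¹' S.image = S.carrier :=
  Set.ext fun _ => S.mk_mem_image

theorem isOpen_image : IsOpen S.image := by
  rw [← (isQuotientMap_quot_mk (r := K.ConeGlue)).isOpen_preimage, preimage_image]
  exact S.isOpen_carrier

theorem flow_zero (z : K.ConeCells) : S.flowMap 0 z = z := by
  rcases z with _ | ⟨e, t⟩ | ⟨x, p⟩
  · rfl
  · simp [flowMap, flow, slide_zero]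
  · simp [flowMap, flow, slide_zero]

theorem flow_eq_of_mk_eq {z z' : K.ConeCells} (h : (Quot.mk _ z : K.ConeSpace) = Quot.mk _ z')
    (hz : z ∈ S.carrier) (s : I) :
    (Quot.mk _ (S.flowMap s z) : K.ConeSpace) = Quot.mk _ (S.flowMap s z') := by
  have h' := Quot.eqvGen_exact h
  clear h
  induction h' with
  | rel x y hxy => exact S.flow_glue x y hxy hz s
  | refl x => rfl
  | symm x y h ih =>
    exact (ih ((S.mem_carrier_iff_of_eq (Quot.eqvGen_sound h)).2 hz)).symm
  | trans x y z h₁ _ ih₁ ih₂ =>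
    exact (ih₁ hz).trans (ih₂ ((S.mem_carrier_iff_of_eq (Quot.eqvGen_sound h₁)).1 hz))

theorem continuous_flow :
    Continuous fun x : S.carrier × I => (Quot.mk _ (S.flowMap x.2 x.1) : K.ConeSpace) := by
  refine continuous_quot_mk.comp ?_
  have hopen : IsOpen (S.carrier ×ˢ (Set.univ : Set I)) := S.isOpen_carrier.prod isOpen_univ
  suffices h : ContinuousOn (fun x : K.ConeCells × I => S.flowMap x.2 x.1)
      (S.carrier ×ˢ Set.univ) by
    refine h.comp_continuous (f := fun x : S.carrier × I => ((x.1 : K.ConeCells), x.2)) (by fun_prop)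
      fun x => ⟨x.1.2, trivial⟩
  rintro ⟨z, s⟩ ⟨hz, -⟩
  refine ContinuousAt.continuousWithinAt ?_
  rcases z with x | ⟨e, t⟩ | ⟨x, p⟩
  · refine continuousAt_of_isOpenEmbedding IsOpenEmbedding.inl _ _ s ?_
    exact continuousAt_const (y := K.vtx)
  · have hj : IsOpenEmbedding fun t => K.edg e t :=
      IsOpenEmbedding.inr.comp (IsOpenEmbedding.inl.comp IsOpenEmbedding.sigmaMk)
    refine continuousAt_of_isOpenEmbedding hj _ t s ?_
    have ha : ContinuousAt (S.edgeTarget e) t :=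
      (S.continuousOn_edge e).continuousAt ((S.isOpen_carrier.preimage hj.continuous).mem_nhds hz)
    refine ContinuousAt.comp (g := fun t => K.edg e t)
      (f := fun x : I × I => linePath x.1 (S.edgeTarget e x.1) x.2) hj.continuous.continuousAt ?_
    refine ContinuousAt.comp (x := (t, s)) (g := fun y : I × I × I => linePath y.1 y.2.1 y.2.2)
      (f := fun x : I × I => (x.1, S.edgeTarget e x.1, x.2)) continuous_linePath.continuousAt ?_
    exact continuousAt_fst.prodMk ((ContinuousAt.comp (f := Prod.fst) (x := (t, s)) ha
      continuousAt_fst).prodMk continuousAt_snd)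
  · have hj : IsOpenEmbedding fun p : I × I => (Sum.inr (Sum.inr ⟨x, p⟩) : K.ConeCells) :=
      IsOpenEmbedding.inr.comp (IsOpenEmbedding.inr.comp IsOpenEmbedding.sigmaMk)
    refine continuousAt_of_isOpenEmbedding hj _ p s ?_
    have ha : ContinuousAt (S.triTarget x) p :=
      (S.continuousOn_tri x).continuousAt ((S.isOpen_carrier.preimage hj.continuous).mem_nhds hz)
    refine ContinuousAt.comp (g := fun p : I × I => (Sum.inr (Sum.inr ⟨x, p⟩) : K.ConeCells))
      (f := fun y : (I × I) × I => linePath₂ y.1 (S.triTarget x y.1) y.2)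
      hj.continuous.continuousAt ?_
    have ha' : ContinuousAt (fun y : (I × I) × I => S.triTarget x y.1) (p, s) :=
      ContinuousAt.comp (f := Prod.fst) (x := (p, s)) ha continuousAt_fst
    refine ContinuousAt.prodMk ?_ ?_
    · refine ContinuousAt.comp (x := (p, s)) (g := fun y : I × I × I => linePath y.1 y.2.1 y.2.2)
        (f := fun y : (I × I) × I => (y.1.1, (S.triTarget x y.1).1, y.2))
        continuous_linePath.continuousAt ?_
      exact continuousAt_fst.fst.prodMk (ha'.fst.prodMk continuousAt_snd)
    · refine ContinuousAt.comp (x := (p, s)) (g := fun y : I × I × I => linePath y.1 y.2.1 y.2.2)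
        (f := fun y : (I × I) × I => (y.1.2, (S.triTarget x y.1).2, y.2))
        continuous_linePath.continuousAt ?_
      exact continuousAt_fst.snd.prodMk (ha'.snd.prodMk continuousAt_snd)

/-- The track of a point under the flow of a contraction. -/
def track (z : K.ConeCells) (hz : z ∈ S.carrier) : Path (Quot.mk _ z : K.ConeSpace) S.center where
  toFun s := Quot.mk _ (S.flowMap s z)
  continuous_toFun := S.continuous_flow.comp (f := fun s : I => ((⟨z, hz⟩ : S.carrier), s))
    (by fun_prop)
  source' := by rw [flow_zero]
  target' := S.flow_one z hz

/-- A path in the set which is contracted is determined by the tracks of its ends. -/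
theorem trans_track {z z' : K.ConeCells} (hz : z ∈ S.carrier) (hz' : z' ∈ S.carrier)
    (p : Path (Quot.mk _ z : K.ConeSpace) (Quot.mk _ z')) (hp : ∀ s, p s ∈ S.image) :
    (p.trans (S.track z' hz')).Homotopic (S.track z hz) := by
  -- A quotient map restricted to an open saturated set remains one, also after multiplication by
  -- the locally compact interval. Thus `H`, defined by choosing representatives, is continuous.
  have hq : IsQuotientMap (S.image.restrictPreimage (Quot.mk K.ConeGlue)) :=
    isQuotientMap_quot_mk.restrictPreimage_isOpen S.isOpen_image
  let ℓ : S.image → K.ConeCells := fun x => x.2.choose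
  have hℓ : ∀ x, ℓ x ∈ S.carrier ∧ Quot.mk _ (ℓ x) = (x : K.ConeSpace) := fun x => x.2.choose_spec
  let H : S.image × I → K.ConeSpace := fun x => Quot.mk _ (S.flowMap x.2 (ℓ x.1))
  have hH : ∀ (y : K.ConeCells) (hy : y ∈ S.carrier) s,
      H (⟨Quot.mk _ y, S.mk_mem_image.2 hy⟩, s) = Quot.mk _ (S.flowMap s y) := fun y hy s =>
    S.flow_eq_of_mk_eq (hℓ _).2 (hℓ _).1 s
  refine Path.Homotopic.trans_track H ?_ ?_ ?_ p hp _ _ ?_ ?_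
  · refine hq.continuous_lift_prod_left ?_
    have h : Continuous fun y : (Quot.mk K.ConeGlue ⁻¹' S.image) × I =>
        (Quot.mk _ (S.flowMap y.2 y.1) : K.ConeSpace) :=
      S.continuous_flow.comp (f := fun y : (Quot.mk K.ConeGlue ⁻¹' S.image) × I =>
        ((⟨y.1, S.mk_mem_image.1 y.1.2⟩ : S.carrier), y.2)) (by fun_prop)
    convert h using 2 with y
    exact hH y.1 (S.mk_mem_image.1 y.1.2) y.2
  · intro x
    change Quot.mk _ (S.flowMap 0 (ℓ x)) = _
    rw [flow_zero, (hℓ x).2]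
  · exact fun x => S.flow_one _ (hℓ x).1
  · exact fun _ s => (hH z hz s).symm
  · exact fun _ s => (hH z' hz' s).symm

end Contraction

/-- The end of the unit interval which is closest. -/
noncomputable def nearEnd (t : I) : I := open Classical in if (t : ℝ) < 1 / 2 then 0 else 1

theorem continuousOn_nearEnd : ContinuousOn nearEnd {t : I | (t : ℝ) ≠ 1 / 2} := by
  intro t ht
  refine ContinuousAt.continuousWithinAt ?_
  rcases lt_or_gt_of_ne ht with h | h
  · refine (continuousAt_const (y := (0 : I))).congr ?_
    filter_upwards [(isOpen_lt continuous_subtype_val continuous_const).mem_nhds h] with s hs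
    exact (if_pos hs).symm
  · refine (continuousAt_const (y := (1 : I))).congr ?_
    filter_upwards [(isOpen_lt continuous_const continuous_subtype_val).mem_nhds h] with s hs
    exact (if_neg (not_lt.2 (le_of_lt hs))).symm

theorem nearEnd_symm {t : I} (ht : (t : ℝ) ≠ 1 / 2) : nearEnd (σ t) = σ (nearEnd t) := by
  rcases lt_or_gt_of_ne ht with h | h
  · rw [nearEnd, nearEnd, if_pos h, if_neg (by rw [coe_symm_eq]; linarith), symm_zero]
  · rw [nearEnd, nearEnd, if_neg h.not_gt, if_pos (by rw [coe_symm_eq]; linarith), symm_one]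

theorem nearEnd_zero : nearEnd 0 = 0 := by
  rw [nearEnd, if_pos (by norm_num)]

theorem nearEnd_one : nearEnd 1 = 1 := by
  rw [nearEnd, if_neg (by norm_num)]

theorem nearEnd_cases (t : I) : nearEnd t = 0 ∨ nearEnd t = 1 := by
  unfold nearEnd
  split_ifs <;> simp

/-- For the trivial group a local section amounts to an open saturated set. The openness and
saturation of the stars, proved for coverings, can therefore be reused for the contractions. -/
theorem coverGlue_unit {z z' : K.ConeCells} (h : K.ConeGlue z z') :
    K.CoverGlue (fun _ => (1 : Unit)) ⟨1, z⟩ ⟨1, z'⟩ := by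
  rcases h with ⟨e⟩ | ⟨e⟩ | ⟨c, i, j, t, t'⟩ | ⟨c, i, r⟩ | ⟨c, i, t⟩
  · exact .start ..
  · exact .finish ..
  · exact .apex ..
  · exact .radial ..
  · exact .side ..

theorem LocalSection.isOpen_carrier (s : K.LocalSection (fun _ => (1 : Unit))) :
    IsOpen s.carrier := by
  convert s.isOpen_val 1 using 1
  ext z
  simp

theorem LocalSection.saturated (s : K.LocalSection (fun _ => (1 : Unit))) {z z' : K.ConeCells}
    (h : K.ConeGlue z z') : z ∈ s.carrier ↔ z' ∈ s.carrier :=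
  (s.compat _ _ _ _ (K.coverGlue_unit h)).1

theorem mk_start (e : E) : (Quot.mk _ (K.edg e 0) : K.ConeSpace) = K.conePt := Quot.sound (.start e)

theorem mk_finish (e : E) : (Quot.mk _ (K.edg e 1) : K.ConeSpace) = K.conePt :=
  Quot.sound (.finish e)

theorem mk_side (c : F) (i : (K.polygon c).Index) (t : I) : (Quot.mk _ (K.tri c i t 1) : K.ConeSpace) =
    Quot.mk _ (K.edg (K.bdry c i).1 (orient (K.bdry c i).2 t)) := Quot.sound (.side ..)

theorem mk_corner (c : F) (i : (K.polygon c).Index) :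
    (Quot.mk _ (K.tri c i 0 1) : K.ConeSpace) = K.conePt := by
  rw [mk_side, orient]
  split_ifs
  · exact K.mk_start _
  · rw [symm_zero]; exact K.mk_finish _

theorem mk_corner' (c : F) (i : (K.polygon c).Index) :
    (Quot.mk _ (K.tri c i 1 1) : K.ConeSpace) = K.conePt := by
  rw [mk_side, orient]
  split_ifs
  · exact K.mk_finish _
  · rw [symm_one]; exact K.mk_start _

/-- The contraction of the star of the vertex. -/
noncomputable def vertexContraction : K.Contraction where
  carrier := {z | K.vertexStar z}
  isOpen_carrier := LocalSection.isOpen_carrier K (vertexSection fun _ => rfl)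
  saturated _ _ h := LocalSection.saturated K (vertexSection fun _ => rfl) h
  edgeTarget _ t := nearEnd t
  triTarget _ p := (nearEnd p.1, 1)
  continuousOn_edge _ := continuousOn_nearEnd
  continuousOn_tri _ := (continuousOn_nearEnd.comp continuousOn_fst fun _ h => h.1).prodMk
    continuousOn_const
  flow_glue := by
    rintro _ _ (⟨e⟩ | ⟨e⟩ | ⟨c, i, j, t, t'⟩ | ⟨c, i, r⟩ | ⟨c, i, t⟩) h s
    · simp only [flow, nearEnd_zero, slide_self]
      exact K.mk_start e
    · simp only [flow, nearEnd_one, slide_self]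
      exact K.mk_finish e
    · exact absurd rfl h.2
    · simp only [flow, nearEnd_zero, nearEnd_one, slide_self]
      exact Quot.sound (.radial ..)
    · simp only [flow, slide_self]
      refine (K.mk_side c i _).trans ?_
      have ht : (t : ℝ) ≠ 1 / 2 := h.1
      simp only [orient]
      split_ifs
      · rfl
      · rw [slide_symm, nearEnd_symm ht]
  center := K.conePt
  flow_one := by
    rintro (_ | ⟨e, t⟩ | ⟨⟨c, i⟩, t, r⟩) h
    · rfl
    · simp only [flow, slide_one]
      rcases nearEnd_cases t with h | h <;> rw [h]
      · exact K.mk_start e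
      · exact K.mk_finish e
    · simp only [flow, slide_one]
      rcases nearEnd_cases t with h | h <;> rw [h]
      · exact K.mk_corner c i
      · exact K.mk_corner' c i

/-- The midpoint of the unit interval. -/
noncomputable def midpt : I := ⟨1 / 2, by norm_num, by norm_num⟩

theorem symm_midpt : σ midpt = midpt := by
  apply Subtype.ext
  rw [coe_symm_eq]
  norm_num [midpt]

theorem orient_midpt (b : Bool) : orient b midpt = midpt := by
  rw [orient, symm_midpt, ite_self]

/-- The contraction of the star of a `1`-cell. -/
noncomputable def edgeContraction (e : E) : K.Contraction where
  carrier := {z | K.edgeStar e z}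
  isOpen_carrier := LocalSection.isOpen_carrier K (edgeSection e)
  saturated _ _ h := LocalSection.saturated K (edgeSection e) h
  edgeTarget _ _ := midpt
  triTarget _ _ := (midpt, 1)
  continuousOn_edge _ := continuousOn_const
  continuousOn_tri _ := continuousOn_const
  flow_glue := by
    rintro _ _ (⟨e⟩ | ⟨e⟩ | ⟨c, i, j, t, t'⟩ | ⟨c, i, r⟩ | ⟨c, i, t⟩) h s
    · exact absurd rfl h.2.1
    · exact absurd rfl h.2.2
    · exact absurd rfl h.2.2.2
    · exact absurd rfl h.2.2.1
    · simp only [flow, slide_self]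
      refine (K.mk_side c i _).trans ?_
      simp only [orient]
      split_ifs
      · rfl
      · rw [slide_symm, symm_midpt]
  center := Quot.mk _ (K.edg e midpt)
  flow_one := by
    rintro (_ | ⟨e, t⟩ | ⟨⟨c, i⟩, t, r⟩) h
    · exact h.elim
    · obtain ⟨rfl, -⟩ := h
      simp only [flow, slide_one]
    · obtain ⟨rfl, -⟩ := h
      simp only [flow, slide_one]
      refine (K.mk_side c i _).trans ?_
      rw [orient_midpt]

theorem mk_apex (c : F) (i j : (K.polygon c).Index) (t t' : I) :
    (Quot.mk _ (K.tri c i t 0) : K.ConeSpace) = Quot.mk _ (K.tri c j t' 0) := Quot.sound (.apex ..)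

/-- The contraction of the star of a `2`-cell. -/
noncomputable def faceContraction (c : F) : K.Contraction where
  carrier := {z | K.faceStar c z}
  isOpen_carrier := LocalSection.isOpen_carrier K (faceSection c)
  saturated _ _ h := LocalSection.saturated K (faceSection c) h
  edgeTarget _ t := t
  triTarget _ p := (p.1, 0)
  continuousOn_edge _ := continuousOn_id
  continuousOn_tri _ := continuousOn_fst.prodMk continuousOn_const
  flow_glue := by
    rintro _ _ (⟨e⟩ | ⟨e⟩ | ⟨c, i, j, t, t'⟩ | ⟨c, i, r⟩ | ⟨c, i, t⟩) h s
    · exact h.elim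
    · exact h.elim
    · simp only [flow, slide_self]
      exact K.mk_apex ..
    · simp only [flow, slide_self]
      exact Quot.sound (.radial ..)
    · exact absurd rfl h.2
  center := Quot.mk _ (K.tri c 0 0 0)
  flow_one := by
    rintro (_ | ⟨e, t⟩ | ⟨⟨c, i⟩, t, r⟩) h
    · exact h.elim
    · exact h.elim
    · obtain ⟨rfl, -⟩ := h
      simp only [flow, slide_one]
      exact K.mk_apex ..

end OneVertexComplex

/-! ### Loops along 1-cells and reference classes of paths -/

theorem prefixProd_of_telescope {G : Type*} [Group G] {m : ℕ} (f u : Fin (m + 1) → G)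
    (h : ∀ i, f i = u i * (u (i + 1))⁻¹) (i : Fin (m + 1)) : prefixProd f i = u 0 * (u i)⁻¹ := by
  obtain ⟨n, hn⟩ := i
  induction n with
  | zero => simpa using prefixProd_zero f
  | succ n ih =>
    have hn' : n < m + 1 := by omega
    have e : (⟨n + 1, hn⟩ : Fin (m + 1)) = ⟨n, hn'⟩ + 1 := by
      ext
      rw [Fin.val_add_one_of_lt]
      exact Fin.lt_def.2 (by simp; omega)
    rw [e, prefixProd_of_lt f ⟨n, hn'⟩ hn, ih hn', h]
    group

theorem cellHom_eq_of_eq {X Y : Type*} [TopologicalSpace X] [TopologicalSpace Y]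
    [SimplyConnectedSpace Y] (χ : C(Y, X)) {p p' q q' : Y} {x y : X} (hx : χ p = x) (hy : χ q = y)
    (hp : p = p') (hq : q = q') :
    cellHom χ p q hx hy = cellHom χ p' q' (hp ▸ hx) (hq ▸ hy) := by
  subst hp hq
  rfl

namespace OneVertexComplex

universe u v w

variable {E : Type u} {F : Type v} (K : OneVertexComplex E F)

/-- The fundamental group, with the product of loops given by concatenation. -/
abbrev LoopGroup : Type (max u v) := (FundamentalGroup K.ConeSpace K.conePt)ᵐᵒᵖ

variable {K}

/-- An element of the fundamental group as a morphism of the fundamental groupoid. -/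
def arr (g : K.LoopGroup) :
    FundamentalGroupoid.mk K.conePt ⟶ FundamentalGroupoid.mk K.conePt := g.unop

/-- A loop as an element of the fundamental group. -/
def ofArr (m : FundamentalGroupoid.mk K.conePt ⟶ FundamentalGroupoid.mk K.conePt) : K.LoopGroup :=
  MulOpposite.op m

theorem arr_ofArr (m : FundamentalGroupoid.mk K.conePt ⟶ FundamentalGroupoid.mk K.conePt) :
    arr (ofArr m) = m := rfl

theorem arr_injective : Function.Injective (arr (K := K)) := MulOpposite.unop_injective

theorem arr_one : arr (1 : K.LoopGroup) = 𝟙 _ := rfl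

theorem arr_mul (g h : K.LoopGroup) : arr (g * h) = arr g ≫ arr h := rfl

theorem arr_inv (g : K.LoopGroup) : arr g⁻¹ = inv (arr g) := by
  symm
  apply IsIso.inv_eq_of_hom_inv_id
  rw [← arr_mul, mul_inv_cancel, arr_one]

variable (K) in
/-- The classes of the `1`-cells. -/
def loopGen (e : E) : K.LoopGroup := MulOpposite.op (K.edgeClass e)

theorem edgeChar_apply (e : E) (t : I) : K.edgeChar e t = Quot.mk _ (K.edg e t) := rfl

theorem triChar_apply (x : K.Corner) (p : I × I) :
    K.triChar x p = Quot.mk _ (Sum.inr (Sum.inr ⟨x, p⟩)) := rfl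

theorem edgeChar_zero (e : E) : K.edgeChar e 0 = K.conePt := K.mk_start e

theorem edgeChar_one (e : E) : K.edgeChar e 1 = K.conePt := K.mk_finish e

theorem triChar_corner (x : K.Corner) : K.triChar x (0, 1) = K.conePt := K.mk_corner x.1 x.2

theorem triChar_corner' (x : K.Corner) : K.triChar x (1, 1) = K.conePt := K.mk_corner' x.1 x.2

theorem triChar_apex (c : F) (i : (K.polygon c).Index) (t : I) :
    K.triChar ⟨c, i⟩ (t, 0) = Quot.mk _ (K.tri c 0 0 0) := K.mk_apex ..

theorem triChar_side (c : F) (i : (K.polygon c).Index) (t : I) : K.triChar ⟨c, i⟩ (t, 1) =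
    K.edgeChar (K.bdry c i).1 (orient (K.bdry c i).2 t) := K.mk_side c i t

theorem edgeChar_orient_zero (x : E × Bool) : K.edgeChar x.1 (orient x.2 0) = K.conePt := by
  rcases x with ⟨e, _ | _⟩
  · exact (congrArg (K.edgeChar e) symm_zero).trans (K.mk_finish e)
  · exact K.mk_start e

theorem edgeChar_orient_one (x : E × Bool) : K.edgeChar x.1 (orient x.2 1) = K.conePt := by
  rcases x with ⟨e, _ | _⟩
  · exact (congrArg (K.edgeChar e) symm_one).trans (K.mk_start e)
  · exact K.mk_finish e

theorem arr_loopGen (e : E) :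
    arr (K.loopGen e) = cellHom (K.edgeChar e) 0 1 (edgeChar_zero e) (edgeChar_one e) :=
  mk_eq_cellHom (K.edgeChar e) (linePath 0 1) _ _ (K.edgeLoop e) (fun s => by
    simp [edgeLoop, edgeChar, linePath, Set.Icc.convexComb])

theorem arr_letterVal (x : E × Bool) : arr (letterVal K.loopGen x) =
    cellHom (K.edgeChar x.1) (orient x.2 0) (orient x.2 1) (edgeChar_orient_zero x)
      (edgeChar_orient_one x) := by
  rcases x with ⟨e, _ | _⟩
  · have h : letterVal K.loopGen (e, false) = (K.loopGen e)⁻¹ := rfl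
    rw [h, arr_inv, arr_loopGen, inv_cellHom]
    have h0 : orient false 0 = 1 := symm_zero
    have h1 : orient false 1 = 0 := symm_one
    exact cellHom_eq_of_eq _ _ _ h0.symm h1.symm
  · exact arr_loopGen e

theorem linePath_orient (b : Bool) (t t' s : I) :
    orient b (linePath t t' s) = linePath (orient b t) (orient b t') s := by
  cases b
  · exact linePath_symm t t' s
  · rfl

theorem cellHom_side (c : F) (i : (K.polygon c).Index) (t t' : I) {x y : K.ConeSpace}
    (hx : K.triChar ⟨c, i⟩ (t, 1) = x) (hy : K.triChar ⟨c, i⟩ (t', 1) = y) :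
    cellHom (K.triChar ⟨c, i⟩) (t, 1) (t', 1) hx hy =
      cellHom (K.edgeChar (K.bdry c i).1) (orient (K.bdry c i).2 t) (orient (K.bdry c i).2 t')
        ((triChar_side c i t).symm.trans hx) ((triChar_side c i t').symm.trans hy) := by
  refine cellHom_congr _ _ (linePath₂ (t, 1) (t', 1)) (linePath _ _) _ _ _ _ fun s => ?_
  have h : K.triChar ⟨c, i⟩ (linePath₂ (t, 1) (t', 1) s) =
      Quot.mk _ (K.tri c i (linePath t t' s) 1) := by
    rw [linePath₂_apply, linePath_self]
    rfl
  rw [h, mk_side, linePath_orient]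
  rfl

theorem cellHom_radial (c : F) (i : (K.polygon c).Index) (r r' : I) {x y : K.ConeSpace}
    (hx : K.triChar ⟨c, i⟩ (1, r) = x) (hy : K.triChar ⟨c, i⟩ (1, r') = y)
    (hx' : K.triChar ⟨c, i + 1⟩ (0, r) = x) (hy' : K.triChar ⟨c, i + 1⟩ (0, r') = y) :
    cellHom (K.triChar ⟨c, i⟩) (1, r) (1, r') hx hy =
      cellHom (K.triChar ⟨c, i + 1⟩) (0, r) (0, r') hx' hy' := by
  refine cellHom_congr _ _ (linePath₂ (1, r) (1, r')) (linePath₂ (0, r) (0, r')) _ _ _ _ fun s => ?_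
  rw [linePath₂_apply, linePath₂_apply, linePath_self, linePath_self]
  exact Quot.sound (.radial ..)

theorem cellHom_apex (c : F) (i : (K.polygon c).Index) (t t' : I) {x : K.ConeSpace}
    (hx : K.triChar ⟨c, i⟩ (t, 0) = x) (hy : K.triChar ⟨c, i⟩ (t', 0) = x) :
    cellHom (K.triChar ⟨c, i⟩) (t, 0) (t', 0) hx hy = 𝟙 _ := by
  refine cellHom_const _ (linePath₂ (t, 0) (t', 0)) _ _ fun s => ?_
  rw [linePath₂_apply, linePath_self, ← hx]
  exact K.mk_apex ..

/-- The path from the corner `i` to the centre of a `2`-cell. -/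
noncomputable def cornerToCenter (c : F) (i : (K.polygon c).Index) :
    FundamentalGroupoid.mk K.conePt ⟶
      FundamentalGroupoid.mk (Quot.mk _ (K.tri c 0 0 0) : K.ConeSpace) :=
  cellHom (K.triChar ⟨c, i⟩) (0, 1) (0, 0) (triChar_corner ⟨c, i⟩) (triChar_apex c i _)

theorem arr_letterVal_side (c : F) (i : (K.polygon c).Index) :
    arr (letterVal K.loopGen (K.bdry c i)) =
      cellHom (K.triChar ⟨c, i⟩) (0, 1) (1, 1) (triChar_corner ⟨c, i⟩) (triChar_corner' ⟨c, i⟩) := by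
  rw [arr_letterVal, cellHom_side]

/-- A triangle is simply connected, so going along its side and then radially inwards is the same as
going inwards at once. The radial edge is shared with the next triangle. -/
theorem arr_letterVal_comp_cornerToCenter (c : F) (i : (K.polygon c).Index) :
    arr (letterVal K.loopGen (K.bdry c i)) ≫ cornerToCenter c (i + 1) = cornerToCenter c i := by
  have h : cornerToCenter c (i + 1) = cellHom (K.triChar ⟨c, i⟩) (1, 1) (1, 0) (triChar_corner' ⟨c, i⟩)
      (triChar_apex c i _) :=
    (cellHom_radial ..).symm
  rw [arr_letterVal_side, h, cellHom_trans, cornerToCenter,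
    ← cellHom_trans _ (0, 1) (0, 0) (1, 0) (triChar_corner ⟨c, i⟩) (triChar_apex c i 0),
    cellHom_apex, Category.comp_id]

/-- The difference of the paths from two corners to the centre. -/
noncomputable def cornerLoop (c : F) (i : (K.polygon c).Index) : K.LoopGroup :=
  ofArr (cornerToCenter c i ≫ inv (cornerToCenter c 0))

/-- Each letter is a quotient of consecutive corner loops, so the boundary word telescopes around
the centre. -/
theorem bdryVal_loopGen (c : F) (i : (K.polygon c).Index) :
    K.bdryVal K.loopGen c i = cornerLoop c i * (cornerLoop c (i + 1))⁻¹ := by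
  rw [eq_mul_inv_iff_mul_eq]
  apply arr_injective
  rw [arr_mul, cornerLoop, cornerLoop, arr_ofArr, arr_ofArr, bdryVal, ← Category.assoc,
    arr_letterVal_comp_cornerToCenter]

/-- The boundary words hold in the fundamental group. -/
theorem wordVal_loopGen (c : F) : K.wordVal K.loopGen c = 1 :=
  prod_ofFn_eq_one_of_telescope _ _ (bdryVal_loopGen c)

theorem arr_cornerVal_comp (c : F) (i : (K.polygon c).Index) :
    arr (K.cornerVal K.loopGen c i) ≫ cornerToCenter c i = cornerToCenter c 0 := by
  have h := prefixProd_of_telescope _ _ (bdryVal_loopGen c) i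
  have h0 : cornerLoop c (0 : (K.polygon c).Index) = 1 := by
    apply arr_injective
    rw [cornerLoop, arr_ofArr, IsIso.hom_inv_id, arr_one]
  rw [h0, one_mul] at h
  rw [cornerVal, h, arr_inv, cornerLoop, arr_ofArr]
  simp

theorem arr_cornerVal_succ (c : F) (i : (K.polygon c).Index) :
    arr (K.cornerVal K.loopGen c (i + 1)) = arr (K.cornerVal K.loopGen c i) ≫
      cellHom (K.triChar ⟨c, i⟩) (0, 1) (1, 1) (triChar_corner ⟨c, i⟩) (triChar_corner' ⟨c, i⟩) := by
  rw [cornerVal_succ wordVal_loopGen, arr_mul, arr_letterVal_side]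

variable (K) in
/-- A reference class of paths from the vertex to a point. -/
noncomputable def refHom : ∀ z : K.ConeCells,
    FundamentalGroupoid.mk K.conePt ⟶ FundamentalGroupoid.mk (Quot.mk _ z : K.ConeSpace)
  | Sum.inl _ => 𝟙 _
  | Sum.inr (Sum.inl x) => cellHom (K.edgeChar x.1) 0 x.2 (edgeChar_zero x.1) (edgeChar_apply x.1 x.2)
  | Sum.inr (Sum.inr x) => arr (K.cornerVal K.loopGen x.1.1 x.1.2) ≫
      cellHom (K.triChar x.1) (0, 1) x.2 (triChar_corner x.1) (triChar_apply x.1 x.2)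

/-- The class of the track of a point under the flow of a contraction. -/
def Contraction.trackHom (S : K.Contraction) {a : K.ConeSpace} (ha : S.center = a)
    (z : K.ConeCells) (hz : z ∈ S.carrier) :
    FundamentalGroupoid.mk (Quot.mk _ z : K.ConeSpace) ⟶ FundamentalGroupoid.mk a :=
  Path.Homotopic.Quotient.mk ((S.track z hz).cast rfl ha.symm)

theorem Contraction.trackHom_edg (S : K.Contraction) {a : K.ConeSpace} (ha : S.center = a) (e : E)
    (t : I) (hz : K.edg e t ∈ S.carrier) (h : K.edgeChar e (S.edgeTarget e t) = a) :
    S.trackHom ha (K.edg e t) hz =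
      cellHom (K.edgeChar e) t (S.edgeTarget e t) (edgeChar_apply e t) h :=
  mk_eq_cellHom _ (linePath _ _) _ _ _ fun _ => rfl

theorem Contraction.trackHom_tri (S : K.Contraction) {a : K.ConeSpace} (ha : S.center = a) (c : F)
    (i : (K.polygon c).Index) (t r : I) (hz : K.tri c i t r ∈ S.carrier)
    (h : K.triChar ⟨c, i⟩ (S.triTarget ⟨c, i⟩ (t, r)) = a) :
    S.trackHom ha (K.tri c i t r) hz =
      cellHom (K.triChar ⟨c, i⟩) (t, r) (S.triTarget ⟨c, i⟩ (t, r)) (triChar_apply ..) h :=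
  mk_eq_cellHom _ (linePath₂ _ _) _ _ _ fun _ => rfl

theorem Contraction.edgeChar_target (S : K.Contraction) (e : E) (t : I)
    (hz : K.edg e t ∈ S.carrier) : K.edgeChar e (S.edgeTarget e t) = S.center :=
  (congrArg (fun x => Quot.mk _ (K.edg e x)) (slide_one _ _).symm).trans (S.flow_one _ hz)

theorem Contraction.triChar_target (S : K.Contraction) (x : K.Corner) (p : I × I)
    (hz : Sum.inr (Sum.inr ⟨x, p⟩) ∈ S.carrier) : K.triChar x (S.triTarget x p) = S.center :=
  (congrArg₂ (fun a b => Quot.mk _ (K.tri x.1 x.2 a b)) (slide_one _ _).symm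
    (slide_one _ _).symm).trans (S.flow_one _ hz)

theorem nearEnd_of_lt {t : I} (h : (t : ℝ) < 1 / 2) : nearEnd t = 0 := if_pos h

theorem nearEnd_of_gt {t : I} (h : 1 / 2 < (t : ℝ)) : nearEnd t = 1 := if_neg h.not_gt

variable (K) in
theorem vertexContraction_center : K.vertexContraction.center = K.conePt := rfl

variable (K) in
theorem edgeContraction_center (e : E) :
    (K.edgeContraction e).center = Quot.mk _ (K.edg e midpt) := rfl

variable (K) in
theorem faceContraction_center (c : F) :
    (K.faceContraction c).center = Quot.mk _ (K.tri c 0 0 0) := rfl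

theorem Contraction.inv_trackHom_edg (S : K.Contraction) {a : K.ConeSpace} (ha : S.center = a)
    (e : E) (t : I) (hz : K.edg e t ∈ S.carrier) (h : K.edgeChar e (S.edgeTarget e t) = a) :
    inv (S.trackHom ha (K.edg e t) hz) =
      cellHom (K.edgeChar e) (S.edgeTarget e t) t h (edgeChar_apply e t) := by
  rw [S.trackHom_edg ha e t hz h, inv_cellHom]

theorem Contraction.inv_trackHom_tri (S : K.Contraction) {a : K.ConeSpace} (ha : S.center = a)
    (c : F) (i : (K.polygon c).Index) (t r : I) (hz : K.tri c i t r ∈ S.carrier)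
    (h : K.triChar ⟨c, i⟩ (S.triTarget ⟨c, i⟩ (t, r)) = a) :
    inv (S.trackHom ha (K.tri c i t r) hz) =
      cellHom (K.triChar ⟨c, i⟩) (S.triTarget ⟨c, i⟩ (t, r)) (t, r) h (triChar_apply ..) := by
  rw [S.trackHom_tri ha c i t r hz h, inv_cellHom]

theorem refHom_edg (e : E) (t : I) : K.refHom (K.edg e t) =
    cellHom (K.edgeChar e) 0 t (edgeChar_zero e) (edgeChar_apply e t) := rfl

theorem refHom_tri (c : F) (i : (K.polygon c).Index) (t r : I) : K.refHom (K.tri c i t r) =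
    arr (K.cornerVal K.loopGen c i) ≫
      cellHom (K.triChar ⟨c, i⟩) (0, 1) (t, r) (triChar_corner ⟨c, i⟩)
        (triChar_apply ⟨c, i⟩ (t, r)) := rfl

/-- `vertexVal` measures the discrepancy between the reference class of a point and its reversed
track in the star. The discrepancy is a product of 1-cells, which is what controls short paths. The
other two kinds of stars are treated in the same way. -/
theorem refHom_vertexStar (z : K.ConeCells) (hz : z ∈ K.vertexContraction.carrier) :
    arr (K.vertexVal K.loopGen z) ≫
      inv (K.vertexContraction.trackHom K.vertexContraction_center z hz) = K.refHom z := by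
  rcases z with x | ⟨e, t⟩ | ⟨⟨c, i⟩, t, r⟩
  · have h : K.vertexContraction.trackHom K.vertexContraction_center (Sum.inl x) hz = 𝟙 _ := rfl
    refine (congrArg (fun m => _ ≫ inv m) h).trans ?_
    have h' : arr (K.vertexVal K.loopGen (Sum.inl x)) = 𝟙 _ := rfl
    refine (congrArg (fun m => m ≫ _) h').trans ?_
    have h'' : K.refHom (Sum.inl x) = 𝟙 _ := rfl
    refine Eq.trans ?_ h''.symm
    refine (Category.id_comp _).trans ?_
    exact IsIso.inv_id
  · refine Eq.trans ?_ (refHom_edg e t).symm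
    refine (congrArg (fun m => _ ≫ m) (K.vertexContraction.inv_trackHom_edg
      K.vertexContraction_center e t hz (K.vertexContraction.edgeChar_target e t hz))).trans ?_
    have ht : (t : ℝ) ≠ 1 / 2 := hz
    rcases lt_or_gt_of_ne ht with h | h
    · have hv : arr (K.vertexVal K.loopGen (K.edg e t)) = 𝟙 _ :=
        congrArg arr (if_pos h : K.vertexVal K.loopGen (K.edg e t) = 1)
      refine (congrArg (fun m => m ≫ _) hv).trans ((Category.id_comp _).trans ?_)
      exact cellHom_eq_of_eq (K.edgeChar e) _ _ (nearEnd_of_lt h) rfl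
    · have hv : K.vertexVal K.loopGen (K.edg e t) = K.loopGen e := if_neg h.not_gt
      refine (congrArg (fun m => m ≫ _) ((congrArg arr hv).trans (arr_loopGen e))).trans ?_
      refine (congrArg (fun m => _ ≫ m) (cellHom_eq_of_eq (K.edgeChar e) _ _
        (nearEnd_of_gt h) rfl)).trans ?_
      exact cellHom_trans ..
  · refine Eq.trans ?_ (refHom_tri c i t r).symm
    refine (congrArg (fun m => _ ≫ m) (K.vertexContraction.inv_trackHom_tri
      K.vertexContraction_center c i t r hz
      (K.vertexContraction.triChar_target ⟨c, i⟩ (t, r) hz))).trans ?_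
    have ht : (t : ℝ) ≠ 1 / 2 := hz.1
    rcases lt_or_gt_of_ne ht with h | h
    · have hv : K.vertexVal K.loopGen (K.tri c i t r) = K.cornerVal K.loopGen c i := if_pos h
      have hp : K.vertexContraction.triTarget ⟨c, i⟩ (t, r) = (0, 1) :=
        Prod.ext (nearEnd_of_lt h) rfl
      refine (congrArg (fun m => m ≫ _) (congrArg arr hv)).trans ?_
      exact congrArg (fun m => _ ≫ m) (cellHom_eq_of_eq (K.triChar ⟨c, i⟩) _ _ hp rfl)
    · have hv : K.vertexVal K.loopGen (K.tri c i t r) = K.cornerVal K.loopGen c (i + 1) :=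
        if_neg h.not_gt
      have hp : K.vertexContraction.triTarget ⟨c, i⟩ (t, r) = (1, 1) :=
        Prod.ext (nearEnd_of_gt h) rfl
      refine (congrArg (fun m => m ≫ _) ((congrArg arr hv).trans (arr_cornerVal_succ c i))).trans ?_
      refine (congrArg (fun m => _ ≫ m) (cellHom_eq_of_eq (K.triChar ⟨c, i⟩) _ _ hp rfl)).trans ?_
      exact (Category.assoc ..).trans (congrArg (fun m => _ ≫ m) (cellHom_trans ..))

variable (K) in
/-- The path from the vertex to the midpoint of a `1`-cell. -/
noncomputable def toMidpt (e : E) : FundamentalGroupoid.mk K.conePt ⟶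
    FundamentalGroupoid.mk (Quot.mk _ (K.edg e midpt) : K.ConeSpace) :=
  cellHom (K.edgeChar e) 0 midpt (edgeChar_zero e) (edgeChar_apply e midpt)

/-- `sideVal` refers to the initial point of the 1-cell, which is corner `i + 1` if the side runs
against its orientation. The way from there to the midpoint is half of the side in either case. -/
theorem arr_sideVal_comp (c : F) (i : (K.polygon c).Index) :
    arr (K.sideVal K.loopGen c i) ≫ toMidpt K (K.bdry c i).1 =
      arr (K.cornerVal K.loopGen c i) ≫ cellHom (K.triChar ⟨c, i⟩) (0, 1) (midpt, 1)
        (triChar_corner ⟨c, i⟩) ((triChar_side c i midpt).trans (by rw [orient_midpt]; rfl)) := by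
  rcases Bool.eq_false_or_eq_true (K.bdry c i).2 with hb | hb
  swap
  · have hv : K.sideVal K.loopGen c i = K.cornerVal K.loopGen c (i + 1) := by
      rw [sideVal, hb]; rfl
    rw [hv, arr_cornerVal_succ, Category.assoc,
      ← cellHom_trans (K.triChar ⟨c, i⟩) (0, 1) (1, 1) (midpt, 1) (triChar_corner ⟨c, i⟩)
        (triChar_corner' ⟨c, i⟩), cellHom_side c i 1 midpt]
    refine congrArg _ (congrArg _ ?_)
    exact (cellHom_eq_of_eq _ _ _ (by rw [hb]; exact symm_one) (orient_midpt _)).symm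
  · have hv : K.sideVal K.loopGen c i = K.cornerVal K.loopGen c i := by
      rw [sideVal, hb]; rfl
    rw [hv, cellHom_side c i 0 midpt]
    refine congrArg _ ?_
    exact (cellHom_eq_of_eq _ _ _ (by rw [hb]; rfl) (orient_midpt _)).symm

theorem refHom_edgeStar (e : E) (z : K.ConeCells) (hz : z ∈ (K.edgeContraction e).carrier) :
    arr (K.edgeVal K.loopGen z) ≫ toMidpt K e ≫
      inv ((K.edgeContraction e).trackHom (K.edgeContraction_center e) z hz) = K.refHom z := by
  rcases z with x | ⟨e', t⟩ | ⟨⟨c, i⟩, t, r⟩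
  · exact hz.elim
  · have he : e' = e := hz.1
    subst he
    refine (congrArg (fun m => _ ≫ _ ≫ m) ((K.edgeContraction e').inv_trackHom_edg
      (K.edgeContraction_center e') e' t hz ((K.edgeContraction e').edgeChar_target e' t hz))).trans ?_
    refine (congrArg _ (cellHom_trans ..)).trans ?_
    exact Category.id_comp _
  · have he : (K.bdry c i).1 = e := hz.1
    subst he
    refine (congrArg (fun m => _ ≫ _ ≫ m) ((K.edgeContraction _).inv_trackHom_tri
      (K.edgeContraction_center _) c i t r hz
      ((K.edgeContraction _).triChar_target ⟨c, i⟩ (t, r) hz))).trans ?_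
    refine (Category.assoc ..).symm.trans ?_
    refine (congrArg (fun x => x ≫ _) (arr_sideVal_comp c i)).trans ?_
    exact (Category.assoc ..).trans (congrArg _ (cellHom_trans ..))

theorem refHom_faceStar (c : F) (z : K.ConeCells) (hz : z ∈ (K.faceContraction c).carrier) :
    cornerToCenter c 0 ≫
      inv ((K.faceContraction c).trackHom (K.faceContraction_center c) z hz) = K.refHom z := by
  rcases z with x | ⟨e, t⟩ | ⟨⟨c', i⟩, t, r⟩
  · exact hz.elim
  · exact hz.elim
  · have hc : c' = c := hz.1
    subst hc
    refine Eq.trans ?_ (refHom_tri c' i t r).symm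
    refine (congrArg (fun m => _ ≫ m) ((K.faceContraction c').inv_trackHom_tri
      (K.faceContraction_center c') c' i t r hz
      ((K.faceContraction c').triChar_target ⟨c', i⟩ (t, r) hz))).trans ?_
    refine (congrArg (fun x => x ≫ _) (arr_cornerVal_comp c' i).symm).trans ?_
    refine (Category.assoc ..).trans (congrArg _ ?_)
    have h : cornerToCenter c' i = cellHom (K.triChar ⟨c', i⟩) (0, 1) (t, 0)
        (triChar_corner ⟨c', i⟩) (triChar_apex c' i t) := by
      rw [cornerToCenter, ← cellHom_trans _ (0, 1) (0, 0) (t, 0) (triChar_corner ⟨c', i⟩)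
        (triChar_apex c' i 0) (triChar_apex c' i t), cellHom_apex, Category.comp_id]
    refine (congrArg (fun x => x ≫ _) h).trans ?_
    exact cellHom_trans ..

end OneVertexComplex

/-! ### Generation by the 1-cells and the cellular presentation -/

namespace OneVertexComplex

universe u v w

variable {E : Type u} {F : Type v} {K : OneVertexComplex E F}

theorem map_letterVal {G H : Type*} [Group G] [Group H] (f : G →* H) (gen : E → G) (x : E × Bool) :
    f (letterVal gen x) = letterVal (fun e => f (gen e)) x := by
  rw [letterVal, letterVal]
  split_ifs
  · rfl
  · rw [map_inv]

theorem map_wordVal {G H : Type*} [Group G] [Group H] (f : G →* H) (gen : E → G) (c : F) :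
    f (K.wordVal gen c) = K.wordVal (fun e => f (gen e)) c := by
  rw [wordVal, map_list_prod, List.map_ofFn, wordVal]
  congr 2
  funext i
  exact map_letterVal f gen _

theorem letterVal_mem {G : Type*} [Group G] (H : Subgroup G) {gen : E → G} (h : ∀ e, gen e ∈ H)
    (x : E × Bool) : letterVal gen x ∈ H := by
  rw [letterVal]
  split_ifs
  · exact h _
  · exact H.inv_mem (h _)

theorem cornerVal_mem {G : Type*} [Group G] (H : Subgroup G) {gen : E → G} (h : ∀ e, gen e ∈ H)
    (c : F) (i : (K.polygon c).Index) : K.cornerVal gen c i ∈ H := by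
  refine H.list_prod_mem fun x hx => ?_
  obtain ⟨j, rfl⟩ := (List.mem_ofFn' _ _).1 (List.mem_of_mem_take hx)
  exact letterVal_mem H h _

theorem sideVal_mem {G : Type*} [Group G] (H : Subgroup G) {gen : E → G} (h : ∀ e, gen e ∈ H)
    (c : F) (i : (K.polygon c).Index) : K.sideVal gen c i ∈ H := by
  rw [sideVal]
  split_ifs <;> exact cornerVal_mem H h _ _

theorem vertexVal_mem {G : Type*} [Group G] (H : Subgroup G) {gen : E → G} (h : ∀ e, gen e ∈ H)
    (z : K.ConeCells) : K.vertexVal gen z ∈ H := by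
  rcases z with _ | ⟨e, t⟩ | ⟨⟨c, i⟩, t, r⟩
  · exact H.one_mem
  · simp only [vertexVal]
    split_ifs
    exacts [H.one_mem, h e]
  · simp only [vertexVal]
    split_ifs <;> exact cornerVal_mem H h _ _

theorem edgeVal_mem {G : Type*} [Group G] (H : Subgroup G) {gen : E → G} (h : ∀ e, gen e ∈ H)
    (z : K.ConeCells) : K.edgeVal gen z ∈ H := by
  rcases z with _ | ⟨e, t⟩ | ⟨⟨c, i⟩, t, r⟩
  · exact H.one_mem
  · exact H.one_mem
  · exact sideVal_mem H h _ _

/-- The morphism is the reference class of a point before gluing. -/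
inductive IsRef : ∀ {x : K.ConeSpace}, (FundamentalGroupoid.mk K.conePt ⟶ FundamentalGroupoid.mk x) →
    Prop
  | intro (z : K.ConeCells) : IsRef (K.refHom z)

/-- A path in the star followed by the track of its end is homotopic to the track of its start. The
common part `κ` cancels, leaving only the values of `V` at the two ends. -/
theorem Contraction.refHom_comp (S : K.Contraction) {a : K.ConeSpace} (ha : S.center = a)
    (κ : FundamentalGroupoid.mk K.conePt ⟶ FundamentalGroupoid.mk a) (V : K.ConeCells → K.LoopGroup)
    (hV : ∀ z (hz : z ∈ S.carrier), arr (V z) ≫ κ ≫ inv (S.trackHom ha z hz) = K.refHom z)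
    {z z' : K.ConeCells} (p : Path (Quot.mk _ z : K.ConeSpace) (Quot.mk _ z'))
    (hp : ∀ s, p s ∈ S.image) :
    K.refHom z ≫ (Path.Homotopic.Quotient.mk p :
      FundamentalGroupoid.mk (Quot.mk _ z : K.ConeSpace) ⟶ FundamentalGroupoid.mk (Quot.mk _ z')) =
      arr (V z * (V z')⁻¹) ≫ K.refHom z' := by
  subst ha
  have hz : z ∈ S.carrier := S.mk_mem_image.1 (by simpa using hp 0)
  have hz' : z' ∈ S.carrier := S.mk_mem_image.1 (by simpa using hp 1)
  have h : (Path.Homotopic.Quotient.mk p : FundamentalGroupoid.mk (Quot.mk _ z : K.ConeSpace) ⟶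
      FundamentalGroupoid.mk (Quot.mk _ z')) ≫ S.trackHom rfl z' hz' = S.trackHom rfl z hz :=
    Path.Homotopic.Quotient.eq.2 (S.trans_track hz hz' p hp)
  rw [← hV z hz, ← hV z' hz', arr_mul, arr_inv, ← h]
  simp

variable (K) in
/-- The subgroup generated by the `1`-cells. -/
noncomputable abbrev edgeSubgroup : Subgroup K.LoopGroup := Subgroup.closure (Set.range K.loopGen)

/-- The property holds for paths in a star and survives concatenation, so subdivision gives it for
all paths. It quantifies over all reference classes of the ends because a point has several
preimages before gluing; at a junction any one of them can then be used. -/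
theorem exists_refHom_comp {x y : K.ConeSpace} (p : Path x y) :
    ∀ (r : FundamentalGroupoid.mk K.conePt ⟶ FundamentalGroupoid.mk x), IsRef r →
    ∀ (r' : FundamentalGroupoid.mk K.conePt ⟶ FundamentalGroupoid.mk y), IsRef r' →
    ∃ h ∈ K.edgeSubgroup, r ≫ (Path.Homotopic.Quotient.mk p :
      FundamentalGroupoid.mk x ⟶ FundamentalGroupoid.mk y) = arr h ≫ r' := by
  have hgen : ∀ e, K.loopGen e ∈ K.edgeSubgroup := fun e => Subgroup.subset_closure ⟨e, rfl⟩
  refine Path.Homotopic.Quotient.induction_openCover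
    (U := fun S : {S : K.Contraction // ∃ (a : K.ConeSpace) (ha : S.center = a)
      (κ : FundamentalGroupoid.mk K.conePt ⟶ FundamentalGroupoid.mk a)
      (V : K.ConeCells → K.LoopGroup), (∀ z, V z ∈ K.edgeSubgroup) ∧
        ∀ z (hz : z ∈ S.carrier), arr (V z) ≫ κ ≫ inv (S.trackHom ha z hz) = K.refHom z} =>
      S.1.image) (fun S => S.1.isOpen_image) ?_
    (fun {x y} m => ∀ (r : FundamentalGroupoid.mk K.conePt ⟶ FundamentalGroupoid.mk x), IsRef r →
      ∀ (r' : FundamentalGroupoid.mk K.conePt ⟶ FundamentalGroupoid.mk y), IsRef r' →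
      ∃ h ∈ K.edgeSubgroup, r ≫ (m : FundamentalGroupoid.mk x ⟶ FundamentalGroupoid.mk y) =
        arr h ≫ r') ?_ ?_ p
  · rintro ⟨z⟩
    rcases K.mem_star z with hz | ⟨e, hz⟩ | ⟨c, hz⟩
    · refine ⟨⟨K.vertexContraction, _, K.vertexContraction_center, 𝟙 _, K.vertexVal K.loopGen,
        vertexVal_mem _ hgen, fun z hz => ?_⟩, ⟨z, hz, rfl⟩⟩
      exact (congrArg _ (Category.id_comp _)).trans (refHom_vertexStar z hz)
    · exact ⟨⟨K.edgeContraction e, _, K.edgeContraction_center e, toMidpt K e, K.edgeVal K.loopGen,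
        edgeVal_mem _ hgen, refHom_edgeStar e⟩, ⟨z, hz, rfl⟩⟩
    · refine ⟨⟨K.faceContraction c, _, K.faceContraction_center c, cornerToCenter c 0, fun _ => 1,
        fun _ => one_mem _, fun z hz => ?_⟩, ⟨z, hz, rfl⟩⟩
      exact (Category.id_comp _).trans (refHom_faceStar c z hz)
  · intro x y z p q hp hq r hr r' hr'
    obtain ⟨y, rfl⟩ := Quot.exists_rep y
    obtain ⟨h, hh, e⟩ := hp r hr _ (IsRef.intro y)
    obtain ⟨h', hh', e'⟩ := hq _ (IsRef.intro y) r' hr'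
    refine ⟨h * h', mul_mem hh hh', ?_⟩
    change r ≫ ((p : FundamentalGroupoid.mk x ⟶ FundamentalGroupoid.mk (Quot.mk _ y)) ≫
      (q : FundamentalGroupoid.mk (Quot.mk _ y) ⟶ FundamentalGroupoid.mk z)) = _
    rw [← Category.assoc, e, Category.assoc, e', arr_mul, Category.assoc]
  · rintro ⟨S, a, ha, κ, V, hV, hS⟩ x y p hp r ⟨z⟩ r' ⟨z'⟩
    exact ⟨_, mul_mem (hV z) (inv_mem (hV z')), S.refHom_comp ha κ V hS p hp⟩

/-- The fundamental group is generated by the `1`-cells. -/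
theorem edgeSubgroup_eq_top : K.edgeSubgroup = ⊤ := by
  rw [eq_top_iff]
  rintro g -
  obtain ⟨p, hp⟩ := Path.Homotopic.Quotient.mk_surjective (arr g)
  obtain ⟨h, hh, e⟩ := exists_refHom_comp p (𝟙 _) (IsRef.intro K.vtx) (𝟙 _) (IsRef.intro K.vtx)
  have e' : arr g = arr h := by
    rw [← hp]
    exact (Category.id_comp _).symm.trans (e.trans (Category.comp_id _))
  rwa [arr_injective e']

variable (K) in
/-- The boundary words of the `2`-cells. -/
def relators : Set (FreeGroup E) := Set.range (K.wordVal FreeGroup.of)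

variable (K) in
/-- The group presented by the `1`-cells and the boundary words of the `2`-cells. -/
abbrev CellGroup : Type u := PresentedGroup K.relators

variable (K) in
/-- The generator given by a `1`-cell. -/
def cellGen (e : E) : K.CellGroup := PresentedGroup.of e

theorem wordVal_cellGen (c : F) : K.wordVal K.cellGen c = 1 := by
  have h : PresentedGroup.mk K.relators (K.wordVal FreeGroup.of c) = 1 :=
    PresentedGroup.one_of_mem ⟨c, rfl⟩
  rwa [map_wordVal] at h

theorem lift_relators {G : Type*} [Group G] {gen : E → G} (h : ∀ c, K.wordVal gen c = 1) :
    ∀ r ∈ K.relators, FreeGroup.lift gen r = 1 := by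
  rintro _ ⟨c, rfl⟩
  rw [map_wordVal]
  simpa using h c

/-- The homomorphism given by the images of the `1`-cells. -/
def cellHomOf {G : Type*} [Group G] (gen : E → G) (h : ∀ c, K.wordVal gen c = 1) : K.CellGroup →* G :=
  PresentedGroup.toGroup (lift_relators h)

theorem cellHomOf_cellGen {G : Type*} [Group G] {gen : E → G} (h : ∀ c, K.wordVal gen c = 1) (e : E) :
    cellHomOf gen h (K.cellGen e) = gen e := PresentedGroup.toGroup.of _

theorem cellGroup_hom_ext {G : Type*} [Group G] {φ ψ : K.CellGroup →* G}
    (h : ∀ e, φ (K.cellGen e) = ψ (K.cellGen e)) : φ = ψ := PresentedGroup.ext h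

/-- For injectivity, the covering whose group is `CellGroup` itself provides a homomorphism back
that fixes every generator. Surjectivity is generation by the 1-cells. -/
theorem bijective_cellHomOf_loopGen :
    Function.Bijective (cellHomOf K.loopGen wordVal_loopGen) := by
  constructor
  · obtain ⟨μ, hμ⟩ := exists_hom_of_wordVal (K := K) wordVal_cellGen
    have h : (MulEquiv.opOp K.CellGroup).symm.toMonoidHom.comp
        ((MonoidHom.op μ).comp (cellHomOf K.loopGen wordVal_loopGen)) = MonoidHom.id _ := by
      refine cellGroup_hom_ext fun e => ?_
      rw [MonoidHom.comp_apply, MonoidHom.comp_apply, cellHomOf_cellGen]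
      change (μ (K.edgeClass e)).unop = _
      rw [hμ]
      rfl
    intro x y hxy
    have hx := DFunLike.congr_fun h x
    have hy := DFunLike.congr_fun h y
    rw [MonoidHom.comp_apply, MonoidHom.comp_apply] at hx hy
    rw [hxy] at hx
    exact hx.symm.trans hy
  · rw [← MonoidHom.range_eq_top, eq_top_iff, ← edgeSubgroup_eq_top, Subgroup.closure_le]
    rintro _ ⟨e, rfl⟩
    exact ⟨K.cellGen e, cellHomOf_cellGen _ e⟩

variable (K) in
/-- The fundamental group of the complex is presented by its `1`-cells and `2`-cells. -/
noncomputable def pi1Equiv : K.Pi1 ≃* K.CellGroup :=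
  -- Inversion passes to the opposite group, in which the product of loops is concatenation.
  K.conePi1Equiv.symm.trans ((MulEquiv.inv' _).trans
    (MulEquiv.ofBijective _ bijective_cellHomOf_loopGen).symm)

end OneVertexComplex

end ConeComplex

/-! ### Triangular systems of equations over a group -/

section Triangular

variable {X : Type*} [Group X] {m : ℕ}

/-- The product of the entries of a word after position `i`. -/
def suffixProd (f : Fin (m + 1) → X) (i : Fin (m + 1)) : X := ((List.ofFn f).drop (i + 1)).prod

theorem prefixProd_mul_suffixProd (f : Fin (m + 1) → X) (p : Fin (m + 1)) :
    prefixProd f p * f p * suffixProd f p = (List.ofFn f).prod := by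
  have h := List.prod_take_mul_prod_drop (List.ofFn f) (p + 1)
  rw [List.prod_take_succ _ _ (by rw [List.length_ofFn]; omega), List.getElem_ofFn] at h
  exact h

theorem prefixProd_congr {f g : Fin (m + 1) → X} {p : Fin (m + 1)} (h : ∀ i, i ≠ p → f i = g i) :
    prefixProd f p = prefixProd g p := by
  unfold prefixProd
  congr 1
  refine List.ext_getElem (by simp) fun i hi _ => ?_
  simp only [List.getElem_take, List.getElem_ofFn]
  refine h _ fun e => ?_
  have := congrArg Fin.val e
  simp at hi this
  omega

theorem suffixProd_congr {f g : Fin (m + 1) → X} {p : Fin (m + 1)} (h : ∀ i, i ≠ p → f i = g i) :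
    suffixProd f p = suffixProd g p := by
  unfold suffixProd
  congr 1
  refine List.ext_getElem (by simp) fun i hi _ => ?_
  simp only [List.getElem_drop, List.getElem_ofFn]
  refine h _ fun e => ?_
  have := congrArg Fin.val e
  simp at this
  omega

/-- The value at position `p` for which a word has product `1`. -/
def solveAt (f : Fin (m + 1) → X) (p : Fin (m + 1)) : X :=
  (prefixProd f p)⁻¹ * (suffixProd f p)⁻¹

/-- Neither the part of the word before `p` nor the part after it involves position `p`. This is
what allows the recursive solution. -/
theorem solveAt_congr {f g : Fin (m + 1) → X} {p : Fin (m + 1)} (h : ∀ i, i ≠ p → f i = g i) :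
    solveAt f p = solveAt g p := by
  rw [solveAt, solveAt, prefixProd_congr h, suffixProd_congr h]

theorem prod_ofFn_eq_one_iff (f : Fin (m + 1) → X) (p : Fin (m + 1)) :
    (List.ofFn f).prod = 1 ↔ f p = solveAt f p := by
  rw [← prefixProd_mul_suffixProd f p, solveAt, mul_eq_one_iff_eq_inv, eq_inv_mul_iff_mul_eq]

/-- The inverse if the orientation is reversed. -/
def orientVal (b : Bool) (x : X) : X := if b then x else x⁻¹

theorem orientVal_orientVal (b : Bool) (x : X) : orientVal b (orientVal b x) = x := by
  cases b <;> simp [orientVal]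

theorem eq_orientVal_iff {b : Bool} {x y : X} : orientVal b x = y ↔ x = orientVal b y := by
  constructor
  · rintro rfl; exact (orientVal_orientVal b x).symm
  · rintro rfl; exact orientVal_orientVal b y

/-- A family of words in variables `Y` such that each word has a letter `sel r`, occurring once and
in no other word as the selected letter, which is larger than the other letters of the word. -/
structure TriangularSystem (Y : Type*) (R : Type*) where
  len : R → ℕ
  var : ∀ r, Fin (len r + 1) → Y
  sign : ∀ r, Fin (len r + 1) → Bool
  sel : ∀ r, Fin (len r + 1)
  sel_injective : Function.Injective fun r => var r (sel r)
  lt : Y → Y → Prop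
  wf : WellFounded lt
  var_lt : ∀ r i, i ≠ sel r → lt (var r i) (var r (sel r))

namespace TriangularSystem

variable {Y R : Type*} (T : TriangularSystem Y R)

/-- The selected variables. -/
def dependent : Set Y := Set.range fun r => T.var r (T.sel r)

/-- The value of the word `r`. -/
def value (x : Y → X) (r : R) : X :=
  (List.ofFn fun i => orientVal (T.sign r i) (x (T.var r i))).prod

theorem value_eq_one_iff (x : Y → X) (r : R) : T.value x r = 1 ↔ x (T.var r (T.sel r)) =
    orientVal (T.sign r (T.sel r))
      (solveAt (fun i => orientVal (T.sign r i) (x (T.var r i))) (T.sel r)) := by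
  rw [value, prod_ofFn_eq_one_iff _ (T.sel r), eq_orientVal_iff]

open Classical in
/-- The solution of a triangular system with given values of the free variables. -/
noncomputable def solution (a : Y → X) : Y → X :=
  T.wf.fix fun y x => if h : ∃ r, T.var r (T.sel r) = y then
    orientVal (T.sign h.choose (T.sel h.choose))
      (solveAt (fun i => orientVal (T.sign h.choose i)
        -- The default `1` can be reached only at the selected position, which `solveAt` ignores; at
        -- all others `var_lt` supplies `h'`.
        (if h' : T.lt (T.var h.choose i) y then x _ h' else 1)) (T.sel h.choose))
    else a y

theorem solution_of_notMem (a : Y → X) {y : Y} (hy : y ∉ T.dependent) :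
    T.solution a y = a y := by
  rw [solution, WellFounded.fix_eq]
  exact dif_neg hy

theorem value_solution (a : Y → X) (r : R) : T.value (T.solution a) r = 1 := by
  rw [value_eq_one_iff]
  conv_lhs => rw [solution, WellFounded.fix_eq]
  have h : ∃ r', T.var r' (T.sel r') = T.var r (T.sel r) := ⟨r, rfl⟩
  have aux : ∀ r', T.var r' (T.sel r') = T.var r (T.sel r) → r' = r := fun r' e =>
    T.sel_injective e
  rw [dif_pos h]
  have hr : h.choose = r := aux _ h.choose_spec
  generalize h.choose = r' at hr
  subst hr
  refine congrArg _ (solveAt_congr fun i hi => ?_)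
  rw [dif_pos (T.var_lt _ i hi)]
  rfl

theorem eq_of_value_eq_one {x x' : Y → X} (hx : ∀ r, T.value x r = 1) (hx' : ∀ r, T.value x' r = 1)
    (h : ∀ y, y ∉ T.dependent → x y = x' y) : x = x' := by
  funext y
  induction y using T.wf.induction with
  | _ y ih =>
    by_cases hy : y ∈ T.dependent
    · obtain ⟨r, rfl⟩ := hy
      rw [(T.value_eq_one_iff x r).1 (hx r), (T.value_eq_one_iff x' r).1 (hx' r)]
      refine congrArg _ (solveAt_congr fun i hi => ?_)
      rw [ih _ (T.var_lt r i hi)]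
    · exact h y hy

/-- A subgroup which contains the values of the free variables contains all values. -/
theorem mem_of_value_eq_one {x : Y → X} (hx : ∀ r, T.value x r = 1) (H : Subgroup X)
    (h : ∀ y, y ∉ T.dependent → x y ∈ H) (y : Y) : x y ∈ H := by
  have ho : ∀ (b : Bool) (z : X), z ∈ H → orientVal b z ∈ H := by
    intro b z hz
    cases b
    exacts [H.inv_mem hz, hz]
  induction y using T.wf.induction with
  | _ y ih =>
    by_cases hy : y ∈ T.dependent
    · obtain ⟨r, rfl⟩ := hy
      rw [(T.value_eq_one_iff x r).1 (hx r)]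
      -- Membership of the selected letter is the goal, so it is overwritten by `1`; the solved
      -- value does not see the change.
      have e : ∀ i, i ≠ T.sel r → orientVal (T.sign r i) (x (T.var r i)) =
          if i = T.sel r then 1 else orientVal (T.sign r i) (x (T.var r i)) := by
        intro i hi
        rw [if_neg hi]
      rw [solveAt_congr e]
      have hm : ∀ i, (if i = T.sel r then 1 else orientVal (T.sign r i) (x (T.var r i))) ∈ H := by
        intro i
        split_ifs with hi
        · exact H.one_mem
        · exact ho _ _ (ih _ (T.var_lt r i hi))
      refine ho _ _ (H.mul_mem (H.inv_mem ?_) (H.inv_mem ?_))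
      · refine H.list_prod_mem fun z hz => ?_
        obtain ⟨j, rfl⟩ := (List.mem_ofFn' _ _).1 (List.mem_of_mem_take hz)
        exact hm j
      · refine H.list_prod_mem fun z hz => ?_
        obtain ⟨j, rfl⟩ := (List.mem_ofFn' _ _).1 (List.mem_of_mem_drop hz)
        exact hm j
    · exact h y hy

end TriangularSystem

end Triangular

/-! ### Morse data and the triangular system of lifted relators -/

namespace OneVertexComplex

universe u v w

variable {E : Type u} {F : Type v}

/-- Rooted tree structure on the subgraph of the link with one vertex for every `1`-cell and one edge
for each `2`-cell `c`, given by the corner `k c`. -/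
structure CornerTree (K : OneVertexComplex E F) (k : ∀ c, (K.polygon c).Index) where
  root : E
  child : ∀ c, (K.polygon c).Index
  parent : ∀ c, (K.polygon c).Index
  rank : E → ℕ
  child_parent : ∀ c, child c = k c ∧ parent c = k c - 1 ∨ child c = k c - 1 ∧ parent c = k c
  rank_lt : ∀ c, rank (K.bdry c (parent c)).1 < rank (K.bdry c (child c)).1
  child_injective : Function.Injective fun c => (K.bdry c (child c)).1
  child_ne : ∀ c, (K.bdry c (child c)).1 ≠ root
  exists_child : ∀ e, e ≠ root → ∃ c, (K.bdry c (child c)).1 = e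

/-- The change of height along an oriented `1`-cell. -/
def signed (d : E → ℤ) (x : E × Bool) : ℤ := if x.2 then d x.1 else -d x.1

/-- Integral heights on the vertices of the `2`-cells, as given by a Morse function, with rooted tree
structures on the ascending and the descending link. -/
structure MorseData (K : OneVertexComplex E F) where
  d : E → ℤ
  d_ne : ∀ e, d e ≠ 0
  h : ∀ c, (K.polygon c).Index → ℤ
  h_succ : ∀ c i, h c (i + 1) = h c i + signed d (K.bdry c i)
  bot : ∀ c, (K.polygon c).Index
  top : ∀ c, (K.polygon c).Index
  bot_lt : ∀ c i, i ≠ bot c → h c (bot c) < h c i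
  lt_top : ∀ c i, i ≠ top c → h c i < h c (top c)
  up : CornerTree K bot
  down : CornerTree K top

namespace MorseData

variable {K : OneVertexComplex E F} (D : MorseData K)

/-- The lower end of a lift of a `1`-cell. -/
def low (y : E × ℤ) : ℤ := min y.2 (y.2 + D.d y.1)

/-- The upper end of a lift of a `1`-cell. -/
def high (y : E × ℤ) : ℤ := max y.2 (y.2 + D.d y.1)

/-- The lift of the `1`-cell along a side of the lift of a `2`-cell. -/
def var (c : F) (b : ℤ) (i : (K.polygon c).Index) : E × ℤ :=
  ((K.bdry c i).1, if (K.bdry c i).2 then b + D.h c i else b + D.h c (i + 1))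

theorem low_var (c : F) (b : ℤ) (i : (K.polygon c).Index) :
    D.low (D.var c b i) = b + min (D.h c i) (D.h c (i + 1)) := by
  have := D.h_succ c i
  rw [signed] at this
  rw [low, var]
  dsimp only
  split_ifs at this ⊢ <;> omega

theorem high_var (c : F) (b : ℤ) (i : (K.polygon c).Index) :
    D.high (D.var c b i) = b + max (D.h c i) (D.h c (i + 1)) := by
  have := D.h_succ c i
  rw [signed] at this
  rw [high, var]
  dsimp only
  split_ifs at this ⊢ <;> omega

theorem bot_le (c : F) (i : (K.polygon c).Index) : D.h c (D.bot c) ≤ D.h c i := by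
  by_cases h : i = D.bot c
  · rw [h]
  · exact (D.bot_lt c i h).le

theorem le_top (c : F) (i : (K.polygon c).Index) : D.h c i ≤ D.h c (D.top c) := by
  by_cases h : i = D.top c
  · rw [h]
  · exact (D.lt_top c i h).le

theorem low_var_of_bot {c : F} {i : (K.polygon c).Index} (b : ℤ) (h : i = D.bot c ∨ i = D.bot c - 1) :
    D.low (D.var c b i) = b + D.h c (D.bot c) := by
  rw [low_var]
  rcases h with rfl | rfl
  · have := D.bot_le c (D.bot c + 1)
    omega
  · rw [sub_add_cancel]
    have := D.bot_le c (D.bot c - 1)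
    omega

theorem lt_low_var {c : F} {i : (K.polygon c).Index} (b : ℤ) (h : i ≠ D.bot c)
    (h' : i ≠ D.bot c - 1) : b + D.h c (D.bot c) < D.low (D.var c b i) := by
  rw [low_var]
  have h₁ := D.bot_lt c i h
  have h₂ := D.bot_lt c (i + 1) fun e => h' (eq_sub_of_add_eq e)
  omega

theorem high_var_of_top {c : F} {i : (K.polygon c).Index} (b : ℤ)
    (h : i = D.top c ∨ i = D.top c - 1) : D.high (D.var c b i) = b + D.h c (D.top c) := by
  rw [high_var]
  rcases h with rfl | rfl
  · have := D.le_top c (D.top c + 1)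
    omega
  · rw [sub_add_cancel]
    have := D.le_top c (D.top c - 1)
    omega

theorem high_var_lt {c : F} {i : (K.polygon c).Index} (b : ℤ) (h : i ≠ D.top c)
    (h' : i ≠ D.top c - 1) : D.high (D.var c b i) < b + D.h c (D.top c) := by
  rw [high_var]
  have h₁ := D.lt_top c i h
  have h₂ := D.lt_top c (i + 1) fun e => h' (eq_sub_of_add_eq e)
  omega

theorem bot_le_low_var (c : F) (b : ℤ) (i : (K.polygon c).Index) :
    b + D.h c (D.bot c) ≤ D.low (D.var c b i) := by
  rw [low_var]
  have h₁ := D.bot_le c i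
  have h₂ := D.bot_le c (i + 1)
  omega

theorem low_lt_high (y : E × ℤ) : D.low y < D.high y := by
  have := D.d_ne y.1
  rw [low, high]
  omega

/-- A measure for the distance of a lift of a `1`-cell from level `0`. -/
def rank (y : E × ℤ) : ℕ ×ₗ ℕ ×ₗ ℕ :=
  if 0 ≤ D.low y then toLex (0, toLex ((D.high y).toNat, D.down.rank y.1))
  else toLex (1, toLex ((-D.low y).toNat, D.up.rank y.1))

/-- The letter of a relation which is determined by the others. -/
def sel (c : F) (b : ℤ) : (K.polygon c).Index :=
  if 0 ≤ b + D.h c (D.bot c) then D.down.child c else D.up.child c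

theorem _root_.OneVertexComplex.CornerTree.eq_parent {k : ∀ c, (K.polygon c).Index}
    (t : CornerTree K k) {c : F} {i : (K.polygon c).Index} (hi : i = k c ∨ i = k c - 1)
    (h : i ≠ t.child c) : i = t.parent c := by
  rcases t.child_parent c with ⟨h₁, h₂⟩ | ⟨h₁, h₂⟩ <;> rcases hi with rfl | rfl <;> simp_all

theorem _root_.OneVertexComplex.CornerTree.child_cases {k : ∀ c, (K.polygon c).Index}
    (t : CornerTree K k) (c : F) : t.child c = k c ∨ t.child c = k c - 1 :=
  (t.child_parent c).imp And.left And.left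

/-- If the cell lies in levels ≥ 0, its two letters at the top corner have the strictly highest
upper ends, and the tie is broken by depth in the descending tree. Otherwise the two letters at the
bottom corner have the strictly lowest lower ends, with ties broken in the ascending tree. In that
case any letter of the cell lying in levels ≥ 0 is smaller by the first coordinate of `rank`. -/
theorem rank_var_lt (c : F) (b : ℤ) (i : (K.polygon c).Index) (hi : i ≠ D.sel c b) :
    D.rank (D.var c b i) < D.rank (D.var c b (D.sel c b)) := by
  have hlh := D.low_lt_high (D.var c b i)
  have hb := D.bot_le_low_var c b i
  rw [sel] at hi ⊢
  by_cases h : 0 ≤ b + D.h c (D.bot c)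
  · rw [if_pos h] at hi ⊢
    have h1 := D.bot_le_low_var c b (D.down.child c)
    have h2 := D.high_var_of_top b (D.down.child_cases c)
    rw [rank, rank, if_pos (h.trans hb), if_pos (h.trans h1), Prod.Lex.toLex_lt_toLex]
    refine Or.inr ⟨rfl, ?_⟩
    rw [Prod.Lex.toLex_lt_toLex]
    by_cases ht : i = D.top c ∨ i = D.top c - 1
    · refine Or.inr ⟨?_, ?_⟩
      · dsimp only
        rw [h2, D.high_var_of_top b ht]
      · obtain rfl := D.down.eq_parent ht hi
        exact D.down.rank_lt c
    · have := D.high_var_lt b (not_or.1 ht).1 (not_or.1 ht).2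
      left
      dsimp only
      omega
  · rw [if_neg h] at hi ⊢
    have h2 := D.low_var_of_bot b (D.up.child_cases c)
    rw [rank, rank, h2, if_neg h]
    split_ifs with hl
    · rw [Prod.Lex.toLex_lt_toLex]
      exact Or.inl one_pos
    · rw [Prod.Lex.toLex_lt_toLex]
      refine Or.inr ⟨rfl, ?_⟩
      rw [Prod.Lex.toLex_lt_toLex]
      by_cases ht : i = D.bot c ∨ i = D.bot c - 1
      · refine Or.inr ⟨?_, ?_⟩
        · dsimp only
          rw [D.low_var_of_bot b ht]
        · obtain rfl := D.up.eq_parent ht hi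
          exact D.up.rank_lt c
      · have := D.lt_low_var b (not_or.1 ht).1 (not_or.1 ht).2
        left
        dsimp only
        omega

theorem var_injective (c : F) (i : (K.polygon c).Index) :
    Function.Injective fun b => D.var c b i := by
  intro b b' h
  have h' := congrArg Prod.snd h
  simp only [var] at h'
  split_ifs at h' <;> omega

/-- The lower end of the selected letter is negative exactly when the bottom of the cell is, so the
letter reveals which tree was used. Within one tree a child determines its edge, and its level
determines the lift. -/
theorem sel_injective :
    Function.Injective fun r : F × ℤ => D.var r.1 r.2 (D.sel r.1 r.2) := by
  rintro ⟨c, b⟩ ⟨c', b'⟩ h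
  dsimp only at h
  have hl := congrArg D.low h
  have he := congrArg Prod.fst h
  by_cases h0 : 0 ≤ b + D.h c (D.bot c)
  · by_cases h0' : 0 ≤ b' + D.h c' (D.bot c')
    · rw [sel, sel, if_pos h0, if_pos h0'] at h he
      obtain rfl := D.down.child_injective he
      rw [D.var_injective c _ h]
    · have h1 := D.bot_le_low_var c b (D.sel c b)
      rw [hl, sel, if_neg h0', D.low_var_of_bot _ (D.up.child_cases c')] at h1
      omega
  · by_cases h0' : 0 ≤ b' + D.h c' (D.bot c')
    · have h1 := D.bot_le_low_var c' b' (D.sel c' b')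
      rw [← hl, sel, if_neg h0, D.low_var_of_bot _ (D.up.child_cases c)] at h1
      omega
    · rw [sel, sel, if_neg h0, if_neg h0'] at h he
      obtain rfl := D.up.child_injective he
      rw [D.var_injective c _ h]

/-- The lifts of the relations. -/
def system : TriangularSystem (E × ℤ) (F × ℤ) where
  len r := (K.polygon r.1).extra + 2
  var r := D.var r.1 r.2
  sign r i := (K.bdry r.1 i).2
  sel r := D.sel r.1 r.2
  sel_injective := D.sel_injective
  lt := InvImage (· < ·) D.rank
  wf := InvImage.wf _ wellFounded_lt
  var_lt r i := D.rank_var_lt r.1 r.2 i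

end MorseData

end OneVertexComplex

/-! ### The action groupoid on the levels and freeness of the kernel -/

section Coverings

open CategoryTheory

section SemidirectProducts

variable {Γ A X : Type*} [Group Γ] [MulAction Γ A] [Group X]

/-- The left component of a product reads each letter at the point to which the previous right
components have moved. A word in the semidirect product therefore spells out a lifted word. -/
theorem SemidirectProduct.left_prod_ofFn {n : ℕ} (f : Fin n → (A → X) ⋊[mulAutArrow] Γ)
    (lev : ℕ → A) (h : ∀ i : Fin n, (f i).right⁻¹ • lev i = lev (i + 1)) :
    (List.ofFn f).prod.left (lev 0) = (List.ofFn fun i : Fin n => (f i).left (lev i)).prod := by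
  induction n generalizing lev with
  | zero => simp
  | succ n ih =>
    rw [List.ofFn_succ, List.prod_cons, List.ofFn_succ, List.prod_cons, SemidirectProduct.mul_left]
    have h0 := h 0
    have h1 := ih (fun i => f i.succ) (fun i => lev (i + 1)) (fun i => by simpa using h i.succ)
    simp only [Fin.val_zero, Fin.val_succ] at h0 h1 ⊢
    rw [← h1, ← h0]
    rfl

end SemidirectProducts

theorem fin_ofNat_succ {m : ℕ} (n : ℕ) : Fin.ofNat (m + 1) (n + 1) = Fin.ofNat (m + 1) n + 1 := by
  ext
  simp [Fin.ofNat, Fin.val_add]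

namespace OneVertexComplex

universe u v w

variable {E : Type u} {F : Type v}

namespace MorseData

variable {K : OneVertexComplex E F} (D : MorseData K)

theorem wordVal_ofAdd (c : F) :
    K.wordVal (fun e => Multiplicative.ofAdd (D.d e)) c = 1 := by
  refine prod_ofFn_eq_one_of_telescope _ (fun i => Multiplicative.ofAdd (-D.h c i)) fun i => ?_
  have h : letterVal (fun e => Multiplicative.ofAdd (D.d e)) (K.bdry c i) =
      Multiplicative.ofAdd (signed D.d (K.bdry c i)) := by
    rw [letterVal, signed]
    split_ifs <;> rfl
  rw [bdryVal, h, D.h_succ, ← ofAdd_neg, ← ofAdd_add]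
  congr 1
  ring

/-- The homomorphism to the integers given by the Morse function. -/
def height : K.CellGroup →* Multiplicative ℤ :=
  cellHomOf (fun e => Multiplicative.ofAdd (D.d e)) D.wordVal_ofAdd

theorem height_cellGen (e : E) : D.height (K.cellGen e) = Multiplicative.ofAdd (D.d e) :=
  cellHomOf_cellGen _ e

/-- The levels, as a set with an action of the group. -/
@[ext]
structure Level (D : MorseData K) : Type u where
  down : ℤ

/-- With the minus sign, the inverse of the generator `e` raises the level by `d e`. Reading a word
from left to right then follows its lift. -/
instance : MulAction K.CellGroup D.Level where
  smul g n := ⟨n.down - (D.height g).toAdd⟩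
  one_smul n := by
    change (⟨n.down - (D.height 1).toAdd⟩ : D.Level) = n
    rw [map_one, toAdd_one, sub_zero]
  mul_smul g g' n := by
    change (⟨n.down - (D.height (g * g')).toAdd⟩ : D.Level) =
      ⟨n.down - (D.height g').toAdd - (D.height g).toAdd⟩
    rw [map_mul, toAdd_mul]
    congr 1
    ring

theorem smul_down (g : K.CellGroup) (n : D.Level) :
    (g • n).down = n.down - (D.height g).toAdd := rfl

variable {D} {X : Type w} [Group X]

/-- The generators of a semidirect product given by values on the lifts of the `1`-cells. -/
def semiGen (x : E × ℤ → X) (e : E) : (D.Level → X) ⋊[mulAutArrow] K.CellGroup :=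
  ⟨fun n => x (e, n.down), K.cellGen e⟩

theorem left_letterVal_semiGen (x : E × ℤ → X) (c : F) (b : ℤ) (i : (K.polygon c).Index) :
    (letterVal (semiGen (D := D) x) (K.bdry c i)).left ⟨b + D.h c i⟩ =
      orientVal (K.bdry c i).2 (x (D.var c b i)) := by
  have h := D.h_succ c i
  rw [var, letterVal, orientVal]
  rw [signed] at h
  split_ifs at h ⊢ with hb
  · rfl
  · rw [SemidirectProduct.inv_left]
    change (x ((K.bdry c i).1, Level.down (((K.cellGen (K.bdry c i).1)⁻¹)⁻¹ •
      (⟨b + D.h c i⟩ : D.Level))))⁻¹ = _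
    rw [inv_inv, smul_down, height_cellGen, h]
    congr 3
    change b + D.h c i - D.d _ = _
    ring

theorem right_letterVal_semiGen (x : E × ℤ → X) (y : E × Bool) :
    (letterVal (semiGen (D := D) x) y).right = letterVal K.cellGen y :=
  map_letterVal (SemidirectProduct.rightHom) _ y

theorem height_letterVal (y : E × Bool) :
    (D.height (letterVal K.cellGen y)).toAdd = signed D.d y := by
  rw [letterVal, signed]
  split_ifs
  · rw [height_cellGen]; rfl
  · rw [map_inv, height_cellGen]; rfl

theorem left_wordVal_semiGen (x : E × ℤ → X) (c : F) (b : ℤ) :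
    (K.wordVal (semiGen (D := D) x) c).left ⟨b + D.h c 0⟩ = D.system.value x (c, b) := by
  have h := SemidirectProduct.left_prod_ofFn (K.bdryVal (semiGen (D := D) x) c)
    (fun n => (⟨b + D.h c (Fin.ofNat _ n)⟩ : D.Level)) (fun i => by
      refine Level.ext ?_
      rw [smul_down, bdryVal, right_letterVal_semiGen, map_inv, toAdd_inv, height_letterVal,
        fin_ofNat_succ, Fin.ofNat_val_eq_self, D.h_succ]
      ring)
  rw [Fin.ofNat_zero] at h
  refine h.trans ?_
  rw [TriangularSystem.value]
  congr 2
  funext i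
  rw [Fin.ofNat_val_eq_self]
  exact left_letterVal_semiGen x c b i

/-- The right component is a relator in `CellGroup`, hence trivial. The values of the left component
are the lifted relators, since each level is that of corner `0` of exactly one lift. -/
theorem wordVal_semiGen_eq_one_iff (x : E × ℤ → X) (c : F) :
    K.wordVal (semiGen (D := D) x) c = 1 ↔ ∀ b, D.system.value x (c, b) = 1 := by
  constructor
  · intro h b
    rw [← left_wordVal_semiGen, h]
    rfl
  · intro h
    refine SemidirectProduct.ext ?_ ?_
    · funext n
      have h' := left_wordVal_semiGen (D := D) x c (n.down - D.h c 0)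
      rw [sub_add_cancel, h] at h'
      exact h'
    · exact (map_wordVal SemidirectProduct.rightHom _ c).trans (wordVal_cellGen c)

variable (D) in
/-- The homomorphism to a semidirect product given by values on the lifts of the `1`-cells. -/
def semiHom (x : E × ℤ → X) (h : ∀ r, D.system.value x r = 1) :
    K.CellGroup →* (D.Level → X) ⋊[mulAutArrow] K.CellGroup :=
  cellHomOf (semiGen x) fun c => (wordVal_semiGen_eq_one_iff x c).2 fun b => h (c, b)

theorem semiHom_cellGen (x : E × ℤ → X) (h : ∀ r, D.system.value x r = 1) (e : E) :
    D.semiHom x h (K.cellGen e) = semiGen x e := cellHomOf_cellGen _ e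

theorem semiHom_right (x : E × ℤ → X) (h : ∀ r, D.system.value x r = 1) (g : K.CellGroup) :
    (D.semiHom x h g).right = g := by
  have h' : SemidirectProduct.rightHom.comp (D.semiHom x h) = MonoidHom.id _ := by
    refine cellGroup_hom_ext fun e => ?_
    rw [MonoidHom.comp_apply, semiHom_cellGen]
    rfl
  exact DFunLike.congr_fun h' g

variable (D) in
/-- A lift of a `1`-cell as a morphism. -/
def liftHom (y : E × ℤ) : @Quiver.Hom (ActionCategory K.CellGroup D.Level) _
    (((K.cellGen y.1)⁻¹ • (⟨y.2⟩ : D.Level) : D.Level) : ActionCategory K.CellGroup D.Level)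
    ((⟨y.2⟩ : D.Level) : ActionCategory K.CellGroup D.Level) :=
  ActionCategory.homOfPair (⟨y.2⟩ : D.Level) (K.cellGen y.1)

/-- A functor is given by a solution of the lifted relations. -/
theorem functor_value (G : ActionCategory K.CellGroup D.Level ⥤ SingleObj X) (r : F × ℤ) :
    D.system.value (X := X) (fun y => G.map (D.liftHom y)) r = 1 := by
  -- Currying turns a functor into a homomorphism to the semidirect product. Relators of `CellGroup`
  -- therefore hold among the images of the generators.
  have h : (fun e => ActionCategory.curry G (K.cellGen e)) =
      semiGen (D := D) (X := X) (fun y => G.map (D.liftHom y)) := by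
    funext e
    refine SemidirectProduct.ext ?_ rfl
    rfl
  obtain ⟨c, b⟩ := r
  refine (wordVal_semiGen_eq_one_iff _ c).1 ?_ b
  rw [← h, ← map_wordVal, wordVal_cellGen, map_one]

/-- A functor is determined by its curried homomorphism, the latter by its values on lifts of
1-cells, and those by the unselected lifts. -/
theorem functor_ext (G G' : ActionCategory K.CellGroup D.Level ⥤ SingleObj X)
    (h : ∀ y, y ∉ D.system.dependent → (G.map (D.liftHom y) : X) = G'.map (D.liftHom y)) : G = G' := by
  have h₁ := D.system.eq_of_value_eq_one (X := X) (functor_value G) (functor_value G') h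
  have h₂ : ActionCategory.curry G = ActionCategory.curry G' := by
    refine cellGroup_hom_ext fun e => ?_
    refine SemidirectProduct.ext ?_ rfl
    funext n
    exact congrFun h₁ (e, n.down)
  apply Functor.hext
  · intro _
    apply Unit.ext
  · refine ActionCategory.cases fun t g => ?_
    have h₃ : (ActionCategory.curry G g).left t = (ActionCategory.curry G' g).left t := by rw [h₂]
    exact heq_of_eq h₃

variable (D) in
/-- The action groupoid on the levels is free on the lifts of `1`-cells which are not selected in any
lift of a relation. -/
@[reducible]
noncomputable def isFreeGroupoid : IsFreeGroupoid (ActionCategory K.CellGroup D.Level) where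
  quiverGenerators := ⟨fun a b =>
    {e : E // K.cellGen e • a.back = b.back ∧ (e, b.back.down) ∉ D.system.dependent}⟩
  of e := ⟨K.cellGen e.1, e.2.1⟩
  unique_lift := by
    intro X _ f
    let a : E × ℤ → X := fun y => open Classical in
      if h : y ∉ D.system.dependent then
        @f ⟨(), ((K.cellGen y.1)⁻¹ • (⟨y.2⟩ : D.Level) : D.Level)⟩ ⟨(), ⟨y.2⟩⟩
          ⟨y.1, smul_inv_smul _ _, h⟩ else 1
    have ha : ∀ y (hy : y ∉ D.system.dependent), a y =
        @f ⟨(), ((K.cellGen y.1)⁻¹ • (⟨y.2⟩ : D.Level) : D.Level)⟩ ⟨(), ⟨y.2⟩⟩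
          ⟨y.1, smul_inv_smul _ _, hy⟩ := fun y hy => dif_pos hy
    have hx : ∀ r, D.system.value (D.system.solution a) r = 1 := D.system.value_solution a
    refine ⟨ActionCategory.uncurry (D.semiHom _ hx) (semiHom_right _ hx), ?_, ?_⟩
    · rintro ⟨⟨⟩, p⟩ ⟨⟨⟩, q⟩ ⟨e, h, hq⟩
      change D.Level at p q
      have h₁ : p = (K.cellGen e)⁻¹ • q := (inv_smul_eq_iff.mpr h.symm).symm
      subst h₁
      have h₂ : (D.semiHom _ hx (K.cellGen e)).left q = D.system.solution a (e, q.down) := by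
        rw [semiHom_cellGen]
        rfl
      exact h₂.trans ((D.system.solution_of_notMem a hq).trans (ha _ hq))
    · intro G hG
      refine functor_ext _ _ fun y hy => ?_
      have h₁ := hG ⟨(), ((K.cellGen y.1)⁻¹ • (⟨y.2⟩ : D.Level) : D.Level)⟩ ⟨(), ⟨y.2⟩⟩
          ⟨y.1, smul_inv_smul _ _, hy⟩
      refine h₁.trans ?_
      change _ = (D.semiHom _ hx (K.cellGen y.1)).left ⟨y.2⟩
      rw [semiHom_cellGen]
      change _ = D.system.solution a y
      rw [D.system.solution_of_notMem a hy]
      exact (ha y hy).symm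

/-- If the height is onto, the levels form a single orbit and the groupoid is connected. Vertex
groups of connected free groupoids are free, and the stabilizer of level `0` is the kernel. -/
theorem isFreeGroup_ker (hD : Function.Surjective D.height) : IsFreeGroup D.height.ker := by
  have : MulAction.IsPretransitive K.CellGroup D.Level := by
    refine ⟨fun m n => ?_⟩
    obtain ⟨g, hg⟩ := hD (Multiplicative.ofAdd (m.down - n.down))
    refine ⟨g, Level.ext ?_⟩
    rw [smul_down, hg, toAdd_ofAdd]
    ring
  have : Nonempty D.Level := ⟨⟨0⟩⟩
  have hc : IsConnected (ActionCategory K.CellGroup D.Level) := inferInstance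
  have hc' : @IsConnected (ActionCategory K.CellGroup D.Level) Groupoid.toCategory := hc
  have := D.isFreeGroupoid
  let p : ActionCategory K.CellGroup D.Level := ((⟨0⟩ : D.Level) : ActionCategory _ _)
  have h := IsFreeGroupoid.endIsFreeOfConnectedFree p
  have e : ∀ g : K.CellGroup, g • (⟨0⟩ : D.Level) = ⟨0⟩ ↔ g ∈ D.height.ker := by
    intro g
    rw [MonoidHom.mem_ker]
    constructor
    · intro hg
      have := congrArg Level.down hg
      rw [smul_down] at this
      rw [← toAdd_eq_zero]
      omega
    · intro hg
      refine Level.ext ?_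
      rw [smul_down, hg, toAdd_one, sub_zero]
  exact @IsFreeGroup.ofMulEquiv _ _ h _ _
    { toFun := fun f => ⟨f.1, (e _).1 f.2⟩
      invFun := fun g => ⟨g.1, (e _).2 g.2⟩
      left_inv := fun f => rfl
      right_inv := fun g => rfl
      map_mul' := fun f g => rfl }

end MorseData

end OneVertexComplex

end Coverings

/-! ### Finitely generated free groups and extensions by the integers -/

section FreeByCyclic

/-- The basis elements give pairwise different indicator homomorphisms to `ZMod 2`, each determined
by its values on a finite generating set. There are finitely many such value patterns. -/
theorem finite_of_fg_freeGroup {α : Type*} [Group.FG (FreeGroup α)] : Finite α := by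
  classical
  obtain ⟨S, hS, hfin⟩ := (Group.fg_iff (G := FreeGroup α)).1 inferInstance
  let f : α → FreeGroup α →* Multiplicative (ZMod 2) := fun a =>
    FreeGroup.lift (Pi.mulSingle a (Multiplicative.ofAdd 1))
  have := hfin.to_subtype
  refine Finite.of_injective (fun a => fun s : S => f a s) fun a b hab => ?_
  have h : f a = f b := MonoidHom.eq_of_eqOn_dense hS fun s hs => congrFun hab ⟨s, hs⟩
  have h' := DFunLike.congr_fun h (FreeGroup.of a)
  simp only [f, FreeGroup.lift_apply_of, Pi.mulSingle_eq_same] at h'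
  by_contra hne
  rw [Pi.mulSingle_eq_of_ne hne] at h'
  exact absurd h' (by decide)

theorem exists_mulEquiv_freeGroup_fin (G : Type*) [Group G] [IsFreeGroup G] [Group.FG G] :
    ∃ k : ℕ, Nonempty (G ≃* FreeGroup (Fin k)) := by
  have h : Group.FG (FreeGroup (IsFreeGroup.Generators G)) :=
    Group.fg_of_surjective (f := (IsFreeGroup.toFreeGroup G).toMonoidHom)
      (IsFreeGroup.toFreeGroup G).surjective
  have := finite_of_fg_freeGroup (α := IsFreeGroup.Generators G)
  obtain ⟨k, ⟨e⟩⟩ := Finite.exists_equiv_fin (IsFreeGroup.Generators G)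
  exact ⟨k, ⟨(IsFreeGroup.toFreeGroup G).trans (FreeGroup.freeGroupCongr e)⟩⟩

variable {G : Type*} [Group G] (φ : G →* Multiplicative ℤ)

theorem ofAdd_zpow_toAdd (n : Multiplicative ℤ) :
    Multiplicative.ofAdd (1 : ℤ) ^ (Multiplicative.toAdd n) = n := by
  rw [← ofAdd_zsmul, smul_eq_mul, mul_one, ofAdd_toAdd]

/-- A group with a homomorphism onto the integers is a semidirect product. -/
theorem exists_semidirectProduct_ker_mulEquiv (hφ : Function.Surjective φ) :
    ∃ θ : Multiplicative ℤ →* MulAut φ.ker, Nonempty (φ.ker ⋊[θ] Multiplicative ℤ ≃* G) := by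
  obtain ⟨t, ht⟩ := hφ (Multiplicative.ofAdd 1)
  let s : Multiplicative ℤ →* G := zpowersHom G t
  have hs : ∀ n, φ (s n) = n := by
    intro n
    rw [zpowersHom_apply, map_zpow, ht, ofAdd_zpow_toAdd]
  refine ⟨MulAut.conjNormal.comp s, ⟨MulEquiv.ofBijective
    (SemidirectProduct.lift φ.ker.subtype s fun n => ?_) ⟨?_, ?_⟩⟩⟩
  · ext x
    simp
  · rw [injective_iff_map_eq_one]
    intro x hx
    have hx' : (x.left : G) * s x.right = 1 := hx
    have h := congrArg φ hx'
    rw [map_mul, hs, map_one, (MonoidHom.mem_ker).1 x.left.2, one_mul] at h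
    rw [h, map_one, mul_one] at hx'
    exact SemidirectProduct.ext (Subtype.ext hx') h
  · intro g
    refine ⟨⟨⟨g * (s (φ g))⁻¹, ?_⟩, φ g⟩, ?_⟩
    · rw [MonoidHom.mem_ker, map_mul, map_inv, hs, mul_inv_cancel]
    · exact inv_mul_cancel_right g (s (φ g))

theorem isFinFreeByCyclic_of_fg_ker (hφ : Function.Surjective φ) (hfree : IsFreeGroup φ.ker)
    (hfg : φ.ker.FG) : IsFinFreeByCyclic G := by
  have : Group.FG φ.ker := (Group.fg_iff_subgroup_fg _).2 hfg
  obtain ⟨k, ⟨e⟩⟩ := exists_mulEquiv_freeGroup_fin φ.ker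
  obtain ⟨θ, ⟨ε⟩⟩ := exists_semidirectProduct_ker_mulEquiv φ hφ
  exact ⟨k, _, ⟨ε.symm.trans (SemidirectProduct.congr' (φ₁ := θ) e (MulEquiv.refl _))⟩⟩

theorem IsFinFreeByCyclic.of_mulEquiv {H : Type*} [Group H] (e : G ≃* H)
    (h : IsFinFreeByCyclic H) : IsFinFreeByCyclic G := by
  obtain ⟨k, θ, ⟨ε⟩⟩ := h
  exact ⟨k, θ, ⟨e.trans ε⟩⟩

theorem IsFreeByCyclic.of_mulEquiv {H : Type*} [Group H] (e : G ≃* H)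
    (h : IsFreeByCyclic H) : IsFreeByCyclic G := by
  obtain ⟨φ, hφ, hfree⟩ := h
  refine ⟨φ.comp e.toMonoidHom, hφ.comp e.surjective, ?_⟩
  have ε : φ.ker ≃* (φ.comp e.toMonoidHom).ker :=
    { toFun := fun x => ⟨e.symm x, by
        rw [MonoidHom.mem_ker]
        exact (congrArg φ (e.apply_symm_apply _)).trans x.2⟩
      invFun := fun x => ⟨e x, x.2⟩
      left_inv := fun x => Subtype.ext (e.apply_symm_apply _)
      right_inv := fun x => Subtype.ext (e.symm_apply_apply _)
      map_mul' := fun x y => Subtype.ext (map_mul e.symm (x : H) y) }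
  exact IsFreeGroup.ofMulEquiv ε

end FreeByCyclic

/-! ### Sections of the height with prescribed steps on either side of level 0 -/

section Sections

variable {G : Type*} [Group G] (t : G) (D D' : ℤ) (r r' : G)

/-- A function on the integers with `γ (n + D) = γ n * r` for `0 ≤ n`. -/
def ascendingSection (n : ℤ) : G := t ^ (n % D) * r ^ (n / D)

theorem ascendingSection_add (hD : D ≠ 0) (n : ℤ) :
    ascendingSection t D r (n + D) = ascendingSection t D r n * r := by
  rw [ascendingSection, ascendingSection, Int.add_emod_right, Int.add_ediv_of_dvd_right dvd_rfl,
    Int.ediv_self hD, zpow_add_one, mul_assoc]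

/-- A function on the integers with `γ (n + D) = γ n * r` for `0 ≤ n` and `γ (n + D') = γ n * r'` for
`n < 0`. -/
def twoSidedSection (n : ℤ) : G :=
  if 0 ≤ n then ascendingSection t D r n else ascendingSection t D r (n % D') * r' ^ (n / D')

theorem twoSidedSection_zero : twoSidedSection t D D' r r' 0 = 1 := by
  simp [twoSidedSection, ascendingSection]

theorem twoSidedSection_add_of_nonneg (hD : 0 < D) {n : ℤ} (hn : 0 ≤ n) :
    twoSidedSection t D D' r r' (n + D) = twoSidedSection t D D' r r' n * r := by
  rw [twoSidedSection, twoSidedSection, if_pos hn, if_pos (by omega),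
    ascendingSection_add _ _ _ hD.ne']

theorem twoSidedSection_add_of_neg (hD' : 0 < D') {n : ℤ} (hn : n < 0) :
    twoSidedSection t D D' r r' (n + D') = twoSidedSection t D D' r r' n * r' := by
  have h1 : (n + D') / D' = n / D' + 1 := by
    rw [Int.add_ediv_of_dvd_right dvd_rfl, Int.ediv_self hD'.ne']
  have h : ascendingSection t D r ((n + D') % D') * r' ^ ((n + D') / D') =
      ascendingSection t D r (n % D') * r' ^ (n / D') * r' := by
    rw [Int.add_emod_right, h1, zpow_add_one, mul_assoc]
  rw [twoSidedSection, twoSidedSection, if_neg hn.not_ge, ← h]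
  -- If `n + D'` has crossed to the non-negative side, it is less than `D'`. The quotient then
  -- vanishes and the two formulas for the section agree.
  split_ifs with h'
  · have h2 : (n + D') / D' = 0 := Int.ediv_eq_zero_of_lt h' (by omega)
    rw [h2, zpow_zero, mul_one, Int.emod_eq_of_lt h' (by omega)]
  · rfl

theorem map_twoSidedSection (φ : G →* Multiplicative ℤ) (ht : φ t = Multiplicative.ofAdd 1)
    (hr : φ r = Multiplicative.ofAdd D) (hr' : φ r' = Multiplicative.ofAdd D') (n : ℤ) :
    φ (twoSidedSection t D D' r r' n) = Multiplicative.ofAdd n := by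
  have h : ∀ n, φ (ascendingSection t D r n) = Multiplicative.ofAdd n := by
    intro n
    rw [ascendingSection, map_mul, map_zpow, map_zpow, ht, hr, ← ofAdd_zsmul, ← ofAdd_zsmul,
      ← ofAdd_add, smul_eq_mul, smul_eq_mul, mul_one, mul_comm (n / D), Int.emod_add_mul_ediv]
  rw [twoSidedSection]
  split_ifs
  · exact h n
  · rw [map_mul, h, map_zpow, hr', ← ofAdd_zsmul, ← ofAdd_add, smul_eq_mul, mul_comm,
      Int.emod_add_mul_ediv]

end Sections

/-! ### Finite generation of the kernel and normalization of the height -/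

namespace OneVertexComplex

universe u v w

variable {E : Type u} {F : Type v}

namespace MorseData

variable {K : OneVertexComplex E F} (D : MorseData K)

section Conjugates

variable (γ : ℤ → K.CellGroup)

/-- The loop given by a lift of a `1`-cell and a section of the height. -/
def conjugate (y : E × ℤ) : K.CellGroup := γ y.2 * K.cellGen y.1 * (γ (y.2 + D.d y.1))⁻¹

theorem orientVal_conjugate (c : F) (b : ℤ) (i : (K.polygon c).Index) :
    orientVal (K.bdry c i).2 (D.conjugate γ (D.var c b i)) =
      γ (b + D.h c i) * letterVal K.cellGen (K.bdry c i) * (γ (b + D.h c (i + 1)))⁻¹ := by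
  have h := D.h_succ c i
  rw [signed] at h
  rw [orientVal, letterVal, conjugate, var]
  dsimp only
  split_ifs at h ⊢
  · rw [h, add_assoc]
  · rw [show b + D.h c (i + 1) + D.d (K.bdry c i).1 = b + D.h c i by omega]
    group

/-- The section values cancel between neighbouring letters, and what remains is a relator of
`CellGroup`; both effects are combined in one telescoping product. -/
theorem value_conjugate (r : F × ℤ) : D.system.value (D.conjugate γ) r = 1 := by
  obtain ⟨c, b⟩ := r
  have key : ∀ i, orientVal (K.bdry c i).2 (D.conjugate γ (D.var c b i)) =
      γ (b + D.h c i) * (K.cornerVal K.cellGen c i)⁻¹ *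
        (γ (b + D.h c (i + 1)) * (K.cornerVal K.cellGen c (i + 1))⁻¹)⁻¹ := by
    intro i
    rw [orientVal_conjugate, cornerVal_succ wordVal_cellGen]
    group
  exact prod_ofFn_eq_one_of_telescope _ _ key

/-- The level `n` has to vary for the induction, since the second factor of a product starts where
the first one ends. It is used at level `0` for elements of the kernel. -/
theorem conjugate_mem_of (H : Subgroup K.CellGroup) (h : ∀ y, D.conjugate γ y ∈ H)
    (g : K.CellGroup) (n : ℤ) : γ n * g * (γ (n + (D.height g).toAdd))⁻¹ ∈ H := by
  have hg : g ∈ Subgroup.closure (Set.range K.cellGen) := by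
    have := PresentedGroup.closure_range_of K.relators
    change Subgroup.closure (Set.range K.cellGen) = ⊤ at this
    rw [this]
    trivial
  induction hg using Subgroup.closure_induction generalizing n with
  | mem x hx =>
    obtain ⟨e, rfl⟩ := hx
    rw [height_cellGen]
    exact h (e, n)
  | one =>
    rw [map_one, toAdd_one, add_zero, mul_one, mul_inv_cancel]
    exact H.one_mem
  | mul x y _ _ hx hy =>
    have := H.mul_mem (hx n) (hy (n + (D.height x).toAdd))
    rw [map_mul, toAdd_mul, ← add_assoc]
    convert this using 1
    group
  | inv x _ hx =>
    have := H.inv_mem (hx (n - (D.height x).toAdd))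
    rw [sub_add_cancel] at this
    rw [map_inv, toAdd_inv, ← sub_eq_add_neg]
    convert this using 1
    group

end Conjugates

/-- The roots have unselected lifts at arbitrarily large distance from level `0`. Letting the
section advance by the descending root on the non-negative side, and by the ascending root on the
negative side, makes all their loops there trivial. -/
theorem exists_section (t : K.CellGroup) (ht : D.height t = Multiplicative.ofAdd 1) :
    ∃ γ : ℤ → K.CellGroup, γ 0 = 1 ∧ (∀ n, D.height (γ n) = Multiplicative.ofAdd n) ∧
      (∀ n, 0 ≤ D.low (D.down.root, n) → D.conjugate γ (D.down.root, n) = 1) ∧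
      ∀ n, D.low (D.up.root, n) < 0 → D.conjugate γ (D.up.root, n) = 1 := by
  let gen : E → K.CellGroup := fun e => orientVal (decide (0 < D.d e)) (K.cellGen e)
  have hgen : ∀ e, D.height (gen e) = Multiplicative.ofAdd |D.d e| := by
    intro e
    have := D.d_ne e
    by_cases h : 0 < D.d e
    · simp only [gen, orientVal, h, decide_true, if_true, height_cellGen, abs_of_pos]
    · simp only [gen, orientVal, h, decide_false, Bool.false_eq_true, if_false, map_inv,
        height_cellGen, abs_of_nonpos (not_lt.1 h), ofAdd_neg]
  let γ := twoSidedSection t |D.d D.down.root| |D.d D.up.root| (gen D.down.root) (gen D.up.root)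
  have key : ∀ e n, γ (D.low (e, n) + |D.d e|) = γ (D.low (e, n)) * gen e →
      D.conjugate γ (e, n) = 1 := by
    intro e n h
    rw [conjugate, mul_inv_eq_one]
    dsimp only
    simp only [low, gen, orientVal] at h
    by_cases hd : 0 < D.d e
    · rw [min_eq_left (by omega), abs_of_pos hd, if_pos (decide_eq_true hd)] at h
      exact h.symm
    · rw [min_eq_right (by omega), abs_of_nonpos (not_lt.1 hd), if_neg (by simpa using hd),
        add_neg_cancel_right, eq_mul_inv_iff_mul_eq] at h
      exact h
  refine ⟨γ, twoSidedSection_zero .., map_twoSidedSection _ _ _ _ _ _ ht (hgen _) (hgen _),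
    fun n hn => key _ _ ?_, fun n hn => key _ _ ?_⟩
  · exact twoSidedSection_add_of_nonneg _ _ _ _ _ (abs_pos.2 (D.d_ne _)) hn
  · exact twoSidedSection_add_of_neg _ _ _ _ _ (abs_pos.2 (D.d_ne _)) hn

/-- A non-root lift in levels ≥ 0 is selected unless the 2-cell in which it is the child at the top
corner dips below level `0`. In that case its upper end is less than the height of this 2-cell, and
finitely many 1-cells give a uniform bound. -/
theorem exists_bound [Finite E] : ∃ M : ℤ, ∀ y, y ∉ D.system.dependent → 0 ≤ D.low y →
    y.1 ≠ D.down.root → D.high y ≤ M := by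
  classical
  choose c hc using D.down.exists_child
  let M : E → ℤ := fun e => if he : e ≠ D.down.root then
    D.h (c e he) (D.top (c e he)) - D.h (c e he) (D.bot (c e he)) else 0
  obtain ⟨B, hB⟩ := (Set.finite_range M).bddAbove
  refine ⟨B, fun y hy hl he => ?_⟩
  have hM : M y.1 ≤ B := hB ⟨y.1, rfl⟩
  simp only [M, dif_pos he] at hM
  obtain ⟨e, n⟩ := y
  dsimp only at he hM
  have hc := hc e he
  generalize c e he = c at hM hc
  by_contra! hlt
  refine hy ?_
  obtain ⟨b, hb⟩ : ∃ b, D.var c b (D.down.child c) = (e, n) := by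
    refine ⟨n - if (K.bdry c (D.down.child c)).2 then D.h c (D.down.child c)
      else D.h c (D.down.child c + 1), Prod.ext hc ?_⟩
    rw [var]
    dsimp only
    split_ifs <;> ring
  have hh := D.high_var_of_top b (D.down.child_cases c)
  rw [hb] at hh
  have hs : D.sel c b = D.down.child c := if_pos (by omega)
  refine ⟨(c, b), ?_⟩
  change D.var c b (D.sel c b) = _
  rw [hs, hb]

/-- The 2-cell in which it is the child at the bottom corner has the same lowest level. That level
is negative, so its relator selects this very letter. -/
theorem mem_dependent_of_neg {y : E × ℤ} (hl : D.low y < 0) (he : y.1 ≠ D.up.root) :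
    y ∈ D.system.dependent := by
  obtain ⟨e, n⟩ := y
  obtain ⟨c, hc⟩ := D.up.exists_child e he
  obtain ⟨b, hb⟩ : ∃ b, D.var c b (D.up.child c) = (e, n) := by
    refine ⟨n - if (K.bdry c (D.up.child c)).2 then D.h c (D.up.child c)
      else D.h c (D.up.child c + 1), Prod.ext hc ?_⟩
    rw [var]
    dsimp only
    split_ifs <;> ring
  have hh := D.low_var_of_bot b (D.up.child_cases c)
  rw [hb] at hh
  have hs : D.sel c b = D.up.child c := if_neg (by omega)
  refine ⟨(c, b), ?_⟩
  change D.var c b (D.sel c b) = _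
  rw [hs, hb]

theorem fg_ker [Finite E] (hD : Function.Surjective D.height) : D.height.ker.FG := by
  obtain ⟨t, ht⟩ := hD (Multiplicative.ofAdd 1)
  obtain ⟨γ, h0, hγ, hdown, hup⟩ := D.exists_section t ht
  obtain ⟨M, hM⟩ := D.exists_bound
  -- The initial level of an unselected non-root lift lies between its lower and its upper end,
  -- hence in `[0, M]`.
  let S : Set K.CellGroup := D.conjugate γ '' (Set.univ ×ˢ Set.Icc 0 M)
  have hS : S.Finite := (Set.finite_univ.prod (Set.finite_Icc 0 M)).image _
  have hH : ∀ y, D.conjugate γ y ∈ Subgroup.closure S := by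
    refine D.system.mem_of_value_eq_one (D.value_conjugate γ) _ fun y hy => ?_
    by_cases hl : 0 ≤ D.low y
    · by_cases he : y.1 = D.down.root
      · obtain ⟨e, n⟩ := y
        dsimp only at he
        subst he
        rw [hdown n hl]
        exact Subgroup.one_mem _
      · refine Subgroup.subset_closure ⟨y, ⟨trivial, ?_⟩, rfl⟩
        have := hM y hy hl he
        rw [low] at hl
        rw [high] at this
        exact ⟨by omega, by omega⟩
    · by_cases he : y.1 = D.up.root
      · obtain ⟨e, n⟩ := y
        dsimp only at he
        subst he
        rw [hup n (not_le.1 hl)]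
        exact Subgroup.one_mem _
      · exact absurd (D.mem_dependent_of_neg (not_le.1 hl) he) hy
  refine (Subgroup.fg_iff _).2 ⟨S, le_antisymm ?_ fun g hg => ?_, hS⟩
  · rw [Subgroup.closure_le]
    rintro _ ⟨y, -, rfl⟩
    change _ ∈ D.height.ker
    rw [MonoidHom.mem_ker, conjugate, map_mul, map_mul, map_inv, hγ, hγ, height_cellGen, ofAdd_add,
      mul_inv_cancel]
  · have := D.conjugate_mem_of γ _ hH g 0
    rw [(MonoidHom.mem_ker).1 hg, toAdd_one, add_zero, h0] at this
    simpa using this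

/-- Division of the heights by a common factor of the degrees. -/
theorem exists_surjective_height (D : MorseData K) : ∃ (D' : MorseData K) (g : ℤ), g ≠ 0 ∧
    (∀ e, D.d e = g * D'.d e) ∧ Function.Surjective D'.height := by
  obtain ⟨g, hg0, hg⟩ : ∃ g : ℤ, 0 < g ∧
      AddSubgroup.closure (Set.range D.d) = AddSubgroup.zmultiples g := by
    obtain ⟨a, ha⟩ := Int.subgroup_cyclic (AddSubgroup.closure (Set.range D.d))
    have ha' : AddSubgroup.closure (Set.range D.d) = AddSubgroup.zmultiples |a| := by
      rw [ha, ← AddSubgroup.zmultiples_eq_closure]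
      rcases abs_choice a with h | h <;> rw [h]
      rw [AddSubgroup.zmultiples_neg]
    refine ⟨|a|, abs_pos.2 ?_, ha'⟩
    rintro rfl
    have h : D.d D.up.root ∈ AddSubgroup.closure (Set.range D.d) :=
      AddSubgroup.subset_closure ⟨_, rfl⟩
    rw [ha', abs_zero, AddSubgroup.zmultiples_zero_eq_bot, AddSubgroup.mem_bot] at h
    exact D.d_ne _ h
  have hd : ∀ e, ∃ k, D.d e = g * k := by
    intro e
    have h : D.d e ∈ AddSubgroup.closure (Set.range D.d) := AddSubgroup.subset_closure ⟨e, rfl⟩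
    rw [hg, Int.mem_zmultiples_iff] at h
    exact h
  choose d hd using hd
  have hs : ∀ x, signed D.d x = g * signed d x := by
    intro x
    rw [signed, signed]
    split_ifs
    · exact hd _
    · rw [hd, mul_neg]
  -- Heights in a cell need not be divisible by `g`, but their differences are. They are
  -- renormalized relative to corner `0`, and `g > 0` keeps the extremal corners and hence the
  -- trees.
  have hh : ∀ c (i : (K.polygon c).Index), ∃ k, D.h c i = D.h c 0 + g * k := by
    intro c i
    have key : ∀ n : ℕ, ∃ k, D.h c (Fin.ofNat _ n) = D.h c 0 + g * k := by
      intro n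
      induction n with
      | zero => exact ⟨0, by rw [Fin.ofNat_zero]; ring⟩
      | succ n ih =>
        obtain ⟨k, hk⟩ := ih
        exact ⟨k + signed d (K.bdry c (Fin.ofNat _ n)), by rw [fin_ofNat_succ, D.h_succ, hk, hs]; ring⟩
    have := key i
    rwa [Fin.ofNat_val_eq_self] at this
  choose h hh using hh
  have hlt : ∀ c i j, D.h c i < D.h c j → h c i < h c j := by
    intro c i j hij
    rw [hh, hh c j] at hij
    exact lt_of_mul_lt_mul_left (by omega) hg0.le
  let D' : MorseData K :=
    { d := d
      d_ne := fun e he => D.d_ne e (by rw [hd, he, mul_zero])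
      h := h
      h_succ := fun c i => by
        have := D.h_succ c i
        rw [hh, hh c i, hs] at this
        refine mul_left_cancel₀ hg0.ne' ?_
        rw [mul_add]
        omega
      bot := D.bot
      top := D.top
      bot_lt := fun c i hi => hlt _ _ _ (D.bot_lt c i hi)
      lt_top := fun c i hi => hlt _ _ _ (D.lt_top c i hi)
      up := D.up
      down := D.down }
  refine ⟨D', g, hg0.ne', hd, ?_⟩
  have h1 : (1 : ℤ) ∈ AddSubgroup.closure (Set.range d) := by
    have hr : Set.range D.d = AddMonoidHom.mulLeft g '' Set.range d := by
      rw [← Set.range_comp]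
      congr 1
      funext e
      exact hd e
    have h2 : g ∈ AddSubgroup.closure (Set.range D.d) := by
      rw [hg]
      exact AddSubgroup.mem_zmultiples g
    rw [hr, ← AddMonoidHom.map_closure] at h2
    obtain ⟨z, hz, hz'⟩ := h2
    have : z = 1 := mul_left_cancel₀ hg0.ne' (hz'.trans (mul_one g).symm)
    rwa [this] at hz
  have h2 : ∀ z ∈ AddSubgroup.closure (Set.range d), Multiplicative.ofAdd z ∈ D'.height.range := by
    intro z hz
    induction hz using AddSubgroup.closure_induction with
    | mem x hx =>
      obtain ⟨e, rfl⟩ := hx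
      exact ⟨K.cellGen e, D'.height_cellGen e⟩
    | zero => exact one_mem _
    | add x y _ _ hx hy => exact mul_mem hx hy
    | neg x _ hx => exact inv_mem hx
  intro n
  rw [← ofAdd_zpow_toAdd n]
  exact zpow_mem (h2 1 h1) _

theorem isFreeByCyclic (D : MorseData K) : IsFreeByCyclic K.CellGroup := by
  obtain ⟨D', -, -, -, h⟩ := D.exists_surjective_height
  exact ⟨D'.height, h, isFreeGroup_ker h⟩

theorem isFinFreeByCyclic [Finite E] (D : MorseData K) : IsFinFreeByCyclic K.CellGroup := by
  obtain ⟨D', -, -, -, h⟩ := D.exists_surjective_height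
  exact isFinFreeByCyclic_of_fg_ker D'.height h (isFreeGroup_ker h) (D'.fg_ker h)

end MorseData

end OneVertexComplex

/-! ### Rooted trees in the link -/

section Trees

/-- Prolonging shortest walks to `p` and to `q` by the last edge gives two paths from `r` to `w`.
Paths in a tree are unique. -/
theorem SimpleGraph.IsTree.eq_of_adj_of_dist {V : Type*} {G : SimpleGraph V} (hG : G.IsTree)
    {r w p q : V} (hp : G.Adj p w) (hq : G.Adj q w) (hdp : G.dist r w = G.dist r p + 1)
    (hdq : G.dist r w = G.dist r q + 1) : p = q := by
  obtain ⟨a, ha⟩ := hG.connected.exists_walk_length_eq_dist r p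
  obtain ⟨b, hb⟩ := hG.connected.exists_walk_length_eq_dist r q
  have ha' : (a.concat hp).IsPath :=
    (a.concat hp).isPath_of_length_eq_dist (by rw [SimpleGraph.Walk.length_concat, ha, hdp])
  have hb' : (b.concat hq).IsPath :=
    (b.concat hq).isPath_of_length_eq_dist (by rw [SimpleGraph.Walk.length_concat, hb, hdq])
  have h : a.concat hp = b.concat hq := congrArg Subtype.val
    ((hG.isAcyclic.subsingleton_path r w).elim ⟨_, ha'⟩ ⟨_, hb'⟩)
  obtain ⟨h, -⟩ := SimpleGraph.Walk.concat_inj h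
  exact h

theorem SimpleGraph.IsTree.exists_adj_of_ne {V : Type*} {G : SimpleGraph V} (hG : G.IsTree)
    {r w : V} (h : w ≠ r) : ∃ p, G.Adj p w ∧ G.dist r w = G.dist r p + 1 := by
  obtain ⟨a, ha⟩ := hG.connected.exists_walk_length_eq_dist r w
  have hn : ¬ a.Nil := SimpleGraph.Walk.not_nil_of_ne h.symm
  have hadj := a.adj_penultimate hn
  refine ⟨_, hadj, ?_⟩
  have h1 := SimpleGraph.dist_le (a.dropLast)
  rcases hG.dist_eq_dist_add_one_of_adj r hadj with h2 | h2
  · have h3 : a.dropLast.length = a.length - 1 := by simp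
    omega
  · exact h2

end Trees

namespace OneVertexComplex

universe u v w

variable {E : Type u} {F : Type v} {K : OneVertexComplex E F}

/-- The same `1`-cell with the opposite orientation. -/
def flip (x : E × Bool) : E × Bool := (x.1, !x.2)

theorem signed_flip (d : E → ℤ) (x : E × Bool) : signed d (flip x) = -signed d x := by
  rcases x with ⟨e, _ | _⟩ <;> simp [signed, flip]

theorem eq_of_signed_pos {d : E → ℤ} {x y : E × Bool} (hx : 0 < signed d x) (hy : 0 < signed d y)
    (h : x.1 = y.1) : x = y := by
  rcases x with ⟨e, _ | _⟩ <;> rcases y with ⟨e', _ | _⟩ <;> simp only [signed] at * <;> subst h <;>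
    simp at * <;> omega

/-- A tree in the link with one vertex for each `1`-cell and one edge for each `2`-cell can be rooted
anywhere. -/
theorem LinkTree.exists_cornerTree (d : E → ℤ) (hd : ∀ e, d e ≠ 0) {V : Set (E × Bool)}
    {C : Set K.Corner} {k : ∀ c, (K.polygon c).Index} (hV : ∀ x, x ∈ V ↔ 0 < signed d x)
    (hC : ∀ x : K.Corner, x ∈ C ↔ x.2 = k x.1) (hk : ∀ c, 0 < signed d (K.bdry c (k c)))
    (hk' : ∀ c, signed d (K.bdry c (k c - 1)) < 0) (hT : K.LinkTree V C) (r : E) :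
    ∃ t : CornerTree K k, t.root = r := by
  classical
  obtain ⟨hdiag, hinj, htree⟩ := hT
  set G := (SimpleGraph.fromEdgeSet (K.cornerEnds '' C)).induce V with hG
  have hv : ∀ e, (e, decide (0 < d e)) ∈ V := by
    intro e
    rw [hV, signed]
    have := hd e
    by_cases h : 0 < d e
    · simp [h]
    · simp [h]
      omega
  -- Every 1-cell has exactly one end in `V`, so the vertices of the tree are indexed by the
  -- 1-cells.
  let v : E → V := fun e => ⟨(e, decide (0 < d e)), hv e⟩
  have hvV : ∀ x : V, v x.1.1 = x := by
    intro x
    exact Subtype.ext (eq_of_signed_pos ((hV _).1 (hv _)) ((hV _).1 x.2) rfl)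
  have hvinj : Function.Injective v := fun e e' h => congrArg (fun x : V => x.1.1) h
  let pos : Bool → ∀ c, (K.polygon c).Index := fun b c => if b then k c else k c - 1
  let edge : Bool → F → E := fun b c => (K.bdry c (pos b c)).1
  have hends : ∀ c, K.cornerEnds ⟨c, k c⟩ = s((v (edge true c)).1, (v (edge false c)).1) := by
    intro c
    have h1 : (v (edge true c)).1 = K.bdry c (k c) :=
      eq_of_signed_pos ((hV _).1 (hv _)) (hk c) rfl
    have h2 : (v (edge false c)).1 = flip (K.bdry c (k c - 1)) :=
      eq_of_signed_pos ((hV _).1 (hv _)) (by rw [signed_flip]; have := hk' c; omega) rfl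
    rw [h1, h2]
    rfl
  have hmem : ∀ c, (⟨c, k c⟩ : K.Corner) ∈ C := fun c => (hC _).2 rfl
  have hadj : ∀ x y : V, G.Adj x y ↔ ∃ b c, x = v (edge b c) ∧ y = v (edge (!b) c) := by
    intro x y
    rw [hG, SimpleGraph.comap_adj, SimpleGraph.fromEdgeSet_adj]
    constructor
    · rintro ⟨⟨⟨c, i⟩, hx, he⟩, -⟩
      have hi : i = k c := (hC _).1 hx
      subst hi
      rw [hends, Sym2.eq_iff] at he
      rcases he with ⟨h1, h2⟩ | ⟨h1, h2⟩
      · exact ⟨true, c, Subtype.ext h1.symm, Subtype.ext h2.symm⟩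
      · exact ⟨false, c, Subtype.ext h2.symm, Subtype.ext h1.symm⟩
    · rintro ⟨b, c, rfl, rfl⟩
      have h1 : s((v (edge b c)).1, (v (edge (!b) c)).1) = K.cornerEnds ⟨c, k c⟩ := by
        rw [hends]
        cases b
        · exact Sym2.eq_swap
        · rfl
      refine ⟨⟨_, hmem c, h1.symm⟩, fun h => hdiag _ (hmem c) ?_⟩
      rw [← h1]
      exact Sym2.mk_isDiag_iff.2 h
  have hadj' : ∀ b c, G.Adj (v (edge b c)) (v (edge (!b) c)) := fun b c =>
    (hadj _ _).2 ⟨b, c, rfl, rfl⟩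
  -- Depth is the distance to the chosen root. In a tree the two ends of an edge differ in depth by
  -- one, and the farther one is the child.
  let rk : E → ℕ := fun e => G.dist (v r) (v e)
  have hside : ∀ c, ∃ b, rk (edge b c) = rk (edge (!b) c) + 1 := by
    intro c
    rcases htree.dist_eq_dist_add_one_of_adj (v r) (hadj' true c) with h | h
    · exact ⟨true, h⟩
    · exact ⟨false, h⟩
  choose s hs using hside
  have huniq : ∀ c b, rk (edge b c) = rk (edge (!b) c) + 1 → b = s c := by
    intro c b hb
    have := hs c
    by_contra hne
    rw [Bool.eq_not_of_ne hne] at hb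
    rw [Bool.not_not] at hb
    omega
  refine ⟨{ root := r
            child := fun c => pos (s c) c
            parent := fun c => pos (!s c) c
            rank := rk
            child_parent := fun c => ?_
            rank_lt := fun c => ?_
            child_injective := fun c c' h => ?_
            child_ne := fun c h => ?_
            exists_child := fun e he => ?_ }, rfl⟩
  · cases s c
    · exact Or.inr ⟨rfl, rfl⟩
    · exact Or.inl ⟨rfl, rfl⟩
  · have := hs c
    change rk (edge _ _) < rk (edge _ _)
    omega
  · have h' : edge (s c) c = edge (s c') c' := h
    have h1 := (hadj' (s c) c).symm
    have h2 := (hadj' (s c') c').symm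
    rw [← h'] at h2
    have h3 := hs c'
    rw [← h'] at h3
    have h4 := htree.eq_of_adj_of_dist h1 h2 (hs c) h3
    -- Equal children have equal parents, so the two corners have the same ends. The link tree has
    -- no multiple edges, hence the 2-cells agree.
    have h5 : K.cornerEnds ⟨c, k c⟩ = K.cornerEnds ⟨c', k c'⟩ := by
      have key : ∀ c b, K.cornerEnds ⟨c, k c⟩ = s((v (edge b c)).1, (v (edge (!b) c)).1) := by
        intro c b
        rw [hends]
        cases b
        · exact Sym2.eq_swap
        · rfl
      rw [key c (s c), key c' (s c'), h', h4]
    exact congrArg Sigma.fst (hinj (hmem c) (hmem c') h5)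
  · have h1 : rk (edge (s c) c) = 0 := by
      have : edge (s c) c = r := h
      rw [this]
      exact SimpleGraph.dist_self
    have := hs c
    omega
  · obtain ⟨p, hp, hdist⟩ := htree.exists_adj_of_ne (r := v r) (w := v e) (hvinj.ne he)
    obtain ⟨b, c, rfl, hb⟩ := (hadj _ _).1 hp
    have hb' := hvinj hb
    refine ⟨c, ?_⟩
    have h1 : (!b) = s c := by
      refine huniq c _ ?_
      rw [Bool.not_not, ← hb']
      exact hdist
    change edge (s c) c = e
    rw [← h1, hb']

end OneVertexComplex

/-! ### From circle-valued Morse functions to integral Morse data -/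

namespace OneVertexComplex

universe u v w

variable {E : Type u} {F : Type v} {K : OneVertexComplex E F}

namespace MorseMap

variable (f : K.MorseMap)

/-- An affine function with integral values on the unit interval is constant. -/
theorem _root_.AffineMap.apply_zero_eq_apply_one_of_int (g : ℝ →ᵃ[ℝ] ℝ)
    (hg : ∀ t : unitInterval, ∃ n : ℤ, g t = n) : g 0 = g 1 := by
  set s := g 1 - g 0 with hs
  have hline : ∀ t : ℝ, g t = g 0 + t * s := by
    intro t
    have h := g.apply_lineMap 0 1 t
    rw [AffineMap.lineMap_apply_ring', AffineMap.lineMap_apply_ring'] at h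
    simp only [sub_zero, mul_one, add_zero] at h
    rw [h]
    ring
  have hpos : 0 < 2 * (|s| + 1) := by positivity
  -- So small that the change `t * s` is less than `1` in absolute value. Being an integer it is
  -- `0`, and since `t ≠ 0` the slope vanishes.
  let t : unitInterval := ⟨1 / (2 * (|s| + 1)), by positivity, by
    rw [div_le_one hpos]
    have := abs_nonneg s
    linarith⟩
  obtain ⟨m, hm⟩ := hg t
  obtain ⟨n, hn⟩ := hg 0
  have h := hline t
  have hn' : g 0 = n := by simpa using hn
  have hts : (t : ℝ) * s = ((m - n : ℤ) : ℝ) := by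
    push_cast
    rw [← hm, ← hn', h]
    ring
  have hlt : |(t : ℝ) * s| < 1 := by
    rw [abs_mul, abs_of_nonneg t.2.1]
    change 1 / (2 * (|s| + 1)) * |s| < 1
    rw [one_div, ← div_eq_inv_mul, div_lt_one hpos]
    have := abs_nonneg s
    linarith
  rw [hts, ← Int.cast_abs] at hlt
  have h0 : m - n = 0 := by
    have : |m - n| < 1 := by exact_mod_cast hlt
    exact Int.abs_lt_one_iff.1 this
  rw [h0, Int.cast_zero, mul_eq_zero] at hts
  have ht : (t : ℝ) ≠ 0 := (show (0 : ℝ) < 1 / (2 * (|s| + 1)) by positivity).ne'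
  have := hts.resolve_left ht
  linarith

/-- The increment of a lift along an oriented `1`-cell. -/
noncomputable def increment (x : E × Bool) : ℝ := if x.2 then f.degree x.1 else -f.degree x.1

/-- Along a side, the lift on the 2-cell and the lift on the 1-cell cover the same map to the
circle. Their difference is affine with integral values on `[0, 1]`, hence takes equal values at
both ends. -/
theorem cellLift_succ (c : F) (i : (K.polygon c).Index) :
    f.cellLift c ((K.polygon c).vertex (i + 1)) =
      f.cellLift c ((K.polygon c).vertex i) + f.increment (K.bdry c i) := by
  let ω : ℝ →ᵃ[ℝ] ℝ := if (K.bdry c i).2 then AffineMap.id ℝ ℝ else AffineMap.lineMap 1 0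
  have hω : ∀ t : unitInterval, ω t = ((if (K.bdry c i).2 then t else unitInterval.symm t :
      unitInterval) : ℝ) := by
    intro t
    by_cases h : (K.bdry c i).2
    · simp [ω, h]
    · simp only [ω, h, Bool.false_eq_true, if_false, unitInterval.coe_symm_eq]
      rw [AffineMap.lineMap_apply_ring']
      ring
  let g : ℝ →ᵃ[ℝ] ℝ := (f.cellLift c).comp (AffineMap.lineMap ((K.polygon c).vertex i) ((K.polygon c).vertex (i + 1))) -
    (f.edgeLift (K.bdry c i).1).comp ω
  have hg : ∀ t : unitInterval, ∃ n : ℤ, g t = n := by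
    intro t
    have h1 := f.cellLift_spec c ((K.polygon c).side i t)
    have h2 := f.edgeLift_spec (K.bdry c i).1 (if (K.bdry c i).2 then t else unitInterval.symm t)
    have h3 : K.cellMap c ((K.polygon c).side i t) =
        K.edgeMap (K.bdry c i).1 (if (K.bdry c i).2 then t else unitInterval.symm t) :=
      Quot.sound (Glue.side c i t)
    rw [h3, ← h2] at h1
    have h4 : ((g t : ℝ) : UnitAddCircle) = 0 := by
      have : g t = f.cellLift c ((K.polygon c).side i t) -
          f.edgeLift (K.bdry c i).1 ((if (K.bdry c i).2 then t else unitInterval.symm t : unitInterval) : ℝ) := by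
        rw [← hω]
        rfl
      rw [this, AddCircle.coe_sub, h1, sub_self]
    obtain ⟨n, hn⟩ := (AddCircle.coe_eq_zero_iff (1 : ℝ)).1 h4
    exact ⟨n, by rw [← hn]; simp⟩
  have h := g.apply_zero_eq_apply_one_of_int hg
  have h0 : g 0 = f.cellLift c ((K.polygon c).vertex i) - f.edgeLift (K.bdry c i).1 (ω 0) := by
    change f.cellLift c (AffineMap.lineMap ((K.polygon c).vertex i) ((K.polygon c).vertex (i + 1)) (0 : ℝ)) - _ = _
    rw [AffineMap.lineMap_apply_zero]
    rfl
  have h1 : g 1 = f.cellLift c ((K.polygon c).vertex (i + 1)) - f.edgeLift (K.bdry c i).1 (ω 1) := by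
    change f.cellLift c (AffineMap.lineMap ((K.polygon c).vertex i) ((K.polygon c).vertex (i + 1)) (1 : ℝ)) - _ = _
    rw [AffineMap.lineMap_apply_one]
    rfl
  have h2 : f.edgeLift (K.bdry c i).1 (ω 1) - f.edgeLift (K.bdry c i).1 (ω 0) = f.increment (K.bdry c i) := by
    rw [increment, degree]
    by_cases h : (K.bdry c i).2
    · simp [ω, h]
    · simp [ω, h]
  rw [h0, h1] at h
  linarith

theorem increment_ne_zero (x : E × Bool) : f.increment x ≠ 0 := by
  have h : f.degree x.1 ≠ 0 := sub_ne_zero.2 (f.edgeLift_nonconst x.1).symm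
  rw [increment]
  split_ifs
  exacts [h, neg_ne_zero.2 h]

theorem increment_eq_cast {d : E → ℤ} (hd : ∀ e, f.degree e = d e) (x : E × Bool) :
    f.increment x = signed d x := by
  rw [increment, signed, hd]
  split_ifs
  · rfl
  · push_cast
    rfl

theorem cellLift_vertex_ne (c : F) (i : (K.polygon c).Index) :
    f.cellLift c ((K.polygon c).vertex i) ≠ f.cellLift c ((K.polygon c).vertex (i + 1)) := by
  rw [cellLift_succ]
  have := f.increment_ne_zero (K.bdry c i)
  intro h
  exact this (by linarith)

theorem edgeLift_apply (e : E) (t : ℝ) : f.edgeLift e t = f.edgeLift e 0 + t * f.degree e := by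
  have h := (f.edgeLift e).apply_lineMap 0 1 t
  rw [AffineMap.lineMap_apply_ring', AffineMap.lineMap_apply_ring'] at h
  simp only [sub_zero, mul_one, add_zero] at h
  rw [h, degree]
  ring

theorem increment_eq (x : E × Bool) (t : ℝ) :
    f.edgeLift x.1 t - f.edgeLift x.1 (endTime x.2) =
      (if x.2 then t else 1 - t) * f.increment x := by
  rw [f.edgeLift_apply x.1 t, f.edgeLift_apply x.1 (endTime x.2), endTime, increment]
  split_ifs <;> ring

theorem mem_ascVertices_iff (x : E × Bool) : x ∈ f.ascVertices ↔ 0 < f.increment x := by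
  constructor
  · intro h
    have h0 := h 0
    have h1 := h 1
    have e0 := f.increment_eq x (0 : unitInterval)
    have e1 := f.increment_eq x (1 : unitInterval)
    refine lt_of_le_of_ne ?_ (f.increment_ne_zero x).symm
    split_ifs at e0 e1 <;> simp at e0 e1 h0 h1 <;> linarith
  · intro h t
    have e := f.increment_eq x t
    have : 0 ≤ (if x.2 then (t : ℝ) else 1 - t) := by
      split_ifs
      exacts [t.2.1, sub_nonneg.2 t.2.2]
    have := mul_nonneg this h.le
    linarith

theorem mem_descVertices_iff (x : E × Bool) : x ∈ f.descVertices ↔ f.increment x < 0 := by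
  constructor
  · intro h
    have h0 := h 0
    have h1 := h 1
    have e0 := f.increment_eq x (0 : unitInterval)
    have e1 := f.increment_eq x (1 : unitInterval)
    refine lt_of_le_of_ne ?_ (f.increment_ne_zero x)
    split_ifs at e0 e1 <;> simp at e0 e1 h0 h1 <;> linarith
  · intro h t
    have e := f.increment_eq x t
    have : 0 ≤ (if x.2 then (t : ℝ) else 1 - t) := by
      split_ifs
      exacts [t.2.1, sub_nonneg.2 t.2.2]
    have := mul_nonpos_of_nonneg_of_nonpos this h.le
    linarith

theorem exists_top (c : F) : ∃ i, ∀ x ∈ (K.polygon c).region, x ≠ (K.polygon c).vertex i →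
    f.cellLift c x < f.cellLift c ((K.polygon c).vertex i) :=
  (K.polygon c).exists_strict_max _ (f.cellLift_vertex_ne c)

theorem exists_bot (c : F) : ∃ i, ∀ x ∈ (K.polygon c).region, x ≠ (K.polygon c).vertex i →
    f.cellLift c ((K.polygon c).vertex i) < f.cellLift c x := by
  obtain ⟨i, hi⟩ := (K.polygon c).exists_strict_max (-f.cellLift c) fun i h =>
    f.cellLift_vertex_ne c i (neg_injective h)
  exact ⟨i, fun x hx hne => neg_lt_neg_iff.1 (hi x hx hne)⟩

/-- Since no side is level, each extremum on a polygon is attained at a single vertex. Both links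
then have one edge for each 2-cell and one vertex for each 1-cell, and a tree of this kind can be
rooted at any 1-cell. -/
theorem exists_morseData (hasc : f.AscendingLinkTree) (hdesc : f.DescendingLinkTree) (r r' : E) :
    ∃ D : MorseData K, (∀ e, f.degree e = D.d e) ∧ D.up.root = r ∧ D.down.root = r' := by
  choose d hd using f.degree_int
  have hinc := f.increment_eq_cast hd
  have hd0 : ∀ e, d e ≠ 0 := by
    intro e he
    have := f.increment_ne_zero (e, true)
    rw [hinc, signed, if_pos rfl, he, Int.cast_zero] at this
    exact this rfl
  have hh : ∀ c (i : (K.polygon c).Index), ∃ n : ℤ, f.cellLift c ((K.polygon c).vertex i) =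
      f.cellLift c ((K.polygon c).vertex 0) + n := by
    intro c i
    have key : ∀ n : ℕ, ∃ k : ℤ, f.cellLift c ((K.polygon c).vertex (Fin.ofNat _ n)) =
        f.cellLift c ((K.polygon c).vertex 0) + k := by
      intro n
      induction n with
      | zero => exact ⟨0, by rw [Fin.ofNat_zero, Int.cast_zero, add_zero]⟩
      | succ n ih =>
        obtain ⟨k, hk⟩ := ih
        refine ⟨k + signed d (K.bdry c (Fin.ofNat _ n)), ?_⟩
        rw [fin_ofNat_succ, cellLift_succ, hk, hinc]
        push_cast
        ring
    have := key i
    rwa [Fin.ofNat_val_eq_self] at this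
  choose h hh using hh
  choose top htop using f.exists_top
  choose bot hbot using f.exists_bot
  have hlt : ∀ c i j, f.cellLift c ((K.polygon c).vertex i) < f.cellLift c ((K.polygon c).vertex j) →
      h c i < h c j := by
    intro c i j hij
    rw [hh, hh c j, add_lt_add_iff_left] at hij
    exact_mod_cast hij
  have htop' : ∀ c i, i ≠ top c → f.cellLift c ((K.polygon c).vertex i) <
      f.cellLift c ((K.polygon c).vertex (top c)) := fun c i hi =>
    htop c _ ((K.polygon c).vertex_mem i) ((K.polygon c).vertex_injective.ne hi)
  have hbot' : ∀ c i, i ≠ bot c → f.cellLift c ((K.polygon c).vertex (bot c)) <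
      f.cellLift c ((K.polygon c).vertex i) := fun c i hi =>
    hbot c _ ((K.polygon c).vertex_mem i) ((K.polygon c).vertex_injective.ne hi)
  have hsucc : ∀ c (i : (K.polygon c).Index), h c (i + 1) = h c i + signed d (K.bdry c i) := by
    intro c i
    have := f.cellLift_succ c i
    rw [hh, hh c i, hinc] at this
    have h' : (h c (i + 1) : ℝ) = h c i + signed d (K.bdry c i) := by linarith
    exact_mod_cast h'
  have hbotlt : ∀ c i, i ≠ bot c → h c (bot c) < h c i := fun c i hi => hlt _ _ _ (hbot' c i hi)
  have hlttop : ∀ c i, i ≠ top c → h c i < h c (top c) := fun c i hi => hlt _ _ _ (htop' c i hi)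
  obtain ⟨up, hup⟩ := LinkTree.exists_cornerTree (k := bot) d hd0
    (fun x => (f.mem_ascVertices_iff x).trans (by rw [hinc]; exact Int.cast_pos))
    (fun x => by
      constructor
      · intro hx
        by_contra hne
        exact (hx _ ((K.polygon x.1).vertex_mem (bot x.1))).not_gt (hbot' _ _ hne)
      · intro hx y hy
        rw [hx]
        by_cases hy' : y = (K.polygon x.1).vertex (bot x.1)
        · rw [hy']
        · exact (hbot _ y hy hy').le)
    (fun c => by
      have h1 := hsucc c (bot c)
      have h2 := hbotlt c (bot c + 1) ((K.polygon c).succ_ne _)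
      omega)
    (fun c => by
      have h1 := hsucc c (bot c - 1)
      have h2 := hbotlt c (bot c - 1) ((K.polygon c).pred_ne _)
      rw [sub_add_cancel] at h1
      omega) hasc r
  have hneg : ∀ x, signed (fun e => -d e) x = -signed d x := by
    intro x
    rw [signed, signed]
    split_ifs <;> ring
  -- The descending link is the ascending link for the negated degrees.
  obtain ⟨down, hdown⟩ := LinkTree.exists_cornerTree (k := top) (fun e => -d e)
    (fun e => neg_ne_zero.2 (hd0 e))
    (fun x => (f.mem_descVertices_iff x).trans (by
      rw [hinc, hneg, Left.neg_pos_iff]; exact Int.cast_lt_zero))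
    (fun x => by
      constructor
      · intro hx
        by_contra hne
        exact (hx _ ((K.polygon x.1).vertex_mem (top x.1))).not_gt (htop' _ _ hne)
      · intro hx y hy
        rw [hx]
        by_cases hy' : y = (K.polygon x.1).vertex (top x.1)
        · rw [hy']
        · exact (htop _ y hy hy').le)
    (fun c => by
      have h1 := hsucc c (top c)
      have h2 := hlttop c (top c + 1) ((K.polygon c).succ_ne _)
      rw [hneg]
      omega)
    (fun c => by
      have h1 := hsucc c (top c - 1)
      have h2 := hlttop c (top c - 1) ((K.polygon c).pred_ne _)
      rw [sub_add_cancel] at h1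
      rw [hneg]
      omega) hdesc r'
  exact ⟨⟨d, hd0, h, hsucc, bot, top, hbotlt, hlttop, up, down⟩, hd, hup, hdown⟩

end MorseMap

namespace MorseData

/-- The data of the Morse function with the opposite sign. -/
def neg (D : MorseData K) : MorseData K where
  d e := -D.d e
  d_ne e := neg_ne_zero.2 (D.d_ne e)
  h c i := -D.h c i
  h_succ c i := by
    rw [D.h_succ, signed, signed]
    split_ifs <;> ring
  bot := D.top
  top := D.bot
  bot_lt c i hi := neg_lt_neg (D.lt_top c i hi)
  lt_top c i hi := neg_lt_neg (D.bot_lt c i hi)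
  up := D.down
  down := D.up

end MorseData

/-! ### The attached square joins the links of the two factors -/

section Amalgam

universe u₁ v₁ u₂ v₂

variable {E₁ : Type u₁} {F₁ : Type v₁} {E₂ : Type u₂} {F₂ : Type v₂} {K₁ : OneVertexComplex E₁ F₁}
  {K₂ : OneVertexComplex E₂ F₂} {w : Fin 4 → (E₁ ⊕ E₂) × Bool}

/-- A choice of a corner for each `2`-cell of a wedge with an attached square. -/
def amalgamCorner (k₁ : ∀ c, (K₁.polygon c).Index) (k₂ : ∀ c, (K₂.polygon c).Index) (k : Fin 4) :
    ∀ c, (((wedge K₁ K₂).attachSquare w).polygon c).Index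
  | none => k
  | some (Sum.inl c) => k₁ c
  | some (Sum.inr c) => k₂ c

/-- Two trees are joined to one tree by the edge given by a corner of the square. -/
def CornerTree.amalgam {k₁ : ∀ c, (K₁.polygon c).Index} {k₂ : ∀ c, (K₂.polygon c).Index}
    (t₁ : CornerTree K₁ k₁) (t₂ : CornerTree K₂ k₂) (k : Fin 4) (x : E₁)
    (hx : (w k).1 = Sum.inl x) (hy : (w (k - 1)).1 = Sum.inr t₂.root) :
    CornerTree ((wedge K₁ K₂).attachSquare w) (amalgamCorner k₁ k₂ k) where
  root := Sum.inl t₁.root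
  -- The root of the second tree becomes a child of `x`, so only the second tree needs a prescribed
  -- root. Its ranks are shifted to lie above that of `x`.
  child := amalgamCorner t₁.child t₂.child (k - 1)
  parent := amalgamCorner t₁.parent t₂.parent k
  rank := Sum.elim t₁.rank fun e => t₁.rank x + 1 + t₂.rank e
  child_parent := by
    rintro (_ | c | c)
    · exact Or.inr ⟨rfl, rfl⟩
    · exact t₁.child_parent c
    · exact t₂.child_parent c
  rank_lt := by
    rintro (_ | c | c)
    · change Sum.elim _ _ (w k).1 < Sum.elim _ _ (w (k - 1)).1
      rw [hx, hy]
      change t₁.rank x < t₁.rank x + 1 + _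
      omega
    · exact t₁.rank_lt c
    · exact Nat.add_lt_add_left (t₂.rank_lt c) _
  child_injective := by
    have h0 : ∀ c, (w (k - 1)).1 ≠ Sum.inr (K₂.bdry c (t₂.child c)).1 := by
      intro c h
      rw [hy] at h
      exact t₂.child_ne c (Sum.inr_injective h).symm
    have h0' : ∀ e, (w (k - 1)).1 ≠ Sum.inl e := by
      intro e h
      rw [hy] at h
      cases h
    rintro (_ | c | c) (_ | c' | c') h
    · rfl
    · exact absurd h (h0' _)
    · exact absurd h (h0 _)
    · exact absurd h.symm (h0' _)
    · exact congrArg _ (congrArg _ (t₁.child_injective (Sum.inl_injective h)))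
    · cases h
    · exact absurd h.symm (h0 _)
    · cases h
    · exact congrArg _ (congrArg _ (t₂.child_injective (Sum.inr_injective h)))
  child_ne := by
    rintro (_ | c | c) h
    · have h' : (w (k - 1)).1 = Sum.inl t₁.root := h
      rw [hy] at h'
      cases h'
    · exact t₁.child_ne c (Sum.inl_injective h)
    · cases h
  exists_child := by
    rintro (e | e) he
    · obtain ⟨c, hc⟩ := t₁.exists_child e fun h => he (congrArg _ h)
      exact ⟨some (Sum.inl c), congrArg Sum.inl hc⟩
    · by_cases h : e = t₂.root
      · exact ⟨none, h ▸ hy⟩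
      · obtain ⟨c, hc⟩ := t₂.exists_child e h
        exact ⟨some (Sum.inr c), congrArg Sum.inr hc⟩

theorem partialSums_succ {a b c d : ℤ} (h : a + b + c + d = 0) (i : Fin 4) :
    (![0, a, a + b, a + b + c] : Fin 4 → ℤ) (i + 1) =
      (![0, a, a + b, a + b + c] : Fin 4 → ℤ) i + (![a, b, c, d] : Fin 4 → ℤ) i := by
  fin_cases i
  · exact (zero_add a).symm
  · rfl
  · rfl
  · exact h.symm

/-- Morse data on a wedge with an attached square. -/
theorem MorseData.exists_amalgam (D₁ : MorseData K₁) (D₂ : MorseData K₂) (x₀ x₁ : E₁ × Bool)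
    (y₀ y₁ : E₂ × Bool) (hx₀ : 0 < signed D₁.d x₀) (hy₁ : 0 < signed D₂.d y₁)
    (hx₁ : signed D₁.d x₁ < 0) (hy₀ : signed D₂.d y₀ < 0)
    (hsum : signed D₁.d x₀ + signed D₂.d y₁ + signed D₁.d x₁ + signed D₂.d y₀ = 0)
    (hup : D₂.up.root = y₀.1) (hdown : D₂.down.root = y₁.1) :
    Nonempty (MorseData ((wedge K₁ K₂).attachSquare
      ![inLeft x₀, inRight y₁, inLeft x₁, inRight y₀])) := by
  refine ⟨{ d := Sum.elim D₁.d D₂.d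
            d_ne := ?_
            h := fun c => match c with
              | none => (![0, signed D₁.d x₀, signed D₁.d x₀ + signed D₂.d y₁,
                  signed D₁.d x₀ + signed D₂.d y₁ + signed D₁.d x₁] : Fin 4 → ℤ)
              | some (Sum.inl c) => D₁.h c
              | some (Sum.inr c) => D₂.h c
            h_succ := ?_
            -- The word climbs along two sides and then descends along two. Corner `0`, between `y₀`
            -- and `x₀`, is therefore the only minimum, and corner `2`, between `y₁` and `x₁`, the
            -- only maximum.
            bot := amalgamCorner D₁.bot D₂.bot 0
            top := amalgamCorner D₁.top D₂.top 2
            bot_lt := ?_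
            lt_top := ?_
            up := D₁.up.amalgam D₂.up 0 x₀.1 rfl (by rw [hup]; rfl)
            down := D₁.down.amalgam D₂.down 2 x₁.1 rfl (by rw [hdown]; rfl) }⟩
  · rintro (e | e)
    · exact D₁.d_ne e
    · exact D₂.d_ne e
  · rintro (_ | c | c) i
    · change Fin 4 at i
      have e : ![signed D₁.d x₀, signed D₂.d y₁, signed D₁.d x₁, signed D₂.d y₀] i =
          signed (Sum.elim D₁.d D₂.d) (![inLeft x₀, inRight y₁, inLeft x₁, inRight y₀] i) := by
        fin_cases i <;> rfl
      exact (partialSums_succ hsum i).trans (congrArg _ e)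
    · exact D₁.h_succ c i
    · exact D₂.h_succ c i
  · rintro (_ | c | c) i hi
    · change Fin 4 at i
      fin_cases i
      · exact absurd rfl hi
      · exact hx₀
      · exact add_pos hx₀ hy₁
      · change 0 < signed D₁.d x₀ + signed D₂.d y₁ + signed D₁.d x₁
        omega
    · exact D₁.bot_lt c i hi
    · exact D₂.bot_lt c i hi
  · rintro (_ | c | c) i hi
    · change Fin 4 at i
      fin_cases i
      · exact add_pos hx₀ hy₁
      · exact lt_add_of_pos_right _ hy₁
      · exact absurd rfl hi
      · change signed D₁.d x₀ + signed D₂.d y₁ + signed D₁.d x₁ <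
          signed D₁.d x₀ + signed D₂.d y₁
        omega
    · exact D₁.lt_top c i hi
    · exact D₂.lt_top c i hi

end Amalgam

end OneVertexComplex

/-! ### Orientation of the letters and maps onto ℤ² -/

namespace OneVertexComplex

universe u v w u₁ v₁ u₂ v₂

section Letters

variable {E : Type u} {F : Type v} {K : OneVertexComplex E F}

theorem signed_mul (d : E → ℤ) (g : ℤ) (x : E × Bool) :
    signed (fun e => g * d e) x = g * signed d x := by
  rw [signed, signed]
  split_ifs <;> ring

theorem signed_zero (x : E × Bool) : signed (fun _ : E => (0 : ℤ)) x = 0 := by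
  rw [signed]
  split_ifs <;> rfl

theorem signed_comp_odd (d : E → ℤ) (g : ℤ → ℤ) (hg : ∀ n, g (-n) = -g n) (x : E × Bool) :
    signed (fun e => g (d e)) x = g (signed d x) := by
  rw [signed, signed]
  split_ifs
  · rfl
  · rw [hg]

theorem MorseMap.signed_letter (f : K.MorseMap) {d : E → ℤ} (hd : ∀ e, f.degree e = d e) (s : Bool)
    (e : E) : signed d (f.letter s e) = if s then |d e| else -|d e| := by
  have h : (0 < f.degree e) ↔ 0 < d e := by rw [hd]; exact Int.cast_pos
  simp only [signed, MorseMap.letter, h]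
  by_cases h' : 0 < d e
  · rw [abs_of_pos h']
    cases s <;> simp [h']
  · rw [abs_of_nonpos (not_lt.1 h')]
    cases s <;> simp [h']

/-- A decreasing traversal for `f` is an increasing one for `-f`. Negation exchanges the two link
trees, so for `s = false` the roots are requested in the opposite order. -/
theorem MorseMap.exists_oriented_morseData (f : K.MorseMap) (hasc : f.AscendingLinkTree)
    (hdesc : f.DescendingLinkTree) (s : Bool) (r r' : E) :
    ∃ D : MorseData K, (∀ e, |f.degree e| = |D.d e|) ∧
      (∀ e, signed D.d (f.letter s e) = |D.d e|) ∧ (∀ e, signed D.d (f.letter (!s) e) = -|D.d e|) ∧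
      D.up.root = r ∧ D.down.root = r' := by
  cases s
  · obtain ⟨D, hd, hr, hr'⟩ := f.exists_morseData hasc hdesc r' r
    have hneg : ∀ x, signed D.neg.d x = -signed D.d x := by
      intro x
      simp only [signed, MorseData.neg]
      split_ifs <;> ring
    have habs : ∀ e, |D.neg.d e| = |D.d e| := fun e => abs_neg _
    refine ⟨D.neg, fun e => ?_, fun e => ?_, fun e => ?_, hr', hr⟩
    · rw [hd, ← Int.cast_abs, habs]
    · rw [hneg, f.signed_letter hd, habs]
      simp
    · rw [hneg, f.signed_letter hd, habs]
      simp
  · obtain ⟨D, hd, hr, hr'⟩ := f.exists_morseData hasc hdesc r r'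
    refine ⟨D, fun e => by rw [hd, Int.cast_abs], fun e => ?_, fun e => ?_, hr, hr'⟩
    · rw [f.signed_letter hd]
      simp
    · rw [f.signed_letter hd]
      simp

theorem wordVal_ofAdd_eq (a : E → ℤ) (c : F) : K.wordVal (fun e => Multiplicative.ofAdd (a e)) c =
    Multiplicative.ofAdd (∑ i, signed a (K.bdry c i)) := by
  have h : ∀ x, letterVal (fun e => Multiplicative.ofAdd (a e)) x =
      Multiplicative.ofAdd (signed a x) := by
    intro x
    rw [letterVal, signed]
    split_ifs <;> rfl
  rw [wordVal, List.prod_ofFn, ofAdd_sum]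
  exact Finset.prod_congr rfl fun i _ => h _

theorem wordVal_one {G : Type*} [Group G] (c : F) : K.wordVal (fun _ => (1 : G)) c = 1 := by
  have h := map_wordVal (K := K) (1 : K.CellGroup →* G) K.cellGen c
  rw [wordVal_cellGen, map_one] at h
  exact h.symm

/-- Opposite sides of a parallelogram contribute opposite values. -/
theorem _root_.ConvexPolygon.IsParallelogram.sum_odd {P : ConvexPolygon} (hP : P.IsParallelogram)
    (f : (ℝ × ℝ) →ᵃ[ℝ] ℝ) (a : P.Index → ℤ)
    (ha : ∀ i, f (P.vertex (i + 1)) = f (P.vertex i) + a i) (g : ℤ → ℤ) (hg : ∀ n, g (-n) = -g n) :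
    ∑ i, g (a i) = 0 := by
  obtain ⟨n, v, hconv⟩ := P
  obtain ⟨hn, hv⟩ := hP
  dsimp only at hn
  subst hn
  change Fin 4 → ℤ at a
  change Fin 4 → ℝ × ℝ at v
  change v 0 + v 2 = v 1 + v 3 at hv
  change ∀ i : Fin 4, f (v (i + 1)) = f (v i) + a i at ha
  change ∑ i : Fin 4, g (a i) = 0
  have hf : f (v 0) + f (v 2) = f (v 1) + f (v 3) := by
    have hl : ∀ x, f x = f.linear x + f 0 := fun x => congrFun f.decomp x
    rw [hl (v 0), hl (v 1), hl (v 2), hl (v 3)]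
    have := congrArg f.linear hv
    rw [map_add, map_add] at this
    linarith
  have h0 : f (v 1) = f (v 0) + a 0 := ha 0
  have h1 : f (v 2) = f (v 1) + a 1 := ha 1
  have h2 : f (v 3) = f (v 2) + a 2 := ha 2
  have e2 : a 2 = -a 0 := by
    have : (a 2 : ℝ) = -a 0 := by linarith
    exact_mod_cast this
  have h3 : f (v 0) = f (v 3) + a 3 := ha 3
  have e3 : a 3 = -a 1 := by
    have : (a 3 : ℝ) = -a 1 := by linarith
    exact_mod_cast this
  rw [Fin.sum_univ_four, e2, e3, hg, hg]
  ring

/-- Opposite sides of a parallelogram have opposite increments, and oddness preserves this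
cancellation. Arbitrary odd functions of the degree, not only linear ones, therefore define
homomorphisms. -/
theorem MorseMap.wordVal_odd (f : K.MorseMap) {d : E → ℤ} (hd : ∀ e, f.degree e = d e)
    (hK : K.IsSquared) (g : ℤ → ℤ) (hg : ∀ n, g (-n) = -g n) (c : F) :
    K.wordVal (fun e => Multiplicative.ofAdd (g (d e))) c = 1 := by
  rw [wordVal_ofAdd_eq, ← ofAdd_zero]
  congr 1
  simp only [signed_comp_odd d g hg]
  refine (hK c).sum_odd (f.cellLift c) _ (fun i => ?_) g hg
  rw [f.cellLift_succ, f.increment_eq_cast hd]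

end Letters

theorem surjective_prod_of_axes {G : Type*} [Group G] (φ ψ : G →* Multiplicative ℤ)
    (hφ : ∀ m, ∃ g, φ g = m ∧ ψ g = 1) (hψ : ∀ m, ∃ g, φ g = 1 ∧ ψ g = m) :
    ∃ χ : G →* Multiplicative (ℤ × ℤ), Function.Surjective χ := by
  have h : Function.Surjective (φ.prod ψ) := by
    rintro ⟨m, n⟩
    obtain ⟨g, hg, hg'⟩ := hφ m
    obtain ⟨k, hk, hk'⟩ := hψ n
    exact ⟨g * k, Prod.ext (by simp [hg, hk]) (by simp [hg', hk'])⟩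
  exact ⟨(MulEquiv.prodMultiplicative ℤ ℤ).symm.toMonoidHom.comp (φ.prod ψ),
    fun x => by
      obtain ⟨g, hg⟩ := h (MulEquiv.prodMultiplicative ℤ ℤ x)
      exact ⟨g, (congrArg _ hg).trans (MulEquiv.symm_apply_apply _ x)⟩⟩

/-- The odd function with value `k` at `m` which vanishes away from `m` and `-m`. -/
def oddBump (m k n : ℤ) : ℤ := if n = m then k else if n = -m then -k else 0

theorem oddBump_neg {m : ℤ} (hm : m ≠ 0) (k n : ℤ) : oddBump m k (-n) = -oddBump m k n := by
  simp only [oddBump]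
  split_ifs <;> omega

theorem oddBump_self (m k : ℤ) : oddBump m k m = k := if_pos rfl

theorem oddBump_of_abs_ne {m k n : ℤ} (h : |n| ≠ |m|) : oddBump m k n = 0 := by
  rw [oddBump, if_neg, if_neg]
  · rintro rfl
    exact h (abs_neg m)
  · rintro rfl
    exact h rfl

theorem abs_oddBump_abs (n : ℤ) : |oddBump |n| 1 n| = 1 := by
  rw [oddBump]
  rcases abs_choice n with h | h
  · rw [if_pos h.symm, abs_one]
  · split_ifs with h1 h2
    · exact abs_one
    · rw [abs_neg, abs_one]
    · exact absurd (by rw [h, neg_neg]) h2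

section Amalgam

variable {E₁ : Type u₁} {F₁ : Type v₁} {E₂ : Type u₂} {F₂ : Type v₂} {K₁ : OneVertexComplex E₁ F₁}
  {K₂ : OneVertexComplex E₂ F₂} {x₀ x₁ : E₁ × Bool} {y₀ y₁ : E₂ × Bool}

/-- Homomorphisms to the integers which agree on the attached square extend. -/
theorem exists_hom_amalgam {a : E₁ → ℤ} {b : E₂ → ℤ}
    (ha : ∀ c, K₁.wordVal (fun e => Multiplicative.ofAdd (a e)) c = 1)
    (hb : ∀ c, K₂.wordVal (fun e => Multiplicative.ofAdd (b e)) c = 1)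
    (h : signed a x₀ + signed b y₁ + signed a x₁ + signed b y₀ = 0) :
    ∃ φ : ((wedge K₁ K₂).attachSquare ![inLeft x₀, inRight y₁, inLeft x₁, inRight y₀]).CellGroup →*
      Multiplicative ℤ, (∀ e, φ (cellGen _ (Sum.inl e)) = Multiplicative.ofAdd (a e)) ∧
      ∀ e, φ (cellGen _ (Sum.inr e)) = Multiplicative.ofAdd (b e) := by
  refine ⟨cellHomOf (fun e => Multiplicative.ofAdd (Sum.elim a b e)) ?_,
    fun e => cellHomOf_cellGen _ _, fun e => cellHomOf_cellGen _ _⟩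
  rintro (_ | c | c)
  · rw [wordVal_ofAdd_eq, ← ofAdd_zero]
    congr 1
    change ∑ i : Fin 4, signed (Sum.elim a b)
      ((![inLeft x₀, inRight y₁, inLeft x₁, inRight y₀] : Fin 4 → (E₁ ⊕ E₂) × Bool) i) = 0
    rw [Fin.sum_univ_four]
    exact h
  · exact ha c
  · exact hb c

/-- The square is balanced in each factor separately, so the height of either factor extends by zero
over the other. Normalized heights are onto, and the two axes of ℤ² are reached from the two
factors. -/
theorem exists_surjective_of_balanced (D₁ : MorseData K₁) (D₂ : MorseData K₂)
    (h₁ : signed D₁.d x₀ + signed D₁.d x₁ = 0) (h₂ : signed D₂.d y₁ + signed D₂.d y₀ = 0) :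
    ∃ χ : ((wedge K₁ K₂).attachSquare ![inLeft x₀, inRight y₁, inLeft x₁, inRight y₀]).CellGroup →*
      Multiplicative (ℤ × ℤ), Function.Surjective χ := by
  obtain ⟨D₁', g₁, hg₁, hd₁, hs₁⟩ := D₁.exists_surjective_height
  obtain ⟨D₂', g₂, hg₂, hd₂, hs₂⟩ := D₂.exists_surjective_height
  have h₁' : signed D₁'.d x₀ + signed D₁'.d x₁ = 0 := by
    refine mul_left_cancel₀ hg₁ ?_
    rw [mul_add, ← signed_mul, ← signed_mul, mul_zero, ← funext hd₁]
    exact h₁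
  have h₂' : signed D₂'.d y₁ + signed D₂'.d y₀ = 0 := by
    refine mul_left_cancel₀ hg₂ ?_
    rw [mul_add, ← signed_mul, ← signed_mul, mul_zero, ← funext hd₂]
    exact h₂
  obtain ⟨φ, hφ, hφ'⟩ := exists_hom_amalgam (x₀ := x₀) (x₁ := x₁) (y₀ := y₀) (y₁ := y₁)
    (K₂ := K₂) (b := fun _ => 0) D₁'.wordVal_ofAdd wordVal_one (by rw [signed_zero, signed_zero]; omega)
  obtain ⟨ψ, hψ, hψ'⟩ := exists_hom_amalgam (x₀ := x₀) (x₁ := x₁) (y₀ := y₀) (y₁ := y₁)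
    (K₁ := K₁) (a := fun _ => 0) wordVal_one D₂'.wordVal_ofAdd (by rw [signed_zero, signed_zero]; omega)
  let ι₁ : K₁.CellGroup →* _ := cellHomOf (fun e => cellGen _ (Sum.inl e)) fun c =>
    wordVal_cellGen (K := (wedge K₁ K₂).attachSquare
      ![inLeft x₀, inRight y₁, inLeft x₁, inRight y₀]) (some (Sum.inl c))
  let ι₂ : K₂.CellGroup →* _ := cellHomOf (fun e => cellGen _ (Sum.inr e)) fun c =>
    wordVal_cellGen (K := (wedge K₁ K₂).attachSquare
      ![inLeft x₀, inRight y₁, inLeft x₁, inRight y₀]) (some (Sum.inr c))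
  have hι₁ : ∀ e, ι₁ (K₁.cellGen e) = cellGen _ (Sum.inl e) := fun e => cellHomOf_cellGen _ e
  have hι₂ : ∀ e, ι₂ (K₂.cellGen e) = cellGen _ (Sum.inr e) := fun e => cellHomOf_cellGen _ e
  have e₁ : φ.comp ι₁ = D₁'.height := cellGroup_hom_ext fun e => by
    rw [MonoidHom.comp_apply, hι₁, hφ, D₁'.height_cellGen]
  have e₂ : ψ.comp ι₁ = 1 := cellGroup_hom_ext fun e => by
    rw [MonoidHom.comp_apply, hι₁, hψ]
    rfl
  have e₃ : φ.comp ι₂ = 1 := cellGroup_hom_ext fun e => by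
    rw [MonoidHom.comp_apply, hι₂, hφ']
    rfl
  have e₄ : ψ.comp ι₂ = D₂'.height := cellGroup_hom_ext fun e => by
    rw [MonoidHom.comp_apply, hι₂, hψ', D₂'.height_cellGen]
  refine surjective_prod_of_axes φ ψ (fun m => ?_) fun m => ?_
  · obtain ⟨g, hg⟩ := hs₁ m
    exact ⟨ι₁ g, (DFunLike.congr_fun e₁ g).trans hg, DFunLike.congr_fun e₂ g⟩
  · obtain ⟨g, hg⟩ := hs₂ m
    exact ⟨ι₂ g, DFunLike.congr_fun e₃ g, (DFunLike.congr_fun e₄ g).trans hg⟩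

theorem exists_zpow_eq {G : Type*} [Group G] (φ ψ : G →* Multiplicative ℤ) {x : G} {k : ℤ}
    (hk : |k| = 1) (hφ : φ x = Multiplicative.ofAdd k) (hψ : ψ x = 1) (m : Multiplicative ℤ) :
    ∃ g, φ g = m ∧ ψ g = 1 := by
  refine ⟨x ^ (k * m.toAdd), ?_, ?_⟩
  · have hkk : k * k = 1 := by rw [← abs_mul_abs_self, hk, one_mul]
    rw [map_zpow, hφ, ← ofAdd_zsmul, smul_eq_mul, mul_right_comm, hkk, one_mul, ofAdd_toAdd]
  · rw [map_zpow, hψ, one_zpow]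

/-- One homomorphism counts the 1-cells of `K₁` of degree `±|α₀|`, the other those of degree
`±|α₁|`. The resulting imbalance on the square is compensated in `K₂` by a bump at `|β₀|`, which
does not affect `b₁` because `|β₀| ≠ |β₁|`. -/
theorem exists_surjective_of_squared (f₁ : K₁.MorseMap) (f₂ : K₂.MorseMap) {d₁ : E₁ → ℤ}
    {d₂ : E₂ → ℤ} (hd₁ : ∀ e, f₁.degree e = d₁ e) (hd₂ : ∀ e, f₂.degree e = d₂ e)
    (h₁ : ∀ e, d₁ e ≠ 0) (h₂ : ∀ e, d₂ e ≠ 0)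
    (hK₁ : K₁.IsSquared) (hK₂ : K₂.IsSquared) (a₀ a₁ : E₁) (b₀ b₁ : E₂)
    (hab : |d₁ a₀| + |d₂ b₁| = |d₁ a₁| + |d₂ b₀|) (hne : |d₁ a₀| ≠ |d₁ a₁|) (s t : Bool) :
    ∃ χ : (squareAmalgam f₁ f₂ a₀ a₁ b₀ b₁ s t).CellGroup →*
      Multiplicative (ℤ × ℤ), Function.Surjective χ := by
  let ε : Bool → ℤ := fun b => if b then 1 else -1
  have hne' : |d₂ b₁| ≠ |d₂ b₀| := by omega
  have habs₁ : ∀ e, |d₁ e| ≠ 0 := fun e => abs_ne_zero.2 (h₁ e)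
  have habs₂ : ∀ e, |d₂ e| ≠ 0 := fun e => abs_ne_zero.2 (h₂ e)
  have hl₁ : ∀ b e, signed d₁ (f₁.letter b e) = if b then |d₁ e| else -|d₁ e| :=
    f₁.signed_letter hd₁
  have hl₂ : ∀ b e, signed d₂ (f₂.letter b e) = if b then |d₂ e| else -|d₂ e| :=
    f₂.signed_letter hd₂
  have hodd : ∀ (g : ℤ → ℤ) (_ : ∀ n, g (-n) = -g n) (b : Bool) (n : ℤ),
      g (if b then n else -n) = ε b * g n := by
    intro g hg b n
    cases b
    · simp only [ε, Bool.false_eq_true, if_false, hg, neg_mul, one_mul]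
    · simp only [ε, if_true, one_mul]
  have hε : ∀ b, ε (!b) = -ε b := by
    intro b
    cases b <;> rfl
  have hεε : ∀ b, ε b * ε b = 1 := by
    intro b
    cases b <;> rfl
  have key : ∀ (g₁ g₂ : ℤ → ℤ), (∀ n, g₁ (-n) = -g₁ n) → (∀ n, g₂ (-n) = -g₂ n) →
      ε s * (g₁ |d₁ a₀| - g₁ |d₁ a₁|) + ε t * (g₂ |d₂ b₁| - g₂ |d₂ b₀|) = 0 →
      ∃ φ : (squareAmalgam f₁ f₂ a₀ a₁ b₀ b₁ s t).CellGroup →* Multiplicative ℤ,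
        (∀ e, φ (cellGen _ (Sum.inl e)) = Multiplicative.ofAdd (g₁ (d₁ e))) ∧
        ∀ e, φ (cellGen _ (Sum.inr e)) = Multiplicative.ofAdd (g₂ (d₂ e)) := by
    intro g₁ g₂ hg₁ hg₂ h
    refine exists_hom_amalgam (f₁.wordVal_odd hd₁ hK₁ g₁ hg₁) (f₂.wordVal_odd hd₂ hK₂ g₂ hg₂) ?_
    rw [signed_comp_odd _ _ hg₁, signed_comp_odd _ _ hg₁, signed_comp_odd _ _ hg₂,
      signed_comp_odd _ _ hg₂, hl₁, hl₁, hl₂, hl₂, hodd g₁ hg₁, hodd g₁ hg₁, hodd g₂ hg₂,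
      hodd g₂ hg₂, hε, hε, ← h]
    ring
  have hb₁ : ∀ k, oddBump |d₂ b₀| k |d₂ b₁| = 0 := fun k =>
    oddBump_of_abs_ne (by rw [abs_abs, abs_abs]; exact hne')
  -- The side `a₀` contributes `ε s`, so `b₀`, with coefficient `-ε t`, has to carry `ε s * ε t`.
  -- For `ψ` the sign changes because `a₁` is traversed the other way.
  obtain ⟨φ, hφ, -⟩ := key (oddBump |d₁ a₀| 1) (oddBump |d₂ b₀| (ε s * ε t))
    (oddBump_neg (habs₁ _) _) (oddBump_neg (habs₂ _) _) (by
      rw [oddBump_self, oddBump_self, hb₁, oddBump_of_abs_ne (by rw [abs_abs, abs_abs]; exact hne.symm)]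
      have := hεε t
      linear_combination (-ε s) * this)
  obtain ⟨ψ, hψ, -⟩ := key (oddBump |d₁ a₁| 1) (oddBump |d₂ b₀| (-(ε s * ε t)))
    (oddBump_neg (habs₁ _) _) (oddBump_neg (habs₂ _) _) (by
      rw [oddBump_self, oddBump_self, hb₁, oddBump_of_abs_ne (by rw [abs_abs, abs_abs]; exact hne)]
      have := hεε t
      linear_combination (ε s) * this)
  refine surjective_prod_of_axes φ ψ (exists_zpow_eq φ ψ (abs_oddBump_abs (d₁ a₀)) (hφ a₀) ?_)
    fun m => ?_
  · rw [hψ, oddBump_of_abs_ne (by rw [abs_abs]; exact hne), ofAdd_zero]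
  · obtain ⟨g, hg, hg'⟩ := exists_zpow_eq ψ φ (abs_oddBump_abs (d₁ a₁)) (hψ a₁)
      (by rw [hφ, oddBump_of_abs_ne (by rw [abs_abs]; exact hne.symm), ofAdd_zero]) m
    exact ⟨g, hg', hg⟩

end Amalgam

end OneVertexComplex

/-! ### The theorem -/

theorem mainTheorem2 {E₁ F₁ E₂ F₂ : Type*}
    (K₁ : OneVertexComplex E₁ F₁) (K₂ : OneVertexComplex E₂ F₂)
    (f₁ : K₁.MorseMap) (f₂ : K₂.MorseMap)
    (hasc₁ : f₁.AscendingLinkTree) (hdesc₁ : f₁.DescendingLinkTree)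
    (hasc₂ : f₂.AscendingLinkTree) (hdesc₂ : f₂.DescendingLinkTree)
    (a₀ a₁ : E₁) (b₀ b₁ : E₂)
    (hab : |f₁.degree a₀| + |f₂.degree b₁| = |f₁.degree a₁| + |f₂.degree b₀|)
    (s t : Bool) :
    IsFreeByCyclic (OneVertexComplex.squareAmalgam f₁ f₂ a₀ a₁ b₀ b₁ s t).Pi1 ∧
    (Finite E₁ → Finite E₂ →
      IsFinFreeByCyclic (OneVertexComplex.squareAmalgam f₁ f₂ a₀ a₁ b₀ b₁ s t).Pi1) ∧
    ((K₁.IsSquared ∧ K₂.IsSquared) ∨ |f₁.degree a₀| = |f₁.degree a₁| →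
      ∃ ψ : (OneVertexComplex.squareAmalgam f₁ f₂ a₀ a₁ b₀ b₁ s t).Pi1 →*
        Multiplicative (ℤ × ℤ), Function.Surjective ψ) := by
  set K := OneVertexComplex.squareAmalgam f₁ f₂ a₀ a₁ b₀ b₁ s t with hK
  -- The roots chosen for `K₁` are immaterial. Those for `K₂` must be `b₀` and `b₁`, the 1-cells of
  -- `K₂` at the lowest and at the highest corner of the square.
  obtain ⟨D₁, hD₁, hpos₁, hneg₁, -, -⟩ := f₁.exists_oriented_morseData hasc₁ hdesc₁ s a₀ a₀
  obtain ⟨D₂, hD₂, hpos₂, hneg₂, hup, hdown⟩ :=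
    f₂.exists_oriented_morseData hasc₂ hdesc₂ t b₀ b₁
  have hsum : |D₁.d a₀| + |D₂.d b₁| = |D₁.d a₁| + |D₂.d b₀| := by
    rw [hD₁, hD₁, hD₂, hD₂] at hab
    exact_mod_cast hab
  obtain ⟨D⟩ : Nonempty (OneVertexComplex.MorseData K) :=
    D₁.exists_amalgam D₂ (f₁.letter s a₀) (f₁.letter (!s) a₁) (f₂.letter (!t) b₀) (f₂.letter t b₁)
      (by rw [hpos₁]; exact abs_pos.2 (D₁.d_ne _)) (by rw [hpos₂]; exact abs_pos.2 (D₂.d_ne _))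
      (by rw [hneg₁]; exact neg_neg_of_pos (abs_pos.2 (D₁.d_ne _)))
      (by rw [hneg₂]; exact neg_neg_of_pos (abs_pos.2 (D₂.d_ne _)))
      (by rw [hpos₁, hpos₂, hneg₁, hneg₂]; omega) hup hdown
  have hsurj : (∃ χ : K.CellGroup →* Multiplicative (ℤ × ℤ), Function.Surjective χ) →
      ∃ ψ : K.Pi1 →* Multiplicative (ℤ × ℤ), Function.Surjective ψ := by
    rintro ⟨χ, hχ⟩
    exact ⟨χ.comp K.pi1Equiv.toMonoidHom, hχ.comp K.pi1Equiv.surjective⟩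
  refine ⟨D.isFreeByCyclic.of_mulEquiv K.pi1Equiv, fun _ _ =>
    D.isFinFreeByCyclic.of_mulEquiv K.pi1Equiv, fun h => hsurj ?_⟩
  -- Splitting by equality rather than by the hypothesis sends squared complexes with equal degrees
  -- to the balanced case, so the bumps are needed only for different absolute values.
  by_cases heq : |D₁.d a₀| = |D₁.d a₁|
  · exact OneVertexComplex.exists_surjective_of_balanced D₁ D₂
      (by rw [hpos₁, hneg₁]; omega) (by rw [hpos₂, hneg₂]; omega)
  · rcases h with ⟨hK₁, hK₂⟩ | h
    · obtain ⟨d₁, hd₁⟩ : ∃ d₁ : E₁ → ℤ, ∀ e, f₁.degree e = d₁ e := by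
        choose d hd using f₁.degree_int
        exact ⟨d, hd⟩
      obtain ⟨d₂, hd₂⟩ : ∃ d₂ : E₂ → ℤ, ∀ e, f₂.degree e = d₂ e := by
        choose d hd using f₂.degree_int
        exact ⟨d, hd⟩
      have he₁ : ∀ e, |d₁ e| = |D₁.d e| := by
        intro e
        have := hD₁ e
        rw [hd₁] at this
        exact_mod_cast this
      have he₂ : ∀ e, |d₂ e| = |D₂.d e| := by
        intro e
        have := hD₂ e
        rw [hd₂] at this
        exact_mod_cast this
      refine OneVertexComplex.exists_surjective_of_squared f₁ f₂ hd₁ hd₂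
        (fun e => abs_ne_zero.1 ?_) (fun e => abs_ne_zero.1 ?_) hK₁ hK₂ a₀ a₁ b₀ b₁ ?_ ?_ s t
      · rw [he₁]
        exact abs_ne_zero.2 (D₁.d_ne e)
      · rw [he₂]
        exact abs_ne_zero.2 (D₂.d_ne e)
      · rw [he₁, he₁, he₂, he₂, hsum]
      · rw [he₁, he₁]
        exact heq
    · rw [hD₁, hD₁] at h
      exact absurd (by exact_mod_cast h) heq
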